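/- Let $k$ be an algebraically closed field of characteristic $p>0$. All group schemes are over $k$. A \emph{$\mathrm{BT}_1$ group scheme} is a finite commutative group scheme $G$ that is killed by $p$ and satisfies $\ker(\mathrm{Frob})=\operatorname{im}(\mathrm{Ver})$ and $\ker(\mathrm{Ver})=\operatorname{im}(\mathrm{Frob})$, where $\mathrm{Frob}:G\to G^{(p)}$ and $\mathrm{Ver}:G^{(p)}\to G$ are Frobenius and Verschiebung. A \emph{principal quasipolarization} on $G$ is an isomorphism $\psi:G\to G^D$ to the Cartier dual with $\psi^D=-\psi$ (for $p=2$ one usually requires more of $\psi$; the statement below needs only this condition). Let $I_{1,1}$ be the $\mathrm{BT}_1$ group scheme of rank $p^2$ with Dieudonné module $\mathbb{E}/\mathbb{E}(F+V)$, where $\mathbb{E}=k[F,V]$ is the Cartier ring modulo $p$; concretely, $I_{1,1}$ is the kernel of $F+V$ on the group scheme $W_2$ of $p$-typical Witt vectors of length two. Let $(G,\psi)$ be a principally quasipolarized $\mathrm{BT}_1$ group scheme of rank $p^{2g}$. Let $$f=\dim_{\mathbb{F}_p}\operatorname{Hom}(\boldsymbol{\mu}_p,G),\qquad a=\dim_k\operatorname{Hom}(\boldsymbol{\alpha}_p,G)$$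 be its $p$-rank and $a$-number, and let its superspecial rank $s$ be the largest integer $s$ for which there is a closed subgroup scheme $H\subset G$ with $H\simeq I_{1,1}^s$ such that the composite $H\hookrightarrow G\xrightarrow{\ \psi\ }G^D\twoheadrightarrow H^D$ is an isomorphism. Then: (a) $0\le s\le a\le g-f$. (b) If $a=g-f$, then $G\simeq(\mathbb{Z}/p\oplus\boldsymbol{\mu}_p)^f\oplus I_{1,1}^a$ as group schemes, and $s=a$. (c) If $a\ne g-f$, then $s<a$. -/

import Mathlib

open scoped TensorProduct Polynomial
open Coalgebra

/-! Finite commutative group schemes over a field `k` are treated through their coordinate rings: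
`G = Spec A` with `A` a finite-dimensional commutative cocommutative Hopf algebra over `k`.
A homomorphism `Spec B → Spec A` is a bialgebra homomorphism `A →ₐc[k] B`, a closed subgroup scheme
is a surjective such homomorphism, a product of group schemes is a tensor product. -/

set_option linter.unusedSectionVars false

noncomputable section

namespace BT1

universe u v

/-! ### Cartier duality -/

section Dual

variable (k : Type u) [Field k] (A : Type v) [CommRing A] [HopfAlgebra k A]

/-- The coordinate ring of the Cartier dual of `Spec A`: the linear dual of `A`. Its multiplication
is the convolution product, i.e. the transpose of the comultiplication of `A`. -/
def CartierDual : Type (max u v) := WithConv (A →ₗ[k] k)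

variable [Coalgebra.IsCocomm k A]

instance : CommRing (CartierDual k A) := inferInstanceAs (CommRing (WithConv (A →ₗ[k] k)))

instance : Algebra k (CartierDual k A) := inferInstanceAs (Algebra k (WithConv (A →ₗ[k] k)))

instance : FunLike (CartierDual k A) A k where
  coe φ := ⇑(WithConv.ofConv φ)
  coe_injective _ _ h := WithConv.ofConv_injective (DFunLike.coe_injective h)

instance : LinearMapClass (CartierDual k A) k A k where
  map_add φ := map_add (WithConv.ofConv φ)
  map_smulₛₗ φ := map_smulₛₗ (WithConv.ofConv φ)

/-- The underlying vector space of the Cartier dual is the linear dual. -/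
def CartierDual.equivDual : CartierDual k A ≃ₗ[k] Module.Dual k A where
  toFun φ := WithConv.ofConv φ
  invFun φ := WithConv.toConv φ
  left_inv _ := rfl
  right_inv _ := rfl
  map_add' _ _ := rfl
  map_smul' _ _ := rfl

variable {k A} in
@[ext] lemma CartierDual.ext {φ χ : CartierDual k A} (h : ∀ a, φ a = χ a) : φ = χ :=
  DFunLike.ext _ _ h

section apply
variable {k A}

@[simp] lemma equivDual_apply (φ : CartierDual k A) (a : A) :
    CartierDual.equivDual k A φ a = φ a := rfl
@[simp] lemma equivDual_symm_apply (φ : Module.Dual k A) (a : A) :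
    (CartierDual.equivDual k A).symm φ a = φ a := rfl
@[simp] lemma dual_zero_apply (a : A) : (0 : CartierDual k A) a = 0 := rfl
@[simp] lemma dual_add_apply (φ χ : CartierDual k A) (a : A) : (φ + χ) a = φ a + χ a := rfl
@[simp] lemma dual_smul_apply (c : k) (φ : CartierDual k A) (a : A) : (c • φ) a = c * φ a := rfl
@[simp] lemma dual_one_apply (a : A) : (1 : CartierDual k A) a = counit (R := k) a := rfl
@[simp] lemma dual_algebraMap_apply (c : k) (a : A) :
    algebraMap k (CartierDual k A) c a = c * counit (R := k) a := rfl
lemma dual_mul_apply {ι : Type*} {a : A} (r : Coalgebra.Repr k a ι) (φ χ : CartierDual k A) :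
    (φ * χ) a = ∑ i ∈ r.index, φ (r.left i) * χ (r.right i) :=
  r.convMul_apply (WithConv.toConv (WithConv.ofConv φ)) (WithConv.toConv (WithConv.ofConv χ))

end apply

variable [Module.Finite k A]

/-- The canonical identification of `A* ⊗ A*` with `(A ⊗ A)*`. -/
def dualPairing : CartierDual k A ⊗[k] CartierDual k A ≃ₗ[k] Module.Dual k (A ⊗[k] A) :=
  (TensorProduct.congr (CartierDual.equivDual k A) (CartierDual.equivDual k A)).trans
    (TensorProduct.dualDistribEquiv k A A)

variable {k A}

lemma dualPairing_tmul (φ χ : CartierDual k A) (a b : A) :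
    dualPairing k A (φ ⊗ₜ χ) (a ⊗ₜ b) = φ a * χ b := by
  simp [dualPairing, TensorProduct.dualDistribEquiv, TensorProduct.dualDistribEquivOfBasis]

lemma dualPairing_ext {v w : CartierDual k A ⊗[k] CartierDual k A}
    (h : ∀ a b, dualPairing k A v (a ⊗ₜ b) = dualPairing k A w (a ⊗ₜ b)) : v = w :=
  (dualPairing k A).injective (TensorProduct.ext' h)

variable (k A) in
/-- The comultiplication of the dual: the transpose of the multiplication of `A`. -/
def dualComul : CartierDual k A →ₗ[k] CartierDual k A ⊗[k] CartierDual k A :=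
  (dualPairing k A).symm.toLinearMap ∘ₗ (LinearMap.mul' k A).dualMap ∘ₗ
    (CartierDual.equivDual k A).toLinearMap

lemma dualPairing_dualComul (φ : CartierDual k A) (a b : A) :
    dualPairing k A (dualComul k A φ) (a ⊗ₜ b) = φ (a * b) := by
  simp [dualComul]

variable (k A) in
/-- The counit of the dual: evaluation at `1`. -/
def dualCounit : CartierDual k A →ₗ[k] k where
  toFun φ := φ 1
  map_add' _ _ := rfl
  map_smul' _ _ := rfl

@[simp] lemma dualCounit_apply (φ : CartierDual k A) : dualCounit k A φ = φ 1 := rfl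

variable (k A) in
/-- The antipode of the dual: the transpose of the antipode of `A`. -/
def dualAntipode : CartierDual k A →ₗ[k] CartierDual k A :=
  (CartierDual.equivDual k A).symm.toLinearMap ∘ₗ (HopfAlgebra.antipode k (A := A)).dualMap ∘ₗ
    (CartierDual.equivDual k A).toLinearMap

@[simp] lemma dualAntipode_apply (φ : CartierDual k A) (a : A) :
    dualAntipode k A φ a = φ (HopfAlgebra.antipode k a) := rfl

variable (k A) in
/-- Auxiliary: `A* ⊗ (A* ⊗ A*)` as functionals on `A ⊗ (A ⊗ A)`. -/
def dualPairing₃ : CartierDual k A ⊗[k] (CartierDual k A ⊗[k] CartierDual k A) ≃ₗ[k]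
    Module.Dual k (A ⊗[k] (A ⊗[k] A)) :=
  (TensorProduct.congr (CartierDual.equivDual k A) (dualPairing k A)).trans
    (TensorProduct.dualDistribEquiv k A (A ⊗[k] A))

lemma dualPairing₃_tmul (φ : CartierDual k A) (w : CartierDual k A ⊗[k] CartierDual k A)
    (a : A) (b : A ⊗[k] A) :
    dualPairing₃ k A (φ ⊗ₜ w) (a ⊗ₜ b) = φ a * dualPairing k A w b := by
  simp [dualPairing₃, TensorProduct.dualDistribEquiv, TensorProduct.dualDistribEquivOfBasis]

lemma dualPairing₃_left (w : CartierDual k A ⊗[k] CartierDual k A) (a b c : A) :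
    dualPairing₃ k A (TensorProduct.assoc k _ _ _ ((dualComul k A).rTensor _ w))
      (a ⊗ₜ (b ⊗ₜ c)) = dualPairing k A w ((a * b) ⊗ₜ c) := by
  induction w with
  | zero => simp
  | add x y hx hy => simp only [map_add, LinearMap.add_apply, hx, hy]
  | tmul φ χ =>
    rw [LinearMap.rTensor_tmul, dualPairing_tmul, ← dualPairing_dualComul]
    generalize dualComul k A φ = v
    induction v with
    | zero => simp
    | add x y hx hy =>
      simp only [map_add, TensorProduct.add_tmul, LinearMap.add_apply, hx, hy, add_mul]
    | tmul φ' φ'' =>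
      simp [dualPairing₃_tmul, dualPairing_tmul, mul_assoc]

lemma dualPairing₃_right (w : CartierDual k A ⊗[k] CartierDual k A) (a b c : A) :
    dualPairing₃ k A ((dualComul k A).lTensor _ w)
      (a ⊗ₜ (b ⊗ₜ c)) = dualPairing k A w (a ⊗ₜ (b * c)) := by
  induction w with
  | zero => simp
  | add x y hx hy => simp only [map_add, LinearMap.add_apply, hx, hy]
  | tmul φ χ =>
    simp [dualPairing₃_tmul, dualPairing_tmul, dualPairing_dualComul]

lemma lid_rTensor_dualCounit (w : CartierDual k A ⊗[k] CartierDual k A) (a : A) :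
    (TensorProduct.lid k _ ((dualCounit k A).rTensor _ w)) a = dualPairing k A w (1 ⊗ₜ a) := by
  induction w with
  | zero => simp
  | add x y hx hy => simp only [map_add, LinearMap.add_apply, dual_add_apply, hx, hy]
  | tmul φ χ => simp [dualPairing_tmul]

lemma rid_lTensor_dualCounit (w : CartierDual k A ⊗[k] CartierDual k A) (a : A) :
    (TensorProduct.rid k _ ((dualCounit k A).lTensor _ w)) a = dualPairing k A w (a ⊗ₜ 1) := by
  induction w with
  | zero => simp
  | add x y hx hy => simp only [map_add, LinearMap.add_apply, dual_add_apply, hx, hy]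
  | tmul φ χ => simp [dualPairing_tmul, mul_comm]

instance dualCoalgebra : Coalgebra k (CartierDual k A) where
  comul := dualComul k A
  counit := dualCounit k A
  coassoc := by
    ext1 φ
    apply (dualPairing₃ k A).injective
    refine TensorProduct.ext (LinearMap.ext fun a => TensorProduct.ext' fun b c => ?_)
    change dualPairing₃ k A (TensorProduct.assoc k _ _ _ ((dualComul k A).rTensor _
      (dualComul k A φ))) (a ⊗ₜ (b ⊗ₜ c)) =
      dualPairing₃ k A ((dualComul k A).lTensor _ (dualComul k A φ)) (a ⊗ₜ (b ⊗ₜ c))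
    rw [dualPairing₃_left, dualPairing₃_right, dualPairing_dualComul, dualPairing_dualComul,
      mul_assoc]
  rTensor_counit_comp_comul := by
    ext1 φ
    apply (TensorProduct.lid k _).injective
    ext a
    refine (lid_rTensor_dualCounit (dualComul k A φ) a).trans ?_
    simp [dualPairing_dualComul]
  lTensor_counit_comp_comul := by
    ext1 φ
    apply (TensorProduct.rid k _).injective
    ext a
    refine (rid_lTensor_dualCounit (dualComul k A φ) a).trans ?_
    simp [dualPairing_dualComul]

lemma dualPairing_mul {ι κ : Type*} (v w : CartierDual k A ⊗[k] CartierDual k A) {a b : A}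
    (r : Coalgebra.Repr k a ι) (s : Coalgebra.Repr k b κ) :
    dualPairing k A (v * w) (a ⊗ₜ b) = ∑ i ∈ r.index, ∑ j ∈ s.index,
      dualPairing k A v (r.left i ⊗ₜ s.left j) * dualPairing k A w (r.right i ⊗ₜ s.right j) := by
  induction v with
  | zero => simp
  | add x y hx hy =>
    simp only [map_add, LinearMap.add_apply, hx, hy, add_mul, Finset.sum_add_distrib]
  | tmul φ χ =>
    induction w with
    | zero => simp
    | add x y hx hy =>
      simp only [map_add, LinearMap.add_apply, hx, hy, mul_add, Finset.sum_add_distrib]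
    | tmul φ' χ' =>
      rw [Algebra.TensorProduct.tmul_mul_tmul, dualPairing_tmul, dual_mul_apply r,
        dual_mul_apply s, Finset.sum_mul_sum]
      refine Finset.sum_congr rfl fun i _ => Finset.sum_congr rfl fun j _ => ?_
      rw [dualPairing_tmul, dualPairing_tmul]
      ring

instance dualBialgebra : Bialgebra k (CartierDual k A) :=
  Bialgebra.mk' k (CartierDual k A)
    (by
      change (1 : CartierDual k A) 1 = 1
      simp)
    (by
      intro φ χ
      change (φ * χ) 1 = φ 1 * χ 1
      rw [dual_mul_apply (ι := Unit) ⟨{()}, fun _ => 1, fun _ => 1, by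
        simp [Algebra.TensorProduct.one_def]⟩]
      simp)
    (by
      apply dualPairing_ext
      intro a b
      refine (dualPairing_dualComul 1 a b).trans ?_
      simp [Algebra.TensorProduct.one_def, dualPairing_tmul])
    (by
      intro φ χ
      apply dualPairing_ext
      intro a b
      refine (dualPairing_dualComul (φ * χ) a b).trans ?_
      rw [dualPairing_mul _ _ (ℛ k a) (ℛ k b), dual_mul_apply ((ℛ k a).mul (ℛ k b))]
      change ∑ i ∈ (ℛ k a).index ×ˢ (ℛ k b).index, _ = _
      rw [Finset.sum_product]
      refine Finset.sum_congr rfl fun i _ => Finset.sum_congr rfl fun j _ => ?_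
      exact congrArg₂ (· * ·) (dualPairing_dualComul φ _ _).symm
        (dualPairing_dualComul χ _ _).symm)

lemma mul_rTensor_dualAntipode {ι : Type*} (w : CartierDual k A ⊗[k] CartierDual k A) {a : A}
    (r : Coalgebra.Repr k a ι) :
    (LinearMap.mul' k _ ((dualAntipode k A).rTensor _ w)) a = ∑ i ∈ r.index,
      dualPairing k A w (HopfAlgebra.antipode k (r.left i) ⊗ₜ r.right i) := by
  induction w with
  | zero => simp
  | add x y hx hy =>
    simp only [map_add, LinearMap.add_apply, dual_add_apply, Finset.sum_add_distrib, hx, hy]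
  | tmul φ χ =>
    simp only [LinearMap.rTensor_tmul, LinearMap.mul'_apply, dual_mul_apply r, dualPairing_tmul,
      dualAntipode_apply]

lemma mul_lTensor_dualAntipode {ι : Type*} (w : CartierDual k A ⊗[k] CartierDual k A) {a : A}
    (r : Coalgebra.Repr k a ι) :
    (LinearMap.mul' k _ ((dualAntipode k A).lTensor _ w)) a = ∑ i ∈ r.index,
      dualPairing k A w (r.left i ⊗ₜ HopfAlgebra.antipode k (r.right i)) := by
  induction w with
  | zero => simp
  | add x y hx hy =>
    simp only [map_add, LinearMap.add_apply, dual_add_apply, Finset.sum_add_distrib, hx, hy]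
  | tmul φ χ =>
    simp only [LinearMap.lTensor_tmul, LinearMap.mul'_apply, dual_mul_apply r, dualPairing_tmul,
      dualAntipode_apply]

instance dualHopfAlgebra : HopfAlgebra k (CartierDual k A) where
  antipode := dualAntipode k A
  mul_antipode_rTensor_comul := by
    ext1 φ
    ext a
    refine (mul_rTensor_dualAntipode (dualComul k A φ) (ℛ k a)).trans ?_
    simp only [dualPairing_dualComul]
    rw [← map_sum, HopfAlgebra.sum_antipode_mul_eq_smul, map_smul]
    change _ = (algebraMap k (CartierDual k A) (φ 1)) a
    simp [mul_comm]
  mul_antipode_lTensor_comul := by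
    ext1 φ
    ext a
    refine (mul_lTensor_dualAntipode (dualComul k A φ) (ℛ k a)).trans ?_
    simp only [dualPairing_dualComul]
    rw [← map_sum, HopfAlgebra.sum_mul_antipode_eq_smul, map_smul]
    change _ = (algebraMap k (CartierDual k A) (φ 1)) a
    simp [mul_comm]

end Dual

/-! ### Frobenius, Verschiebung, truncated Barsotti–Tate groups of level one -/

section BT

variable (k : Type u) [Field k] (p : ℕ) [Fact p.Prime] [CharP k p]

lemma add_pow_p {R : Type*} [CommRing R] [Algebra k R] (x y : R) :
    (x + y) ^ p = x ^ p + y ^ p := by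
  obtain ⟨r, hr⟩ := exists_add_pow_prime_eq (Fact.out : p.Prime) x y
  have h0 : (p : R) = 0 := by
    rw [← map_natCast (algebraMap k R), CharP.cast_eq_zero, map_zero]
  rw [hr, h0]
  ring

variable [IsAlgClosed k] (A : Type v) [CommRing A] [HopfAlgebra k A] [Coalgebra.IsCocomm k A] [Module.Finite k A]

/-- The comorphism of the Verschiebung of `G = Spec A`, after identifying the ring underlying the
coordinate ring `A ⊗_{k,σ} k` of `G^(p)` with `A` (as `k` is perfect); in this way it becomes a
`σ⁻¹`-semilinear map `A → A`. It is the Cartier dual of the Frobenius of the dual group, i.e. the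
transpose of the `p`-power map `φ ↦ φ ^ p` of the ring `CartierDual k A`. -/
def verschiebung (a : A) : A :=
  (Module.evalEquiv k A).symm
    { toFun := fun φ => (frobeniusEquiv k p).symm (((CartierDual.equivDual k A).symm φ ^ p) a)
      map_add' := fun φ χ => by rw [map_add, add_pow_p k p, dual_add_apply, map_add]
      map_smul' := fun c φ => by
        rw [map_smul, smul_pow, dual_smul_apply, map_mul, frobeniusEquiv_symm_pow]
        rfl }

lemma verschiebung_spec (a : A) (φ : CartierDual k A) :
    φ (verschiebung k p A a) ^ p = (φ ^ p) a := by
  have h : φ (verschiebung k p A a) = (frobeniusEquiv k p).symm ((φ ^ p) a) := by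
    rw [← equivDual_apply, verschiebung, Module.apply_evalEquiv_symm_apply]
    rfl
  rw [h, frobeniusEquiv_symm_pow_p]

/-- The augmentation ideal, defining the unit section of `Spec A`. -/
def augmentation : Ideal A := RingHom.ker (Bialgebra.counitAlgHom k A)

/-- The ideal of the kernel of `Frob : G → G^(p)`. -/
def kerFrobIdeal : Ideal A := Ideal.span ((fun a => a ^ p) '' (augmentation k A : Set A))

/-- The ideal of the kernel of `Ver : G^(p) → G` (in `A`, identified with the ring of `G^(p)`). -/
def kerVerIdeal : Ideal A := Ideal.span (verschiebung k p A '' (augmentation k A : Set A))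

/-- `G = Spec A` is a `BT_1` group scheme: it is killed by `p`, `ker Frob = im Ver` and
`ker Ver = im Frob`. The (schematic) image of a homomorphism is the closed subgroup scheme whose
ideal is the kernel of the comorphism. -/
structure IsBT1 : Prop where
  killed : (WithConv.toConv (AlgHom.id k A)) ^ p = 1
  kerFrob_eq_imVer : ∀ a : A, a ∈ kerFrobIdeal k p A ↔ verschiebung k p A a = 0
  kerVer_eq_imFrob : ∀ a : A, a ∈ kerVerIdeal k p A ↔ a ^ p = 0

variable {k A} in
/-- A homomorphism `ψ : G → G^D`, given by its comorphism, is antisymmetric: `ψ^D = -ψ` where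
`G^{DD}` is identified with `G`. -/
def IsAntisymmetric (ψ : CartierDual k A →ₐc[k] A) : Prop :=
  ∀ φ χ : CartierDual k A, φ (ψ χ) = χ (HopfAlgebra.antipode k (ψ φ))

end BT

/-! ### The group schemes `μ_p`, `ℤ/p`, `α_p`, `I_{1,1}` -/

section Examples

variable (k : Type u) [Field k] (p : ℕ)

/-- The coordinate ring `k[t]/(t^p - 1)` of `μ_p`, with `t` group-like, as a group algebra. -/
abbrev MuP : Type u := MonoidAlgebra k (Multiplicative (ZMod p))

instance : Coalgebra.IsCocomm k (MuP k p) where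
  comm_comp_comul := by
    ext
    simp

instance [Fact p.Prime] : Module.Finite k (MuP k p) :=
  inferInstance

/-- The coordinate ring of the constant group scheme `ℤ/p`: the ring of functions on `ℤ/p`, which is
the dual of the group algebra. -/
abbrev ConstZp [Fact p.Prime] : Type u := CartierDual k (MuP k p)

/-- The truncated polynomial algebra `k[x]/(x^n)`. -/
def TruncPoly (n : ℕ) : Type u := AdjoinRoot (Polynomial.X ^ n : k[X])

namespace TruncPoly

variable (n : ℕ)

instance : CommRing (TruncPoly k n) := inferInstanceAs (CommRing (AdjoinRoot (Polynomial.X ^ n : k[X])))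

instance : Algebra k (TruncPoly k n) := inferInstanceAs (Algebra k (AdjoinRoot (Polynomial.X ^ n : k[X])))

/-- The class of `x`. -/
def gen : TruncPoly k n := AdjoinRoot.root (Polynomial.X ^ n : k[X])

lemma gen_pow : gen k n ^ n = 0 := by
  have h := AdjoinRoot.eval₂_root (Polynomial.X ^ n : k[X])
  rwa [Polynomial.eval₂_X_pow] at h

variable {k n} {R : Type*} [CommRing R] [Algebra k R]

/-- The homomorphism `k[x]/(x^n) → R` sending `x` to `b`. -/
def lift (b : R) (hb : b ^ n = 0) : TruncPoly k n →ₐ[k] R :=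
  AdjoinRoot.liftAlgHom (Polynomial.X ^ n : k[X]) (Algebra.ofId k R) b (by rw [Polynomial.eval₂_X_pow, hb])

@[simp] lemma lift_gen (b : R) (hb : b ^ n = 0) : lift (k := k) b hb (gen k n) = b :=
  AdjoinRoot.liftAlgHom_root ..

lemma hom_ext {f g : TruncPoly k n →ₐ[k] R} (h : f (gen k n) = g (gen k n)) : f = g :=
  AdjoinRoot.algHom_ext h

end TruncPoly

variable [Fact p.Prime] [CharP k p]

/-- The coordinate ring `k[x]/(x^p)` of `α_p`. -/
def AlphaP : Type u := TruncPoly k p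

namespace AlphaP

instance : CommRing (AlphaP k p) := inferInstanceAs (CommRing (TruncPoly k p))

instance : Algebra k (AlphaP k p) := inferInstanceAs (Algebra k (TruncPoly k p))

/-- The class of `x`. -/
def gen : AlphaP k p := TruncPoly.gen k p

lemma gen_pow : gen k p ^ p = 0 := TruncPoly.gen_pow k p

variable {k p} {R : Type*} [CommRing R] [Algebra k R]

/-- The homomorphism `k[x]/(x^p) → R` sending `x` to `b`. -/
def lift (b : R) (hb : b ^ p = 0) : AlphaP k p →ₐ[k] R := TruncPoly.lift b hb

@[simp] lemma lift_gen (b : R) (hb : b ^ p = 0) : lift b hb (gen k p) = b :=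
  TruncPoly.lift_gen b hb

lemma hom_ext {f g : AlphaP k p →ₐ[k] R} (h : f (gen k p) = g (gen k p)) : f = g :=
  TruncPoly.hom_ext h

lemma tmul_add_pow : (gen k p ⊗ₜ[k] (1 : AlphaP k p) + 1 ⊗ₜ gen k p) ^ p = 0 := by
  rw [add_pow_p k p, Algebra.TensorProduct.tmul_pow, Algebra.TensorProduct.tmul_pow, gen_pow]
  simp

/-- The generator `x` is primitive: `Δ x = x ⊗ 1 + 1 ⊗ x`. -/
instance : Bialgebra k (AlphaP k p) :=
  Bialgebra.ofAlgHom
    (lift (gen k p ⊗ₜ[k] (1 : AlphaP k p) + 1 ⊗ₜ gen k p) tmul_add_pow)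
    (lift 0 (zero_pow (Fact.out : p.Prime).ne_zero))
    (hom_ext (by
      simp [Algebra.TensorProduct.one_def, TensorProduct.add_tmul, TensorProduct.tmul_add,
        add_assoc]))
    (hom_ext (by simp))
    (hom_ext (by simp))

@[simp] lemma comul_gen :
    comul (R := k) (gen k p) = gen k p ⊗ₜ[k] (1 : AlphaP k p) + 1 ⊗ₜ gen k p :=
  lift_gen _ tmul_add_pow

@[simp] lemma counit_gen : counit (R := k) (gen k p) = 0 :=
  lift_gen (k := k) (p := p) (0 : k) (zero_pow (Fact.out : p.Prime).ne_zero)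

/-- The endomorphism `x ↦ c x` of `α_p`; this is the action of `k` on `α_p`. -/
def scale (c : k) : AlphaP k p →ₐc[k] AlphaP k p :=
  BialgHom.ofAlgHom
    (lift (c • gen k p) (by rw [smul_pow, gen_pow, smul_zero]))
    (hom_ext (by simp))
    (hom_ext (by simp [TensorProduct.smul_tmul']))

@[simp] lemma scale_gen (c : k) : scale c (gen k p) = c • gen k p :=
  lift_gen (k := k) (p := p) (c • gen k p) (by rw [smul_pow, gen_pow, smul_zero])

lemma bialgHom_ext {f g : AlphaP k p →ₐc[k] AlphaP k p} (h : f (gen k p) = g (gen k p)) :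
    f = g :=
  BialgHom.coe_toAlgHom_injective (hom_ext h)

lemma scale_one : scale (1 : k) = BialgHom.id k (AlphaP k p) :=
  bialgHom_ext (by simp)

lemma scale_mul (c d : k) : scale (c * d) = (scale c).comp (scale (p := p) d) :=
  bialgHom_ext (by simp [mul_smul, smul_comm c d])

end AlphaP

/-- The polynomial `((x + y)^p - x^p - y^p) / p`, which has integral coefficients. -/
def wittCocycle {R : Type*} [CommRing R] (p : ℕ) (x y : R) : R :=
  ∑ i ∈ Finset.Ioo 0 p, ((p.choose i / p : ℕ) : R) * (x ^ i * y ^ (p - i))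

section wittCocycle

variable {R S : Type*} [CommRing R] [CommRing S]

lemma map_wittCocycle (f : R →+* S) (x y : R) :
    f (wittCocycle p x y) = wittCocycle p (f x) (f y) := by
  simp [wittCocycle]

lemma mul_wittCocycle (x y : R) :
    (p : R) * wittCocycle p x y = (x + y) ^ p - x ^ p - y ^ p := by
  have hp : p.Prime := Fact.out
  have h1 : (x + y) ^ p = ∑ i ∈ Finset.range (p + 1), x ^ i * y ^ (p - i) * (p.choose i : R) :=
    add_pow x y p
  rw [Finset.sum_range_succ, Finset.range_eq_Ico,
    ← Finset.sum_sdiff (s₁ := {0}) (s₂ := Finset.Ico 0 p) (by simp [hp.pos])] at h1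
  have h2 : Finset.Ico 0 p \ {0} = Finset.Ioo 0 p := by
    ext i; simp [Nat.pos_iff_ne_zero, and_comm]
  rw [h2] at h1
  have h3 : ∑ i ∈ Finset.Ioo 0 p, x ^ i * y ^ (p - i) * (p.choose i : R) =
      (p : R) * wittCocycle p x y := by
    rw [wittCocycle, Finset.mul_sum]
    refine Finset.sum_congr rfl fun i hi => ?_
    rw [Finset.mem_Ioo] at hi
    have hd : p * (p.choose i / p) = p.choose i :=
      Nat.mul_div_cancel' (hp.dvd_choose_self hi.1.ne' hi.2)
    have hc : (p.choose i : R) = (p : R) * ((p.choose i / p : ℕ) : R) := by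
      rw [← Nat.cast_mul, hd]
    rw [hc]
    ring
  rw [h1, h3]
  simp

lemma wittCocycle_cocycle (x y z : R) :
    wittCocycle p x y + wittCocycle p (x + y) z =
      wittCocycle p y z + wittCocycle p x (y + z) := by
  have key : ∀ a b c : MvPolynomial (Fin 3) ℤ,
      wittCocycle p a b + wittCocycle p (a + b) c =
        wittCocycle p b c + wittCocycle p a (b + c) := by
    intro a b c
    have hp : ((p : ℕ) : MvPolynomial (Fin 3) ℤ) ≠ 0 :=
      Nat.cast_ne_zero.2 (Fact.out : p.Prime).ne_zero
    apply mul_left_cancel₀ hp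
    simp only [mul_add, mul_wittCocycle]
    ring
  have h := congrArg (MvPolynomial.eval₂Hom (Int.castRingHom R) ![x, y, z])
    (key (MvPolynomial.X 0) (MvPolynomial.X 1) (MvPolynomial.X 2))
  simp only [map_add, map_wittCocycle, MvPolynomial.eval₂Hom_X'] at h
  exact h

lemma wittCocycle_mul (s x y : R) :
    wittCocycle p (s * x) (s * y) = s ^ p * wittCocycle p x y := by
  rw [wittCocycle, wittCocycle, Finset.mul_sum]
  refine Finset.sum_congr rfl fun i hi => ?_
  rw [Finset.mem_Ioo] at hi
  rw [mul_pow, mul_pow, ← pow_sub_mul_pow s hi.2.le]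
  ring

lemma dvd_wittCocycle (x y : R) : x ∣ wittCocycle p x y := by
  refine Finset.dvd_sum fun i hi => ?_
  rw [Finset.mem_Ioo] at hi
  exact ((dvd_pow_self x hi.1.ne').mul_right _).mul_left _

lemma wittCocycle_zero_left (y : R) : wittCocycle p 0 y = 0 :=
  zero_dvd_iff.1 (dvd_wittCocycle p 0 y)

lemma wittCocycle_comm (x y : R) : wittCocycle p x y = wittCocycle p y x := by
  have key : ∀ a b : MvPolynomial (Fin 2) ℤ, wittCocycle p a b = wittCocycle p b a := by
    intro a b
    have hp : ((p : ℕ) : MvPolynomial (Fin 2) ℤ) ≠ 0 :=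
      Nat.cast_ne_zero.2 (Fact.out : p.Prime).ne_zero
    apply mul_left_cancel₀ hp
    simp only [mul_wittCocycle]
    ring
  have h := congrArg (MvPolynomial.eval₂Hom (Int.castRingHom R) ![x, y])
    (key (MvPolynomial.X 0) (MvPolynomial.X 1))
  simp only [map_wittCocycle, MvPolynomial.eval₂Hom_X'] at h
  exact h

lemma wittCocycle_zero_right (x : R) : wittCocycle p x 0 = 0 := by
  rw [wittCocycle_comm, wittCocycle_zero_left]

end wittCocycle

/-- The coordinate ring of `I_{1,1}`, the group scheme with Dieudonné module `𝔼/𝔼(F + V)`. It is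
realised as the kernel of `F + V` on the group scheme `W_2` of `p`-typical Witt vectors
`(x₀, x₁)` of length two. As `F (x₀, x₁) = (x₀^p, x₁^p)` and `V (x₀, x₁) = (0, x₀)`, this kernel
is given by `x₀^p = 0` and `x₀ = -x₁^p`, so its coordinate ring is `k[x]/(x^(p^2))` with `x = x₁`.
The Witt vector addition
`x₁ + y₁ + (x₀^p + y₀^p - (x₀ + y₀)^p) / p` gives the comultiplication below. -/
def I11 : Type u := TruncPoly k (p ^ 2)

namespace I11

instance : CommRing (I11 k p) := inferInstanceAs (CommRing (TruncPoly k (p ^ 2)))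

instance : Algebra k (I11 k p) := inferInstanceAs (Algebra k (TruncPoly k (p ^ 2)))

/-- The class of `x`. -/
def gen : I11 k p := TruncPoly.gen k (p ^ 2)

lemma gen_pow : (gen k p ^ p) ^ p = 0 := by
  rw [← pow_mul, ← sq]
  exact TruncPoly.gen_pow k (p ^ 2)

variable {k p} {R : Type*} [CommRing R] [Algebra k R]

/-- The homomorphism `k[x]/(x^(p^2)) → R` sending `x` to `b`. -/
def lift (b : R) (hb : (b ^ p) ^ p = 0) : I11 k p →ₐ[k] R :=
  TruncPoly.lift b (by rw [sq, pow_mul, hb])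

@[simp] lemma lift_gen (b : R) (hb : (b ^ p) ^ p = 0) : lift b hb (gen k p) = b :=
  TruncPoly.lift_gen b _

lemma hom_ext {f g : I11 k p →ₐ[k] R} (h : f (gen k p) = g (gen k p)) : f = g :=
  TruncPoly.hom_ext h

variable (k p) in
/-- The value of the comultiplication on the generator:
`x ⊗ 1 + 1 ⊗ x + ((X + Y)^p - X^p - Y^p) / p` with `X = x^p ⊗ 1` and `Y = 1 ⊗ x^p`. -/
def comulGen : I11 k p ⊗[k] I11 k p :=
  gen k p ⊗ₜ 1 + 1 ⊗ₜ gen k p + wittCocycle p ((gen k p ^ p) ⊗ₜ 1) (1 ⊗ₜ (gen k p ^ p))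

lemma wittCocycle_pow {x : R} (y : R) (hx : x ^ p = 0) : wittCocycle p x y ^ p = 0 := by
  obtain ⟨d, hd⟩ := dvd_wittCocycle p x y
  rw [hd, mul_pow, hx, zero_mul]

lemma comulGen_pow : comulGen k p ^ p = (gen k p ^ p) ⊗ₜ 1 + 1 ⊗ₜ (gen k p ^ p) := by
  rw [comulGen, add_pow_p k p, add_pow_p k p, wittCocycle_pow]
  · simp [Algebra.TensorProduct.tmul_pow]
  · simp [Algebra.TensorProduct.tmul_pow, gen_pow]

lemma comulGen_pow_pow : (comulGen k p ^ p) ^ p = 0 := by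
  rw [comulGen_pow, add_pow_p k p]
  simp [Algebra.TensorProduct.tmul_pow, gen_pow]

lemma zero_pow_pow : ((0 : R) ^ p) ^ p = 0 := by
  have hp : p ≠ 0 := (Fact.out : p.Prime).ne_zero
  rw [zero_pow hp, zero_pow hp]

lemma map_wittCocycle' {S : Type*} [CommRing S] [Algebra k S] (f : R →ₐ[k] S) (x y : R) :
    f (wittCocycle p x y) = wittCocycle p (f x) (f y) :=
  map_wittCocycle p (f : R →+* S) x y

lemma comul_coassoc (D : I11 k p →ₐ[k] I11 k p ⊗[k] I11 k p) (hD : D (gen k p) = comulGen k p) :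
    (Algebra.TensorProduct.assoc k k k (I11 k p) (I11 k p) (I11 k p)).toAlgHom.comp
      ((Algebra.TensorProduct.map D (.id k (I11 k p))).comp D) =
      (Algebra.TensorProduct.map (.id k (I11 k p)) D).comp D := by
  have hc : D (gen k p ^ p) = (gen k p ^ p) ⊗ₜ 1 + 1 ⊗ₜ (gen k p ^ p) := by
    rw [map_pow, hD, comulGen_pow]
  have h := wittCocycle_cocycle p ((gen k p ^ p) ⊗ₜ[k] ((1 : I11 k p) ⊗ₜ[k] (1 : I11 k p)))
    ((1 : I11 k p) ⊗ₜ[k] ((gen k p ^ p) ⊗ₜ[k] (1 : I11 k p)))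
    ((1 : I11 k p) ⊗ₜ[k] ((1 : I11 k p) ⊗ₜ[k] (gen k p ^ p)))
  have h1 (x y : I11 k p ⊗[k] I11 k p) :
      wittCocycle p x y ⊗ₜ[k] (1 : I11 k p) = wittCocycle p (x ⊗ₜ[k] 1) (y ⊗ₜ[k] 1) :=
    map_wittCocycle' (Algebra.TensorProduct.includeLeft (R := k) (S := k)
      (A := I11 k p ⊗[k] I11 k p) (B := I11 k p)) x y
  have h2 (x y : I11 k p ⊗[k] I11 k p) :
      (1 : I11 k p) ⊗ₜ[k] wittCocycle p x y = wittCocycle p (1 ⊗ₜ[k] x) (1 ⊗ₜ[k] y) :=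
    map_wittCocycle' (Algebra.TensorProduct.includeRight (R := k)
      (A := I11 k p) (B := I11 k p ⊗[k] I11 k p)) x y
  apply hom_ext
  simp only [AlgHom.comp_apply, hD]
  rw [comulGen]
  simp only [map_add, map_wittCocycle', Algebra.TensorProduct.map_tmul, hc, hD,
    AlgHom.id_apply, map_one]
  rw [comulGen]
  simp only [TensorProduct.add_tmul, TensorProduct.tmul_add, h1, h2, AlgEquiv.toAlgHom_apply,
    map_add, map_wittCocycle', Algebra.TensorProduct.assoc_tmul,
    Algebra.TensorProduct.one_def]
  linear_combination h

instance : Bialgebra k (I11 k p) :=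
  Bialgebra.ofAlgHom (lift (comulGen k p) comulGen_pow_pow) (lift 0 zero_pow_pow)
    (comul_coassoc _ (lift_gen _ _))
    (hom_ext (by
      simp [comulGen, map_wittCocycle', zero_pow (Fact.out : p.Prime).ne_zero,
        wittCocycle_zero_left]))
    (hom_ext (by
      simp [comulGen, map_wittCocycle', zero_pow (Fact.out : p.Prime).ne_zero,
        wittCocycle_zero_right]))

@[simp] lemma comul_gen : comul (R := k) (gen k p) = comulGen k p :=
  lift_gen _ comulGen_pow_pow

@[simp] lemma counit_gen : counit (R := k) (gen k p) = 0 :=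
  lift_gen (k := k) (p := p) (0 : k) zero_pow_pow

lemma neg_gen_pow : ((-gen k p) ^ p) ^ p = 0 := by
  rw [neg_pow, mul_pow, gen_pow, mul_zero]

lemma antipode_aux : gen k p + -gen k p + wittCocycle p (gen k p ^ p) ((-gen k p) ^ p) = 0 := by
  have h : wittCocycle p (gen k p ^ p * 1) (gen k p ^ p * (-1) ^ p) = 0 := by
    rw [wittCocycle_mul, gen_pow, zero_mul]
  rw [neg_pow, mul_comm ((-1) ^ p), add_neg_cancel, zero_add]
  simpa using h

lemma map_comulGen (L : I11 k p ⊗[k] I11 k p →ₐ[k] I11 k p) :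
    L (comulGen k p) = L (gen k p ⊗ₜ 1) + L (1 ⊗ₜ gen k p) +
      wittCocycle p (L (gen k p ⊗ₜ 1) ^ p) (L (1 ⊗ₜ gen k p) ^ p) := by
  have h1 : (gen k p ^ p) ⊗ₜ[k] (1 : I11 k p) = (gen k p ⊗ₜ[k] (1 : I11 k p)) ^ p := by
    simp [Algebra.TensorProduct.tmul_pow]
  have h2 : (1 : I11 k p) ⊗ₜ[k] (gen k p ^ p) = ((1 : I11 k p) ⊗ₜ[k] gen k p) ^ p := by
    simp [Algebra.TensorProduct.tmul_pow]
  rw [comulGen, map_add, map_add, map_wittCocycle', h1, h2, map_pow, map_pow]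

lemma convInverse_of_gen (L : I11 k p ⊗[k] I11 k p →ₐ[k] I11 k p) {a b : I11 k p}
    (h1 : L (gen k p ⊗ₜ 1) = a) (h2 : L (1 ⊗ₜ gen k p) = b)
    (h : a + b + wittCocycle p (a ^ p) (b ^ p) = 0) :
    L.comp (Bialgebra.comulAlgHom k (I11 k p)) =
      (Algebra.ofId k (I11 k p)).comp (Bialgebra.counitAlgHom k (I11 k p)) := by
  apply hom_ext
  rw [AlgHom.comp_apply, Bialgebra.comulAlgHom_apply, comul_gen, map_comulGen, h1, h2, h]
  simp

/-- The antipode sends `x` to `-x`. -/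
instance : HopfAlgebra k (I11 k p) :=
  HopfAlgebra.ofAlgHom (lift (-gen k p) neg_gen_pow)
    (convInverse_of_gen (a := -gen k p) (b := gen k p) _
      ((Algebra.TensorProduct.lift_tmul ..).trans (by simp))
      ((Algebra.TensorProduct.lift_tmul ..).trans (by simp)) (by
      rw [wittCocycle_comm, add_comm (-gen k p)]
      exact antipode_aux))
    (convInverse_of_gen (a := gen k p) (b := -gen k p) _
      ((Algebra.TensorProduct.lift_tmul ..).trans (by simp))
      ((Algebra.TensorProduct.lift_tmul ..).trans (by simp)) antipode_aux)

instance : Coalgebra.IsCocomm k (I11 k p) where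
  comm_comp_comul := by
    have h : (Algebra.TensorProduct.comm k (I11 k p) (I11 k p)).toAlgHom.comp
        (Bialgebra.comulAlgHom k (I11 k p)) = Bialgebra.comulAlgHom k (I11 k p) := by
      apply hom_ext
      simp only [AlgHom.comp_apply, Bialgebra.comulAlgHom_apply, comul_gen, comulGen, map_add,
        map_wittCocycle', AlgEquiv.toAlgHom_apply, Algebra.TensorProduct.comm_tmul]
      rw [wittCocycle_comm, add_comm (_ ⊗ₜ[k] _)]
    exact congr(($h).toLinearMap)

end I11

end Examples

/-! ### Invariants -/

section Invariants

variable (k : Type u) [Field k] (p : ℕ) [Fact p.Prime] [CharP k p]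
variable (A : Type v) [CommRing A] [HopfAlgebra k A] [Coalgebra.IsCocomm k A]

/-- The group `Hom(μ_p, G)` for `G = Spec A`, written additively; its group law (from Mathlib) is
the convolution product of bialgebra homomorphisms. -/
abbrev HomMuP : Type (max u v) := Additive (WithConv (A →ₐc[k] MuP k p))

lemma muP_killed : (WithConv.toConv (AlgHom.id k (MuP k p))) ^ p = 1 := by
  have h : ∀ (n : ℕ) (g : Multiplicative (ZMod p)),
      ((WithConv.toConv (AlgHom.id k (MuP k p))) ^ n) (MonoidAlgebra.single g 1) =
        MonoidAlgebra.single (g ^ n) 1 := by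
    intro n g
    induction n with
    | zero => simp
    | succ n ih =>
      rw [pow_succ, AlgHom.convMul_apply]
      simp [ih, pow_succ, MonoidAlgebra.single_mul_single]
  apply WithConv.ext
  refine MonoidAlgebra.algHom_ext (fun g => ?_) (Subsingleton.elim _ _)
  refine (h p g).trans ?_
  have hg : g ^ p = 1 := by
    apply Multiplicative.toAdd.injective
    simp
  simp [hg]

variable {k A} in
lemma convPow_comp {B : Type*} [CommRing B] [Bialgebra k B] (f : A →ₐc[k] B) (n : ℕ) :
    (WithConv.toConv (f : A →ₐ[k] B)) ^ n =
      WithConv.toConv (((WithConv.toConv (AlgHom.id k B)) ^ n).ofConv.comp (f : A →ₐ[k] B)) := by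
  induction n with
  | zero =>
    rw [pow_zero, pow_zero]
    apply WithConv.ext
    ext a
    simp
  | succ n ih =>
    rw [pow_succ, pow_succ, AlgHom.convMul_comp_bialgHom_distrib, ih]
    rfl

lemma homMuP_killed (f : HomMuP k p A) : p • f = 0 := by
  apply Additive.toMul.injective
  apply WithConv.ofConv_injective
  apply BialgHom.coe_toAlgHom_injective
  apply WithConv.toConv_injective
  refine (BialgHom.toAlgHom_convPow (Additive.toMul f) p).trans ?_
  refine (convPow_comp (Additive.toMul f).ofConv p).trans ?_
  rw [muP_killed]
  apply WithConv.ext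
  ext a
  simp

/-- `Hom(μ_p, G)` is an `𝔽_p`-vector space. -/
instance : Module (ZMod p) (HomMuP k p A) :=
  AddCommMonoid.zmodModule (homMuP_killed k p A)

/-- The `p`-rank of `G = Spec A`: the dimension of `Hom(μ_p, G)` over `𝔽_p`. -/
def pRank : ℕ := Module.finrank (ZMod p) (HomMuP k p A)

/-- The group `Hom(α_p, G)` for `G = Spec A`, written additively. -/
abbrev HomAlphaP : Type (max u v) := Additive (WithConv (A →ₐc[k] AlphaP k p))

namespace HomAlphaP

variable {k p A}

/-- The bialgebra homomorphism underlying an element of `Hom(α_p, G)`. -/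
def hom (f : HomAlphaP k p A) : A →ₐc[k] AlphaP k p := (Additive.toMul f).ofConv

/-- The scalar `c` acts on `Hom(α_p, G)` through the action of `k` on `α_p`. -/
instance : SMul k (HomAlphaP k p A) where
  smul c f := Additive.ofMul (WithConv.toConv ((AlphaP.scale c).comp (hom f)))

lemma hom_smul (c : k) (f : HomAlphaP k p A) : hom (c • f) = (AlphaP.scale c).comp (hom f) := rfl

lemma ext {f g : HomAlphaP k p A} (h : (hom f : A →ₐ[k] AlphaP k p) = hom g) : f = g :=
  congrArg (fun x => Additive.ofMul (WithConv.toConv x)) (BialgHom.coe_toAlgHom_injective h)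

/-- The homomorphism of rings underlying an element of `Hom(α_p, G)`, in the convolution monoid. -/
def alg (f : HomAlphaP k p A) : WithConv (A →ₐ[k] AlphaP k p) :=
  WithConv.toConv (hom f : A →ₐ[k] AlphaP k p)

lemma alg_injective : Function.Injective (alg (k := k) (p := p) (A := A)) :=
  fun _ _ h => ext (congrArg WithConv.ofConv h)

lemma alg_add (f g : HomAlphaP k p A) : alg (f + g) = alg f * alg g := rfl

lemma alg_zero : alg (0 : HomAlphaP k p A) = 1 := rfl

lemma alg_smul (c : k) (f : HomAlphaP k p A) :
    alg (c • f) = WithConv.toConv ((AlphaP.scale c : AlphaP k p →ₐ[k] AlphaP k p).comp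
      (alg f).ofConv) := rfl

lemma scale_add (c d : k) :
    WithConv.toConv (AlphaP.scale (c + d) : AlphaP k p →ₐ[k] AlphaP k p) =
      WithConv.toConv (AlphaP.scale c : AlphaP k p →ₐ[k] AlphaP k p) *
        WithConv.toConv (AlphaP.scale d : AlphaP k p →ₐ[k] AlphaP k p) := by
  apply WithConv.ext
  apply AlphaP.hom_ext
  refine Eq.trans ?_ (AlgHom.convMul_apply _ _ _).symm
  simp [add_smul]

instance : Module k (HomAlphaP k p A) where
  one_smul f := by
    apply alg_injective
    rw [alg_smul, AlphaP.scale_one]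
    rfl
  mul_smul c d f := by
    apply alg_injective
    rw [alg_smul, AlphaP.scale_mul]
    rfl
  smul_zero c := by
    apply alg_injective
    rw [alg_smul, alg_zero]
    apply WithConv.ext
    ext a
    exact (AlphaP.scale c : AlphaP k p →ₐ[k] AlphaP k p).commutes _
  smul_add c f g := by
    apply alg_injective
    rw [alg_smul, alg_add, AlgHom.comp_convMul_distrib]
    rfl
  add_smul c d f := by
    apply alg_injective
    rw [alg_smul, ← WithConv.ofConv_toConv (AlphaP.scale (c + d) : AlphaP k p →ₐ[k] AlphaP k p),
      scale_add]
    exact congrArg WithConv.toConv (AlgHom.convMul_comp_bialgHom_distrib _ _ (hom f))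
  zero_smul f := by
    apply alg_injective
    have h : (AlphaP.scale (0 : k) : AlphaP k p →ₐ[k] AlphaP k p) =
        (Algebra.ofId k _).comp (Bialgebra.counitAlgHom k _) := AlphaP.hom_ext (by simp)
    rw [alg_smul, alg_zero, h]
    apply WithConv.ext
    ext a
    simp [alg]

end HomAlphaP

/-- The `a`-number of `G = Spec A`: the dimension of `Hom(α_p, G)` over `k`. -/
def aNumber : ℕ := Module.finrank k (HomAlphaP k p A)

end Invariants

section SuperspecialRank

variable {k : Type u} [Field k]

/-- The coordinate ring of the `n`-fold product `G^n`, for `G` with coordinate ring `B`. -/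
def groupPow (B : CommHopfAlgCat.{u} k) : ℕ → CommHopfAlgCat.{u} k
  | 0 => CommHopfAlgCat.of k k
  | n + 1 => CommHopfAlgCat.of k (B ⊗[k] groupPow B n)

variable (k) (p : ℕ) [Fact p.Prime] [CharP k p]

/-- The coordinate ring of `I_{1,1}^s`. -/
def I11Pow (s : ℕ) : CommHopfAlgCat.{u} k := groupPow (CommHopfAlgCat.of k (I11 k p)) s

/-- The coordinate ring of `(ℤ/p ⊕ μ_p)^f`. -/
def ordinaryPow (f : ℕ) : CommHopfAlgCat.{u} k :=
  groupPow (CommHopfAlgCat.of k (ConstZp k p ⊗[k] MuP k p)) f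

variable {k p} {A : Type v} [CommRing A] [HopfAlgebra k A] [Coalgebra.IsCocomm k A]
  [Module.Finite k A]

/-- A superspecial factor `H ≃ I_{1,1}^s` of `G = Spec A` is a closed immersion `I_{1,1}^s → G` of
group schemes, i.e. a surjection `q : A → O(I_{1,1}^s)`. It is polarized for `ψ : G → G^D` if
the composite `ψ_H : H → G → G^D → H^D` is an isomorphism; the comorphism of `ψ_H` is
`O(H)^* → A^* → A → O(H)`, where the first map is the transpose of `q`. -/
def IsPolarizedFactor (ψ : CartierDual k A →ₐc[k] A) (s : ℕ) (q : A →ₐc[k] I11Pow k p s) : Prop :=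
  Function.Surjective q ∧
    Function.Bijective fun φ : Module.Dual k (I11Pow k p s) =>
      q (ψ ((CartierDual.equivDual k A).symm (φ ∘ₗ (q : A →ₗ[k] I11Pow k p s))))

variable (p) in
/-- The superspecial rank of `(G, ψ)`: the largest `s` such that `G` has a polarized superspecial
factor `H ≃ I_{1,1}^s`. (The set is bounded as `I_{1,1}^s` has order `p^(2s)`, and contains `0`.) -/
def superspecialRank (ψ : CartierDual k A →ₐc[k] A) : ℕ :=
  sSup {s : ℕ | ∃ q : A →ₐc[k] I11Pow k p s, IsPolarizedFactor ψ s q}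

end SuperspecialRank

end BT1

end

/-! Let D be the Cartier dual of A and P the space of primitive elements of D. A primitive
functional is a derivation at the origin, so P is the tangent space of G, and v ↦ v^p is a
Frobenius-semilinear endomorphism of P. Since μ_p is dual to ℤ/p and α_p is self-dual, Hom(μ_p, G)
is the set of fixed vectors of this endomorphism and Hom(α_p, G) is its kernel `nilPrim`. Fixed
vectors that are independent over 𝔽_p stay independent over k, and their span meets the kernel in 0;
hence f + a ≤ dim P (`pRank_add_aNumber_le`).

That dim P = g is a count of orders. Coordinates dual to a basis of P make A free of rank p^(dim P)
over its subring of p-th powers (`Coords.finrank_eq`). The condition ker Frob = im Ver says that the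
ideal of ker Frob is the annihilator of the p-th powers of D, which gives the dimension of that
subring, and self-duality carries it over to A. So dim A = p^(2 dim P) (`IsBT1.finrank_eq`).

A factor I_{1,1}^s contributes at least s dimensions to the kernel of the p-power map, so s ≤ a
(`superspecialRank_le`).

If f + a = g, then P is the span of the fixed vectors plus `nilPrim`. Each c in `nilPrim` is the
first component of a "Witt element" b of D, found by extending the associated map A → k[x]/(x^p) to
k[x]/(x^(p+1)); the condition ker Ver = im Frob makes this possible (`IsBT1.exists_trunc_lift`,
`IsBT1.exists_isWitt`). After normalising b by fixed vectors, c ↦ b^p is an injective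
Frob²-semilinear endomorphism of `nilPrim`, so by Lang's theorem (`span_fixed_eq_top`) it has a
basis of fixed vectors c = b^p. Each such b is a map O(I_{1,1}) → D. Fixed primitive elements and
suitable points of G give the maps from O(ℤ/p) and O(μ_p). Together they form a homomorphism O((ℤ/p
⊕ μ_p)^f ⊕ I_{1,1}^a) → D that is injective on primitive and on group-like elements, hence injective
(`injective_of_prim_groupLike`), hence bijective by order; ψ transports it to A. The resulting
factor I_{1,1}^a is automatically polarized, since the kernel of its form would have a tangent
vector that is both nilpotent and a combination of fixed vectors.

Conversely, let s = a. The tangent space of the polarized factor is then all of `nilPrim`. If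
v^(p^2) = 0, then v^p comes from the factor, and its image there under the polarization is the p-th
power of a primitive element of O(I_{1,1}^a), which is 0; so v^p = 0. The p-power map is therefore
injective modulo its kernel, Lang's theorem splits P, and f + a = g
(`finrank_prim_le_of_isPolarizedFactor`). -/

set_option linter.unusedSectionVars false

noncomputable section

namespace BT1

universe u v w

/-! ### Primitive elements -/

section Prim

variable (k : Type u) [Field k]

/-- An element `b` of a bialgebra is primitive if `Δ b = b ⊗ 1 + 1 ⊗ b`. -/
def IsPrim {B : Type v} [CommRing B] [Bialgebra k B] (b : B) : Prop :=
  comul (R := k) b = b ⊗ₜ[k] 1 + 1 ⊗ₜ[k] b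

variable {k} {B : Type v} [CommRing B] [Bialgebra k B] {C : Type w} [CommRing C] [Bialgebra k C]

lemma IsPrim.counit {b : B} (h : IsPrim k b) : counit (R := k) b = 0 := by
  have h1 := congrArg (TensorProduct.lid k B) (rTensor_counit_comul (R := k) b)
  rw [h] at h1
  have h2 := congrArg (Coalgebra.counit (R := k)) h1
  simpa using h2

lemma IsPrim.map {F : Type*} [FunLike F B C] [BialgHomClass F k B C] (f : F) {b : B}
    (h : IsPrim k b) : IsPrim k (f b) := by
  rw [IsPrim, ← CoalgHomClass.map_comp_comul_apply, h]
  simp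

lemma IsPrim.add {a b : B} (ha : IsPrim k a) (hb : IsPrim k b) : IsPrim k (a + b) := by
  rw [IsPrim] at *
  rw [map_add, ha, hb, TensorProduct.add_tmul, TensorProduct.tmul_add]
  abel

lemma IsPrim.smul (c : k) {a : B} (ha : IsPrim k a) : IsPrim k (c • a) := by
  rw [IsPrim] at *
  rw [map_smul, ha, smul_add, TensorProduct.smul_tmul', TensorProduct.tmul_smul]

lemma IsPrim.zero : IsPrim k (0 : B) := by simp [IsPrim]

variable (k B) in
/-- The primitive elements form a subspace. -/
def primSubmodule : Submodule k B where
  carrier := {b | IsPrim k b}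
  add_mem' := IsPrim.add
  zero_mem' := IsPrim.zero
  smul_mem' := fun c _ h => h.smul c

lemma IsPrim.pow_p (p : ℕ) [Fact p.Prime] [CharP k p] {b : B} (h : IsPrim k b) :
    IsPrim k (b ^ p) := by
  rw [IsPrim, Bialgebra.comul_pow, h, add_pow_p k p]
  simp [Algebra.TensorProduct.tmul_pow]

end Prim

/-! ### Pairing with the dual -/

section DualBasics

variable {k : Type u} [Field k] {A : Type v} [CommRing A] [HopfAlgebra k A]
  [Coalgebra.IsCocomm k A]

variable (k) in
lemma dual_sep {a : A} (h : ∀ φ : CartierDual k A, φ a = 0) : a = 0 :=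
  (Module.forall_dual_apply_eq_zero_iff k a).1 fun φ => h ((CartierDual.equivDual k A).symm φ)

variable (k) in
lemma dual_sep' {a b : A} (h : ∀ φ : CartierDual k A, φ a = φ b) : a = b :=
  sub_eq_zero.1 (dual_sep k fun φ => by rw [map_sub, h, sub_self])

variable [Module.Finite k A]

instance : Module.Finite k (CartierDual k A) :=
  Module.Finite.equiv (CartierDual.equivDual k A).symm

lemma finrank_dual : Module.finrank k (CartierDual k A) = Module.finrank k A :=
  (CartierDual.equivDual k A).finrank_eq.trans Subspace.dual_finrank_eq

lemma dual_mul_eq (φ χ : CartierDual k A) (a : A) :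
    (φ * χ) a = dualPairing k A (φ ⊗ₜ χ) (comul a) := by
  conv_rhs => rw [← (ℛ k a).eq]
  rw [map_sum, dual_mul_apply (ℛ k a)]
  simp [dualPairing_tmul]

lemma dualPairing_sep {w : A ⊗[k] A}
    (h : ∀ φ χ : CartierDual k A, dualPairing k A (φ ⊗ₜ χ) w = 0) : w = 0 := by
  refine (Module.forall_dual_apply_eq_zero_iff k w).1 fun f => ?_
  obtain ⟨v, rfl⟩ := (dualPairing k A).surjective f
  induction v with
  | zero => simp
  | add x y hx hy => rw [map_add, LinearMap.add_apply, hx, hy, add_zero]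
  | tmul φ χ => exact h φ χ

lemma dualPairing_sep' {v w : A ⊗[k] A}
    (h : ∀ φ χ : CartierDual k A, dualPairing k A (φ ⊗ₜ χ) v = dualPairing k A (φ ⊗ₜ χ) w) :
    v = w :=
  sub_eq_zero.1 (dualPairing_sep fun φ χ => by rw [map_sub, h, sub_self])

lemma comul_dual_apply (φ : CartierDual k A) (a b : A) :
    dualPairing k A (comul (R := k) φ) (a ⊗ₜ b) = φ (a * b) :=
  dualPairing_dualComul φ a b

/-- Comultiplication on the dual is the transpose of multiplication, so primitive functionals are
the derivations at the origin: they form the tangent space of `Spec A`. -/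
lemma isPrim_dual_iff {φ : CartierDual k A} :
    IsPrim k φ ↔ ∀ a b, φ (a * b) = φ a * counit (R := k) b + counit (R := k) a * φ b := by
  constructor
  · intro h a b
    rw [← comul_dual_apply, h, map_add, LinearMap.add_apply, dualPairing_tmul, dualPairing_tmul]
    simp
  · intro h
    refine dualPairing_ext fun a b => ?_
    rw [comul_dual_apply, h, map_add, LinearMap.add_apply, dualPairing_tmul, dualPairing_tmul]
    simp

lemma isPrim_iff {a : A} :
    IsPrim k a ↔ ∀ φ χ : CartierDual k A, (φ * χ) a = φ a * χ 1 + φ 1 * χ a := by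
  constructor
  · intro h φ χ
    rw [dual_mul_eq, h, map_add, dualPairing_tmul, dualPairing_tmul]
  · intro h
    refine dualPairing_sep' fun φ χ => ?_
    rw [← dual_mul_eq, h, map_add, dualPairing_tmul, dualPairing_tmul]

lemma isGroupLike_dual_iff {φ : CartierDual k A} :
    IsGroupLikeElem k φ ↔ φ 1 = 1 ∧ ∀ a b, φ (a * b) = φ a * φ b := by
  constructor
  · intro h
    refine ⟨h.counit_eq_one, fun a b => ?_⟩
    rw [← comul_dual_apply, h.comul_eq_tmul_self, dualPairing_tmul]
  · intro h
    refine ⟨h.1, dualPairing_ext fun a b => ?_⟩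
    rw [comul_dual_apply, h.2, dualPairing_tmul]

lemma isGroupLike_iff {a : A} :
    IsGroupLikeElem k a ↔
      counit (R := k) a = 1 ∧ ∀ φ χ : CartierDual k A, (φ * χ) a = φ a * χ a := by
  constructor
  · intro h
    refine ⟨h.counit_eq_one, fun φ χ => ?_⟩
    rw [dual_mul_eq, h.comul_eq_tmul_self, dualPairing_tmul]
  · intro h
    refine ⟨h.1, dualPairing_sep' fun φ χ => ?_⟩
    rw [← dual_mul_eq, h.2, dualPairing_tmul]

/-- A homomorphism of rings to `k` as a functional. -/
def pointDual (χ : A →ₐ[k] k) : CartierDual k A :=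
  (CartierDual.equivDual k A).symm χ.toLinearMap

@[simp] lemma pointDual_apply (χ : A →ₐ[k] k) (a : A) : pointDual χ a = χ a := rfl

lemma isGroupLike_pointDual (χ : A →ₐ[k] k) : IsGroupLikeElem k (pointDual χ) :=
  isGroupLike_dual_iff.2 ⟨map_one χ, fun a b => map_mul χ a b⟩

/-- A group-like functional as a point. -/
def pointOf {φ : CartierDual k A} (h : IsGroupLikeElem k φ) : A →ₐ[k] k :=
  AlgHom.ofLinearMap (CartierDual.equivDual k A φ) (isGroupLike_dual_iff.1 h).1
    (isGroupLike_dual_iff.1 h).2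

@[simp] lemma pointOf_apply {φ : CartierDual k A} (h : IsGroupLikeElem k φ) (a : A) :
    pointOf h a = φ a := rfl

/-- The element of `A` given by a functional on its dual. -/
def bidualElem (f : CartierDual k A →ₗ[k] k) : A :=
  (Module.evalEquiv k A).symm (f ∘ₗ (CartierDual.equivDual k A).symm.toLinearMap)

@[simp] lemma apply_bidualElem (f : CartierDual k A →ₗ[k] k) (φ : CartierDual k A) :
    φ (bidualElem f) = f φ := by
  rw [← equivDual_apply, bidualElem, Module.apply_evalEquiv_symm_apply]
  rfl

instance : Coalgebra.IsCocomm k (CartierDual k A) where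
  comm_comp_comul := by
    ext1 φ
    refine dualPairing_ext fun a b => ?_
    have h : ∀ w : CartierDual k A ⊗[k] CartierDual k A,
        dualPairing k A (TensorProduct.comm k _ _ w) (a ⊗ₜ b) =
          dualPairing k A w (b ⊗ₜ a) := by
      intro w
      induction w with
      | zero => simp
      | add x y hx hy => simp only [map_add, LinearMap.add_apply, hx, hy]
      | tmul φ χ => simp [dualPairing_tmul, mul_comm]
    refine (h _).trans ?_
    rw [comul_dual_apply, comul_dual_apply, mul_comm]

end DualBasics

/-! ### Transposes -/

section Transpose

variable {k : Type u} [Field k] {A : Type v} [CommRing A] [HopfAlgebra k A]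
  [Coalgebra.IsCocomm k A] [Module.Finite k A]
  {B : Type w} [CommRing B] [HopfAlgebra k B] [Coalgebra.IsCocomm k B] [Module.Finite k B]

lemma dualPairing_map (f : A →ₐc[k] B) (φ χ : CartierDual k B) (w : A ⊗[k] A) (φ' χ' : CartierDual k A)
    (h1 : ∀ a, φ' a = φ (f a)) (h2 : ∀ a, χ' a = χ (f a)) :
    dualPairing k A (φ' ⊗ₜ χ') w =
      dualPairing k B (φ ⊗ₜ χ) (TensorProduct.map (f : A →ₗ[k] B) (f : A →ₗ[k] B) w) := by
  induction w with
  | zero => simp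
  | add x y hx hy => simp only [map_add, hx, hy]
  | tmul a b => simp [dualPairing_tmul, h1, h2]

/-- The transpose of a homomorphism, as a linear map. -/
def dualMapLin (f : A →ₐc[k] B) : CartierDual k B →ₗ[k] CartierDual k A :=
  (CartierDual.equivDual k A).symm.toLinearMap ∘ₗ (f : A →ₗ[k] B).dualMap ∘ₗ
    (CartierDual.equivDual k B).toLinearMap

lemma dualMapLin_apply (f : A →ₐc[k] B) (φ : CartierDual k B) (a : A) :
    dualMapLin f φ a = φ (f a) := rfl

lemma dualMapLin_mul (f : A →ₐc[k] B) (φ χ : CartierDual k B) :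
    dualMapLin f (φ * χ) = dualMapLin f φ * dualMapLin f χ := by
  ext a
  rw [dual_mul_eq, dualMapLin_apply, dual_mul_eq, dualPairing_map f φ χ _ _ _ (fun _ => rfl)
    (fun _ => rfl)]
  congr 1
  exact (CoalgHomClass.map_comp_comul_apply f a).symm

/-- The transpose of a homomorphism. -/
def dualMap (f : A →ₐc[k] B) : CartierDual k B →ₐc[k] CartierDual k A :=
  BialgHom.ofAlgHom (AlgHom.ofLinearMap (dualMapLin f)
      (by ext a; rw [dualMapLin_apply]; exact CoalgHomClass.counit_comp_apply f a)
      (dualMapLin_mul f))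
    (by
      ext φ
      change dualMapLin f φ 1 = φ 1
      rw [dualMapLin_apply, map_one])
    (by
      ext φ
      refine dualPairing_ext fun a b => ?_
      have h : ∀ w : CartierDual k B ⊗[k] CartierDual k B,
          dualPairing k A (TensorProduct.map (dualMapLin f) (dualMapLin f) w) (a ⊗ₜ b) =
            dualPairing k B w (f a ⊗ₜ f b) := by
        intro w
        induction w with
        | zero => simp
        | add x y hx hy => simp only [map_add, LinearMap.add_apply, hx, hy]
        | tmul φ χ => simp [dualPairing_tmul, dualMapLin_apply]
      refine (h (comul (R := k) φ)).trans ?_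
      refine Eq.trans ?_ (comul_dual_apply (dualMapLin f φ) a b).symm
      rw [comul_dual_apply, dualMapLin_apply, map_mul f])

@[simp] lemma dualMap_apply (f : A →ₐc[k] B) (φ : CartierDual k B) (a : A) :
    dualMap f φ a = φ (f a) := rfl

lemma dualMap_injective {f : A →ₐc[k] B} (hf : Function.Surjective f) :
    Function.Injective (dualMap f) := by
  intro φ χ h
  ext b
  obtain ⟨a, rfl⟩ := hf b
  rw [← dualMap_apply, h, dualMap_apply]

/-- The homomorphism with a given transpose, as a linear map. -/
def undualLin (h : CartierDual k B →ₐc[k] CartierDual k A) : A →ₗ[k] B where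
  toFun a := bidualElem ((Module.Dual.eval k A a ∘ₗ (CartierDual.equivDual k A).toLinearMap) ∘ₗ
    (h : CartierDual k B →ₗ[k] CartierDual k A))
  map_add' a b := dual_sep' k fun φ => by simp
  map_smul' c a := dual_sep' k fun φ => by simp

lemma apply_undualLin (h : CartierDual k B →ₐc[k] CartierDual k A) (φ : CartierDual k B) (a : A) :
    φ (undualLin h a) = h φ a := by
  simp [undualLin]

/-- The homomorphism with a given transpose. -/
def undual (h : CartierDual k B →ₐc[k] CartierDual k A) : A →ₐc[k] B :=
  BialgHom.ofAlgHom (AlgHom.ofLinearMap (undualLin h)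
      (dual_sep' k fun φ => by
        rw [apply_undualLin]
        exact CoalgHomClass.counit_comp_apply h φ)
      (fun a b => dual_sep' k fun φ => by
        rw [apply_undualLin, ← comul_dual_apply, ← comul_dual_apply (k := k) φ,
          ← CoalgHomClass.map_comp_comul_apply]
        generalize comul (R := k) φ = w
        induction w with
        | zero => simp
        | add x y hx hy => simp only [map_add, LinearMap.add_apply, hx, hy]
        | tmul φ χ => simp [dualPairing_tmul, apply_undualLin]))
    (by
      ext a
      change counit (R := k) (undualLin h a) = _
      rw [← dual_one_apply, apply_undualLin, map_one]
      rfl)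
    (by
      ext a
      change TensorProduct.map (undualLin h) (undualLin h) (comul (R := k) a) =
        comul (R := k) (undualLin h a)
      refine dualPairing_sep' fun φ χ => ?_
      rw [← dual_mul_eq, apply_undualLin, map_mul, dual_mul_eq]
      generalize comul (R := k) a = w
      induction w with
      | zero => simp
      | add x y hx hy => simp only [map_add, hx, hy]
      | tmul a b => simp [dualPairing_tmul, apply_undualLin])

lemma apply_undual (h : CartierDual k B →ₐc[k] CartierDual k A) (φ : CartierDual k B) (a : A) :
    φ (undual h a) = h φ a := apply_undualLin h φ a

end Transpose

/-! ### Points of finite algebras -/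

section Points

variable {k : Type u} [Field k] [IsAlgClosed k] {A : Type v} [CommRing A] [Algebra k A]
  [Module.Finite k A]

lemma exists_point_of_isMaximal (M : Ideal A) [hM : M.IsMaximal] :
    ∃ χ : A →ₐ[k] k, RingHom.ker χ = M := by
  let _ : Field (A ⧸ M) := Ideal.Quotient.field M
  have hb : Function.Bijective (algebraMap k (A ⧸ M)) :=
    IsAlgClosed.algebraMap_bijective_of_isIntegral
  let e : k ≃ₐ[k] A ⧸ M := AlgEquiv.ofBijective (Algebra.ofId k (A ⧸ M)) hb
  refine ⟨(e.symm : (A ⧸ M) →ₐ[k] k).comp (Ideal.Quotient.mkₐ k M), ?_⟩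
  ext a
  simp [RingHom.mem_ker, Ideal.Quotient.eq_zero_iff_mem]

lemma isNilpotent_of_forall_point {a : A} (h : ∀ χ : A →ₐ[k] k, χ a = 0) : IsNilpotent a := by
  have : IsArtinianRing A := IsArtinianRing.of_finite k A
  rw [← mem_nilradical, nilradical_eq_sInf]
  refine Submodule.mem_sInf.2 fun M hM => ?_
  have : Ideal.IsPrime M := hM
  obtain ⟨χ, hχ⟩ := exists_point_of_isMaximal (k := k) (M : Ideal A)
  rw [← hχ]
  exact h χ

lemma isUnit_of_forall_point {a : A} (h : ∀ χ : A →ₐ[k] k, χ a ≠ 0) : IsUnit a := by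
  by_contra ha
  obtain ⟨M, hM, haM⟩ := exists_max_ideal_of_mem_nonunits ha
  obtain ⟨χ, hχ⟩ := exists_point_of_isMaximal (k := k) M
  rw [← hχ] at haM
  exact h χ haM

/-- Nakayama's lemma in `A ⧸ J`: the only point above `J` is `ε`, so the image of `n` lies in the
Jacobson radical, and the hypothesis says that this image is contained in its own square. -/
lemma le_of_le_sup_sq (n J : Ideal A) (ε : A →ₐ[k] k) (hn : n = RingHom.ker ε)
    (hp : ∀ χ : A →ₐ[k] k, J ≤ RingHom.ker χ → χ = ε) (h : n ≤ J ⊔ n ^ 2) : n ≤ J := by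
  have : IsNoetherianRing A := IsNoetherianRing.of_finite k A
  have h1 : n.map (Ideal.Quotient.mk J) = ⊥ := by
    refine Submodule.eq_bot_of_le_smul_of_le_jacobson_bot (n.map (Ideal.Quotient.mk J)) _
      (IsNoetherian.noetherian _) ?_ ?_
    · rw [smul_eq_mul, ← Ideal.map_mul, ← sq]
      refine (Ideal.map_mono h).trans ?_
      rw [Ideal.map_sup, Ideal.map_quotient_self, bot_sup_eq]
    · refine le_sInf fun M hM => ?_
      have := hM.2
      have : (M.comap (Ideal.Quotient.mk J)).IsMaximal :=
        Ideal.comap_isMaximal_of_surjective _ Ideal.Quotient.mk_surjective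
      obtain ⟨χ, hχ⟩ := exists_point_of_isMaximal (k := k) (M.comap (Ideal.Quotient.mk J))
      have hχ' : χ = ε := hp χ (by
        rw [hχ]
        intro a ha
        rw [Ideal.mem_comap, Ideal.Quotient.eq_zero_iff_mem.2 ha]
        exact M.zero_mem)
      rw [Ideal.map_le_iff_le_comap, ← hχ, hn, hχ']
  intro a ha
  have := Ideal.mem_map_of_mem (Ideal.Quotient.mk J) ha
  rw [h1, Ideal.mem_bot] at this
  exact Ideal.Quotient.eq_zero_iff_mem.1 this

end Points

/-! ### Criteria for surjectivity and injectivity -/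

section Criteria

variable {k : Type u} [Field k]

/-- A homomorphism of finite commutative group schemes with trivial kernel is a closed
immersion. -/
theorem surjective_of_augmentation_le {A : Type v} [CommRing A] [HopfAlgebra k A]
    [Module.Finite k A] {B : Type w} [CommRing B] [HopfAlgebra k B] (h : B →ₐc[k] A)
    (hJ : augmentation k A ≤ Ideal.span (h '' (augmentation k B : Set B))) :
    Function.Surjective h := by
  let _ : Algebra B A := (h : B →ₐ[k] A).toRingHom.toAlgebra
  have hmap : ∀ b : B, algebraMap B A b = h b := fun _ => rfl
  have : IsScalarTower k B A := IsScalarTower.of_algebraMap_eq fun c =>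
    ((h : B →ₐ[k] A).commutes c).symm
  have : Module.Finite B A := Module.Finite.of_restrictScalars_finite k B A
  -- A finite epimorphism of rings is surjective, so it is enough that the two inclusions of `A` in
  -- `A ⊗[B] A` agree.
  suffices Algebra.IsEpi B A from
    (Algebra.isEpi_iff_surjective_algebraMap_of_finite).1 this
  rw [Algebra.isEpi_iff_forall_one_tmul_eq]
  let i₁ : A →ₐ[k] A ⊗[B] A := Algebra.TensorProduct.includeLeft
  let i₂ : A →ₐ[k] A ⊗[B] A := (Algebra.TensorProduct.includeRight (R := B)).restrictScalars k
  have hi : i₁.comp (h : B →ₐ[k] A) = i₂.comp (h : B →ₐ[k] A) := by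
    ext b
    change h b ⊗ₜ[B] (1 : A) = (1 : A) ⊗ₜ[B] h b
    rw [← hmap, Algebra.algebraMap_eq_smul_one, TensorProduct.smul_tmul]
  let j : WithConv (A →ₐ[k] A ⊗[B] A) :=
    WithConv.toConv (i₁.comp ((WithConv.toConv (AlgHom.id k A))⁻¹).ofConv)
  have hj : j * WithConv.toConv i₁ = 1 := by
    have e := AlgHom.comp_convMul_distrib i₁ (WithConv.toConv (AlgHom.id k A))⁻¹
      (WithConv.toConv (AlgHom.id k A))
    rw [inv_mul_cancel] at e
    refine Eq.trans (congrArg WithConv.toConv e.symm) ?_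
    apply WithConv.ext
    ext a
    simp [AlgHom.convOne_apply]
  have hj' : WithConv.toConv i₁ * j = 1 := by
    have e := AlgHom.comp_convMul_distrib i₁ (WithConv.toConv (AlgHom.id k A))
      (WithConv.toConv (AlgHom.id k A))⁻¹
    rw [mul_inv_cancel] at e
    refine Eq.trans (congrArg WithConv.toConv e.symm) ?_
    apply WithConv.ext
    ext a
    simp [AlgHom.convOne_apply]
  -- `i₁` and `i₂` are points of the group `Spec A` with values in `A ⊗[B] A`, and `θ` is their
  -- difference. They have the same image in `Spec B`, so `θ` is a point of the kernel of `h`; the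
  -- kernel is trivial by `hJ`, whence `θ = 1`.
  let θ : WithConv (A →ₐ[k] A ⊗[B] A) := j * WithConv.toConv i₂
  have hθ : θ.ofConv.comp (h : B →ₐ[k] A) =
      (1 : WithConv (B →ₐ[k] A ⊗[B] A)).ofConv := by
    have e1 : θ.ofConv.comp (h : B →ₐ[k] A) =
        ((j * WithConv.toConv i₁).ofConv).comp (h : B →ₐ[k] A) := by
      apply WithConv.toConv_injective
      rw [AlgHom.convMul_comp_bialgHom_distrib, AlgHom.convMul_comp_bialgHom_distrib]
      exact congrArg (fun f => WithConv.toConv (j.ofConv.comp (h : B →ₐ[k] A)) *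
        WithConv.toConv f) hi.symm
    rw [e1, hj]
    ext b
    simp [AlgHom.convOne_apply]
  have hθ1 : θ = 1 := by
    have hker : ∀ a ∈ augmentation k A, θ a = 0 := by
      intro a ha
      have hle : Ideal.span (h '' (augmentation k B : Set B)) ≤ RingHom.ker θ.ofConv := by
        rw [Ideal.span_le]
        rintro _ ⟨b, hb, rfl⟩
        refine (DFunLike.congr_fun hθ b).trans ?_
        rw [AlgHom.convOne_apply]
        rw [show counit (R := k) b = 0 from hb, map_zero]
      exact hle (hJ ha)
    apply WithConv.ext
    ext a
    have h2 : θ (a - algebraMap k A (counit (R := k) a)) = 0 := hker _ (by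
      change counit (R := k) (a - algebraMap k A (counit (R := k) a)) = 0
      simp)
    have h3 : θ.ofConv a - θ.ofConv (algebraMap k A (counit (R := k) a)) = 0 := by
      rw [← map_sub]; exact h2
    rw [sub_eq_zero.1 h3, AlgHom.commutes]
    exact (AlgHom.convOne_apply a).symm
  intro a
  have h3 : WithConv.toConv i₁ = WithConv.toConv i₂ := by
    calc WithConv.toConv i₁ = WithConv.toConv i₁ * (j * WithConv.toConv i₂) := by
          rw [show j * WithConv.toConv i₂ = 1 from hθ1, mul_one]
      _ = WithConv.toConv i₂ := by rw [← mul_assoc, hj', one_mul]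
  exact (DFunLike.congr_fun (WithConv.toConv_injective h3) a).symm

/-- A homomorphism of finite commutative group schemes over an algebraically closed field is
an epimorphism if its comorphism is injective on primitive and on group-like elements. -/
theorem injective_of_prim_groupLike [IsAlgClosed k] {T : Type v} [CommRing T] [HopfAlgebra k T]
    [Coalgebra.IsCocomm k T] [Module.Finite k T] {D : Type w} [CommRing D] [HopfAlgebra k D]
    [Coalgebra.IsCocomm k D] [Module.Finite k D] (h : T →ₐc[k] D)
    (hP : ∀ v : T, IsPrim k v → h v = 0 → v = 0)
    (hG : ∀ t : T, IsGroupLikeElem k t → h t = 1 → t = 1) : Function.Injective h := by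
  -- By duality the transpose has to be a closed immersion, so it has to have trivial kernel. A
  -- point of that kernel is a group-like element of `T` that goes to 1 and a tangent vector is a
  -- primitive element that goes to 0; Nakayama's lemma shows that nothing else can occur.
  have hs : Function.Surjective (dualMap h) := by
    apply surjective_of_augmentation_le
    set J := Ideal.span (dualMap h '' (augmentation k (CartierDual k D) : Set (CartierDual k D)))
      with hJdef
    refine le_of_le_sup_sq _ J (Bialgebra.counitAlgHom k (CartierDual k T)) rfl ?_ ?_
    · intro χ hχ
      have hker : ∀ φ : CartierDual k D, φ 1 = 0 → χ (dualMap h φ) = 0 := fun φ hφ =>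
        hχ (Ideal.subset_span ⟨φ, hφ, rfl⟩)
      have ht : IsGroupLikeElem k (bidualElem χ.toLinearMap) := isGroupLike_iff.2 ⟨by
        rw [← dual_one_apply, apply_bidualElem]; exact map_one χ, fun φ ω => by
        rw [apply_bidualElem, apply_bidualElem, apply_bidualElem]; exact map_mul χ φ ω⟩
      have h1 : h (bidualElem χ.toLinearMap) = 1 := by
        refine dual_sep' k fun φ => ?_
        have h2 := hker (φ - φ 1 • 1) (by
          change φ 1 - φ 1 * counit (R := k) (1 : D) = 0
          simp)
        rw [map_sub, map_smul, map_sub, map_smul, map_one (dualMap h), map_one χ, sub_eq_zero,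
          smul_eq_mul, mul_one] at h2
        rw [← dualMap_apply, apply_bidualElem]
        exact h2
      have h2 := hG _ ht h1
      ext φ
      have h3 := apply_bidualElem χ.toLinearMap φ
      rw [h2] at h3
      exact h3.symm
    · intro φ hφ
      by_contra hnot
      have hε : ∀ x ∈ J ⊔ augmentation k (CartierDual k T) ^ 2, x 1 = 0 := by
        have : J ⊔ augmentation k (CartierDual k T) ^ 2 ≤ augmentation k (CartierDual k T) := by
          refine sup_le ?_ (Ideal.pow_le_self two_ne_zero)
          rw [hJdef, Ideal.span_le]
          rintro _ ⟨ω, hω, rfl⟩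
          change ω (h 1) = 0
          rw [map_one]
          exact hω
        intro x hx
        exact this hx
      obtain ⟨f, hf1, hf2⟩ := Submodule.exists_le_ker_of_notMem
        (p := (J ⊔ augmentation k (CartierDual k T) ^ 2).restrictScalars k) (v := φ) hnot
      -- The correction makes the functional vanish at 1 without changing it on the augmentation
      -- ideal. Vanishing at 1 and on the square of that ideal means that the corresponding element
      -- of `T` is primitive.
      let f' : CartierDual k T →ₗ[k] k := f - f 1 • dualCounit k T
      have hf'1 : f' 1 = 0 := by
        change f 1 - f 1 * (1 : CartierDual k T) 1 = 0
        simp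
      have hf'J : ∀ x ∈ J ⊔ augmentation k (CartierDual k T) ^ 2, f' x = 0 := by
        intro x hx
        change f x - f 1 * x 1 = 0
        rw [hε x hx, mul_zero, sub_zero]
        exact hf2 hx
      have hv : IsPrim k (bidualElem f') := by
        refine isPrim_iff.2 fun a b => ?_
        rw [apply_bidualElem, apply_bidualElem, apply_bidualElem]
        have h1 := hf'J ((a - a 1 • 1) * (b - b 1 • 1))
          (Ideal.mem_sup_right (by
            rw [sq]
            refine Ideal.mul_mem_mul ?_ ?_
            · change a 1 - a 1 * counit (R := k) (1 : T) = 0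
              simp
            · change b 1 - b 1 * counit (R := k) (1 : T) = 0
              simp))
        have h2 : (a - a 1 • 1) * (b - b 1 • 1) =
            a * b - b 1 • a - a 1 • b + (a 1 * b 1) • (1 : CartierDual k T) := by
          simp only [Algebra.smul_def, map_mul, mul_one]
          ring
        rw [h2, map_add, map_sub, map_sub, map_smul, map_smul, map_smul, hf'1] at h1
        simp only [smul_eq_mul] at h1
        linear_combination h1
      have hv0 : h (bidualElem f') = 0 := by
        refine dual_sep k fun ω => ?_
        rw [← dualMap_apply, apply_bidualElem]
        have h1 := hf'J (dualMap h (ω - ω 1 • 1)) (Ideal.mem_sup_left (Ideal.subset_span ⟨_, by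
          change ω 1 - ω 1 * counit (R := k) (1 : D) = 0
          simp, rfl⟩))
        rw [map_sub, map_smul, map_sub, map_smul, map_one (dualMap h), hf'1, smul_zero, sub_zero] at h1
        exact h1
      have h5 := hP _ hv hv0
      have h6 := apply_bidualElem f' φ
      rw [h5, map_zero] at h6
      have h7 : f' φ = f φ := by
        change f φ - f 1 * φ 1 = f φ
        rw [show φ 1 = 0 from hφ]
        simp
      exact hf1 (by rw [← h7, ← h6])
  intro x y hxy
  refine dual_sep' k fun φ => ?_
  obtain ⟨ω, rfl⟩ := hs φ
  rw [dualMap_apply, dualMap_apply, hxy]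

end Criteria

/-! ### Frobenius-semilinear maps over an algebraically closed field -/

section Lang

variable {k : Type u} [Field k]

/-- The polynomials that describe the fixed vectors in a cyclic subspace. -/
def langPoly (q : ℕ) (a : ℕ → k) : ℕ → k[X]
  | 0 => Polynomial.C (a 0) * Polynomial.X ^ q
  | i + 1 => langPoly q a i ^ q + Polynomial.C (a (i + 1)) * Polynomial.X ^ q

lemma X_pow_dvd_langPoly {q : ℕ} (hq : 1 < q) (a : ℕ → k) (i : ℕ) :
    Polynomial.X ^ q ∣ langPoly q a i := by
  induction i with
  | zero => exact dvd_mul_left _ _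
  | succ i ih =>
    exact dvd_add (ih.trans (dvd_pow_self _ (by omega))) (dvd_mul_left _ _)

/-- The `q`-th power of the preceding polynomial is divisible by `X ^ (q * q)`, so the coefficient
of `X ^ q` is the last `a (i + 1)`; the remaining coefficients follow by descent. -/
lemma langPoly_eq_zero {q : ℕ} (hq : 1 < q) (a : ℕ → k) (i : ℕ) (h : langPoly q a i = 0) :
    ∀ j ≤ i, a j = 0 := by
  induction i with
  | zero =>
    intro j hj
    obtain rfl : j = 0 := by omega
    have h1 := congrArg (fun f => Polynomial.coeff f q) h
    simpa [langPoly] using h1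
  | succ i ih =>
    have h1 : Polynomial.coeff (langPoly q a i ^ q) q = 0 := by
      have h2 : Polynomial.X ^ (q * q) ∣ langPoly q a i ^ q := by
        rw [pow_mul]
        exact pow_dvd_pow_of_dvd (X_pow_dvd_langPoly hq a i) q
      exact Polynomial.X_pow_dvd_iff.1 h2 q (by nlinarith)
    have h3 : a (i + 1) = 0 := by
      have h4 := congrArg (fun f => Polynomial.coeff f q) h
      simpa [langPoly, h1] using h4
    have h5 : langPoly q a i = 0 := by
      rw [langPoly, h3] at h
      simpa [show q ≠ 0 by omega] using h
    intro j hj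
    rcases Nat.lt_or_ge j (i + 1) with h6 | h6
    · exact ih h5 j (by omega)
    · obtain rfl : j = i + 1 := by omega
      exact h3

variable [IsAlgClosed k] {V : Type v} [AddCommGroup V] [Module k V] [Module.Finite k V]

/-- Writing the polynomial as `X ^ 2 * R`, a root `y` of `X * R - 1` satisfies `y ^ 2 * R(y) = y`
and cannot be 0. -/
lemma exists_langPoly_root {q : ℕ} (hq : 1 < q) (a : ℕ → k) (m : ℕ) (h : ∃ i ≤ m, a i ≠ 0) :
    ∃ y : k, y ≠ 0 ∧ (langPoly q a m).eval y = y := by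
  obtain ⟨R, hR⟩ : Polynomial.X ^ 2 ∣ langPoly q a m :=
    (pow_dvd_pow _ hq).trans (X_pow_dvd_langPoly hq a m)
  have hR0 : R ≠ 0 := by
    rintro rfl
    obtain ⟨i, hi, hi'⟩ := h
    exact hi' (langPoly_eq_zero hq a m (by simpa using hR) i hi)
  have hdeg : (Polynomial.X * R - Polynomial.C 1).degree ≠ 0 := by
    have h1 : (0 : WithBot ℕ) < (Polynomial.X * R).degree := by
      rw [Polynomial.degree_mul, Polynomial.degree_X, Polynomial.degree_eq_natDegree hR0]
      exact_mod_cast (by omega : 0 < 1 + R.natDegree)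
    rw [Polynomial.degree_sub_C h1]
    exact h1.ne'
  obtain ⟨y, hy⟩ := IsAlgClosed.exists_root _ hdeg
  have hy' : y * R.eval y = 1 := by
    simpa [Polynomial.IsRoot, sub_eq_zero] using hy
  refine ⟨y, ?_, ?_⟩
  · rintro rfl
    simp at hy'
  · rw [hR]
    simp only [Polynomial.eval_mul, Polynomial.eval_pow, Polynomial.eval_X]
    linear_combination y * hy'

variable {q : ℕ} {σ : k →+* k}

/-- Let `Φ^[m+1] v = ∑ a i • Φ^[i] v` be the first relation between the iterates of a vector `v ≠
0`. The vector `∑ y i • Φ^[i] v` is fixed if `y 0 = a 0 * (y m)^q` and `y (i+1) = (y i)^q + a (i+1)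
* (y m)^q`. Eliminating successively gives `y i = langPoly q a i` at `y m`, and one equation for `y
m` remains. Injectivity of `Φ` ensures that some `a i` is nonzero. -/
lemma exists_fixed_ne_zero (hq : 1 < q) (hσ : ∀ x, σ x = x ^ q) [Nontrivial V] (Φ : V →ₛₗ[σ] V)
    (hΦ : Function.Injective Φ) : ∃ v : V, v ≠ 0 ∧ Φ v = v := by
  classical
  obtain ⟨v, hv⟩ := exists_ne (0 : V)
  let S : ℕ → Submodule k V := fun n => Submodule.span k (Set.range fun i : Fin n => Φ^[i] v)
  have hmem : ∀ n i, i < n → Φ^[i] v ∈ S n := fun n i hi =>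
    Submodule.subset_span ⟨⟨i, hi⟩, rfl⟩
  have hex : ∃ n, Φ^[n] v ∈ S n := by
    by_contra! hcon
    have h1 : ∀ n, n ≤ Module.finrank k (S n) := by
      intro n
      induction n with
      | zero => exact Nat.zero_le _
      | succ n ih =>
        have hlt : S n < S (n + 1) := by
          refine lt_of_le_of_ne ?_ ?_
          · refine Submodule.span_le.2 ?_
            rintro _ ⟨i, rfl⟩
            exact hmem _ _ (by omega)
          · intro h
            exact hcon n (h ▸ hmem (n + 1) n (by omega))
        exact Nat.succ_le_of_lt (lt_of_le_of_lt ih (Submodule.finrank_lt_finrank_of_lt hlt))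
    have h2 := (h1 (Module.finrank k V + 1)).trans (Submodule.finrank_le _)
    omega
  obtain ⟨m, hm⟩ : ∃ m, Nat.find hex = m + 1 := by
    refine Nat.exists_eq_succ_of_ne_zero fun h0 => ?_
    have h1 := Nat.find_spec hex
    rw [h0] at h1
    simp [S] at h1
    exact hv h1
  have hspec := Nat.find_spec hex
  have hmin : Φ^[m] v ∉ S m := Nat.find_min hex (by omega)
  rw [hm] at hspec
  obtain ⟨c, hc⟩ := (Submodule.mem_span_range_iff_exists_fun k).1 hspec
  let a : ℕ → k := fun i => if h : i < m + 1 then c ⟨i, h⟩ else 0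
  have ha : Φ^[m + 1] v = ∑ i ∈ Finset.range (m + 1), a i • Φ^[i] v := by
    rw [← hc, Finset.sum_range]
    refine Finset.sum_congr rfl fun i _ => ?_
    rw [show a i = c i from dif_pos i.2]
  have hne : ∃ i ≤ m, a i ≠ 0 := by
    by_contra! hcon
    have h1 : Φ^[m + 1] v = 0 := by
      rw [ha]
      refine Finset.sum_eq_zero fun i hi => ?_
      rw [Finset.mem_range] at hi
      rw [hcon i (by omega), zero_smul]
    have h2 : Function.Injective (Φ^[m + 1]) := hΦ.iterate _
    have h3 : Φ^[m + 1] (0 : V) = 0 := by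
      rw [Function.iterate_fixed (map_zero Φ)]
    exact hv (h2 (h1.trans h3.symm))
  obtain ⟨y, hy0, hy⟩ := exists_langPoly_root hq a m hne
  refine ⟨∑ i ∈ Finset.range (m + 1), (langPoly q a i).eval y • Φ^[i] v, ?_, ?_⟩
  · intro h0
    rw [Finset.sum_range_succ, hy] at h0
    apply hmin
    have h1 : Φ^[m] v = -(y⁻¹ • ∑ i ∈ Finset.range m, (langPoly q a i).eval y • Φ^[i] v) := by
      rw [eq_neg_of_add_eq_zero_left h0, smul_neg, neg_neg, smul_smul, inv_mul_cancel₀ hy0,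
        one_smul]
    rw [h1]
    refine (S m).neg_mem ((S m).smul_mem _ ((S m).sum_mem fun i hi => (S m).smul_mem _ ?_))
    exact hmem _ _ (Finset.mem_range.1 hi)
  · rw [map_sum]
    simp only [map_smulₛₗ, hσ, ← Function.iterate_succ_apply' (f := ⇑Φ)]
    rw [Finset.sum_range_succ, ha, hy, Finset.smul_sum, Finset.sum_range_succ' (n := m),
      Finset.sum_range_succ' (n := m) (f := fun i => (langPoly q a i).eval y • Φ^[i] v),
      ← add_assoc, ← Finset.sum_add_distrib]
    congr 1
    · refine Finset.sum_congr rfl fun i _ => ?_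
      rw [smul_smul, ← add_smul]
      congr 1
      simp only [langPoly, Polynomial.eval_add, Polynomial.eval_pow, Polynomial.eval_mul,
        Polynomial.eval_C, Polynomial.eval_X]
      ring
    · rw [smul_smul]
      congr 1
      simp only [langPoly, Polynomial.eval_pow, Polynomial.eval_mul,
        Polynomial.eval_C, Polynomial.eval_X]
      ring

/-- An injective Frobenius-semilinear endomorphism of a finite-dimensional vector space over an
algebraically closed field has a spanning set of fixed vectors. -/
theorem span_fixed_eq_top (hq : 1 < q) (hσ : ∀ x, σ x = x ^ q) (Φ : V →ₛₗ[σ] V)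
    (hΦ : Function.Injective Φ) : Submodule.span k {v | Φ v = v} = ⊤ := by
  set W := Submodule.span k {v | Φ v = v} with hW
  have hle : W ≤ W.comap Φ := by
    refine Submodule.span_le.2 fun v hv => ?_
    change Φ v ∈ W
    rw [show Φ v = v from hv]
    exact Submodule.subset_span hv
  -- `k` has `q`-th roots, so `Φ` maps `W` onto itself; this makes the induced map on `V ⧸ W`
  -- injective.
  have hsurj : ∀ w ∈ W, ∃ w' ∈ W, Φ w' = w := by
    intro w hw
    induction hw using Submodule.span_induction with
    | mem v hv => exact ⟨v, Submodule.subset_span hv, hv⟩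
    | zero => exact ⟨0, W.zero_mem, map_zero Φ⟩
    | add x y _ _ hx hy =>
      obtain ⟨x', hx', rfl⟩ := hx
      obtain ⟨y', hy', rfl⟩ := hy
      exact ⟨x' + y', W.add_mem hx' hy', map_add Φ _ _⟩
    | smul c x _ hx =>
      obtain ⟨x', hx', rfl⟩ := hx
      obtain ⟨d, hd⟩ := IsAlgClosed.exists_pow_nat_eq c (by omega : 0 < q)
      exact ⟨d • x', W.smul_mem _ hx', by rw [map_smulₛₗ, hσ, hd]⟩
  -- Artin–Schreier equations show that `Φ - 1` maps `W` onto itself, which lets a fixed vector of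
  -- `V ⧸ W` be lifted to a fixed vector of `V`. The scalar `c` is carried along because `Φ - 1` is
  -- not `k`-linear.
  have hAS : ∀ w ∈ W, ∀ c : k, ∃ w' ∈ W, Φ w' - w' = c • w := by
    intro w hw
    induction hw using Submodule.span_induction with
    | mem v hv =>
      intro c
      obtain ⟨x, hx⟩ : ∃ x : k, x ^ q - x = c := by
        have hdeg : (Polynomial.X ^ q - Polynomial.X - Polynomial.C c : k[X]).degree ≠ 0 := by
          have h1 : (Polynomial.X ^ q - Polynomial.X : k[X]).degree = q := by
            rw [Polynomial.degree_sub_eq_left_of_degree_lt] <;>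
              simp only [Polynomial.degree_X_pow, Polynomial.degree_X]
            exact_mod_cast hq
          have h2 : (0 : WithBot ℕ) < (Polynomial.X ^ q - Polynomial.X : k[X]).degree := by
            rw [h1]
            exact_mod_cast (by omega : 0 < q)
          rw [Polynomial.degree_sub_C h2]
          exact h2.ne'
        obtain ⟨x, hx⟩ := IsAlgClosed.exists_root _ hdeg
        exact ⟨x, by simpa [Polynomial.IsRoot, sub_eq_zero] using hx⟩
      refine ⟨x • v, W.smul_mem _ (Submodule.subset_span hv), ?_⟩
      rw [map_smulₛₗ, hσ, show Φ v = v from hv, ← sub_smul, hx]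
    | zero => exact fun c => ⟨0, W.zero_mem, by simp⟩
    | add x y _ _ hx hy =>
      intro c
      obtain ⟨x', hx', hx2⟩ := hx c
      obtain ⟨y', hy', hy2⟩ := hy c
      refine ⟨x' + y', W.add_mem hx' hy', ?_⟩
      rw [map_add, smul_add, ← hx2, ← hy2]
      abel
    | smul d x _ hx =>
      intro c
      rw [smul_smul]
      exact hx _
  by_contra hne
  have : Nontrivial (V ⧸ W) := Submodule.Quotient.nontrivial_iff.2 hne
  have hinj : Function.Injective (W.mapQ W Φ hle) := by
    rw [injective_iff_map_eq_zero]
    intro x hx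
    obtain ⟨v, rfl⟩ := W.mkQ_surjective x
    rw [Submodule.mkQ_apply, Submodule.mapQ_apply, Submodule.Quotient.mk_eq_zero] at hx
    obtain ⟨w', hw', h1⟩ := hsurj _ hx
    rw [← hΦ h1]
    exact (Submodule.Quotient.mk_eq_zero W).2 hw'
  obtain ⟨x, hx0, hx⟩ := exists_fixed_ne_zero hq hσ (W.mapQ W Φ hle) hinj
  obtain ⟨v, rfl⟩ := W.mkQ_surjective x
  rw [Submodule.mkQ_apply, Submodule.mapQ_apply, Submodule.Quotient.eq] at hx
  obtain ⟨w', hw', h1⟩ := hAS _ hx 1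
  have h2 : v - w' ∈ W := Submodule.subset_span (by
    change Φ (v - w') = v - w'
    rw [one_smul, sub_eq_sub_iff_add_eq_add] at h1
    rw [map_sub, sub_eq_sub_iff_add_eq_add, ← h1, add_comm])
  apply hx0
  refine (Submodule.Quotient.mk_eq_zero W).2 ?_
  simpa using W.add_mem h2 hw'

end Lang

/-! ### Polynomial relations and derivations -/

section PolynomialRelations

variable {R : Type u} {A : Type v} [CommRing R] [CommRing A] [Algebra R A] {ι : Type w}

lemma derivation_aeval [Fintype ι] (δ : Derivation R A A) (t : ι → A) (f : MvPolynomial ι R) :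
    δ (MvPolynomial.aeval t f) =
      ∑ i, MvPolynomial.aeval t (MvPolynomial.pderiv i f) * δ (t i) := by
  classical
  induction f using MvPolynomial.induction_on with
  | C a => simp
  | add f g hf hg => simp only [map_add, hf, hg, add_mul, Finset.sum_add_distrib]
  | mul_X f j hf =>
    rw [map_mul, Derivation.leibniz, hf]
    simp only [MvPolynomial.aeval_X, Derivation.leibniz, MvPolynomial.pderiv_X, smul_eq_mul,
      map_add, map_mul, add_mul, Finset.sum_add_distrib, Finset.mul_sum]
    congr 1
    · rw [Finset.sum_eq_single j]
      · simp
      · intro i _ hi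
        simp [hi.symm]
      · simp
    · exact Finset.sum_congr rfl fun i _ => by ring

/-- If `t` are coordinates for derivations that preserve the ideal `I`, then a polynomial relation
modulo `I` of degrees less than `p` in these coordinates has coefficients in `I`. -/
lemma coeff_mem_of_aeval_mem [Fintype ι] [DecidableEq ι] {p : ℕ}
    (hp : ∀ n : ℕ, 0 < n → n < p → IsUnit (n : A)) (t : ι → A)
    (δ : ι → Derivation R A A) (N : ι → ι → A)
    (hN : ∀ i j, ∑ l, N i l * δ l (t j) = if i = j then 1 else 0) (I : Ideal A)
    (hI : ∀ l, ∀ a ∈ I, δ l a ∈ I) (f : MvPolynomial ι R)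
    (hf : ∀ m, f.coeff m ≠ 0 → ∀ i, m i < p) (h : MvPolynomial.aeval t f ∈ I) (m : ι →₀ ℕ) :
    algebraMap R A (f.coeff m) ∈ I := by
  obtain ⟨n, hn⟩ : ∃ n, ∀ m, f.coeff m ≠ 0 → m.degree ≤ n :=
    ⟨f.support.sup Finsupp.degree, fun m hm =>
      Finset.le_sup (f := Finsupp.degree) (MvPolynomial.mem_support_iff.2 hm)⟩
  induction n generalizing f m with
  | zero =>
    have hfC : f = MvPolynomial.C (f.coeff 0) := by
      ext m
      rw [MvPolynomial.coeff_C]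
      split_ifs with h0
      · rw [h0]
      · by_contra hm
        have h1 := hn m hm
        exact h0 ((Finsupp.degree_eq_zero_iff m).1 (by omega)).symm
    by_cases h0 : m = 0
    · rw [h0]
      rw [hfC, MvPolynomial.aeval_C] at h
      exact h
    · rw [hfC, MvPolynomial.coeff_C, if_neg (Ne.symm h0), map_zero]
      exact I.zero_mem
  | succ n ih =>
    -- `N` inverts the matrix of the `δ l (t j)`, so each partial derivative of `f` at `t` is a
    -- combination of the elements `δ l (f(t))` of `I`. Its degree is smaller, and the exponents by
    -- which coefficients get multiplied are units because they are less than `p`.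
    have hpd : ∀ i, MvPolynomial.aeval t (MvPolynomial.pderiv i f) ∈ I := by
      intro i
      have h1 : MvPolynomial.aeval t (MvPolynomial.pderiv i f) =
          ∑ l, N i l * δ l (MvPolynomial.aeval t f) := by
        simp only [derivation_aeval, Finset.mul_sum]
        rw [Finset.sum_comm]
        have h2 : ∀ j, ∑ l, N i l *
            (MvPolynomial.aeval t (MvPolynomial.pderiv j f) * δ l (t j)) =
            MvPolynomial.aeval t (MvPolynomial.pderiv j f) * if i = j then 1 else 0 := by
          intro j
          rw [← hN, Finset.mul_sum]
          exact Finset.sum_congr rfl fun l _ => by ring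
        simp [h2]
      rw [h1]
      exact I.sum_mem fun l _ => I.mul_mem_left _ (hI l _ h)
    have hne : ∀ m : ι →₀ ℕ, m ≠ 0 → algebraMap R A (f.coeff m) ∈ I := by
      intro m hm
      by_cases hfm : f.coeff m = 0
      · rw [hfm, map_zero]
        exact I.zero_mem
      obtain ⟨i, hi⟩ := Finsupp.ne_iff.1 hm
      have hi' : m i ≠ 0 := hi
      have hmi : m - Finsupp.single i 1 + Finsupp.single i 1 = m :=
        tsub_add_cancel_of_le (Finsupp.single_le_iff.2 (Nat.one_le_iff_ne_zero.2 hi'))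
      have h1 := ih (MvPolynomial.pderiv i f) (by
          intro m' hm' j
          rw [MvPolynomial.coeff_pderiv] at hm'
          have h2 := hf _ (left_ne_zero_of_mul hm') j
          rw [Finsupp.add_apply] at h2
          omega) (hpd i) (m - Finsupp.single i 1) (by
          intro m' hm'
          rw [MvPolynomial.coeff_pderiv] at hm'
          have h2 := hn _ (left_ne_zero_of_mul hm')
          rw [map_add, Finsupp.degree_single] at h2
          omega)
      rw [MvPolynomial.coeff_pderiv, hmi, map_mul] at h1
      have h3 : (m - Finsupp.single i 1 : ι →₀ ℕ) i + 1 = m i := by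
        rw [Finsupp.tsub_apply, Finsupp.single_eq_same]
        omega
      have h4 : IsUnit (algebraMap R A (((m - Finsupp.single i 1 : ι →₀ ℕ) i : R) + 1)) := by
        rw [← Nat.cast_succ, Nat.succ_eq_add_one, h3, map_natCast]
        exact hp _ (Nat.pos_of_ne_zero hi') (hf m hfm i)
      exact (I.mul_unit_mem_iff_mem h4).1 h1
    by_cases h0 : m = 0
    · rw [h0]
      have h1 : MvPolynomial.aeval t f = algebraMap R A (f.coeff 0) +
          ∑ m ∈ f.support.erase 0, algebraMap R A (f.coeff m) * ∏ i, t i ^ m i := by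
        rw [MvPolynomial.aeval_def, MvPolynomial.eval₂_eq']
        by_cases h2 : (0 : ι →₀ ℕ) ∈ f.support
        · rw [← Finset.add_sum_erase _ _ h2]
          simp
        · rw [Finset.erase_eq_of_notMem h2, MvPolynomial.notMem_support_iff.1 h2]
          simp
      rw [h1] at h
      refine (I.add_mem_iff_left (I.sum_mem fun m hm => ?_)).1 h
      exact I.mul_mem_right _ (hne m (Finset.ne_of_mem_erase hm))
    · exact hne m h0

/-- Division with remainder by the polynomials `X_i ^ p - y_i`. -/
lemma exists_reduced (p : ℕ) (hp : 0 < p) (y : ι → R) (f : MvPolynomial ι R) :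
    ∃ g : MvPolynomial ι R, (∀ m, g.coeff m ≠ 0 → ∀ i, m i < p) ∧
      f - g ∈ Ideal.span (Set.range fun i => MvPolynomial.X i ^ p - MvPolynomial.C (y i)) := by
  classical
  set I := Ideal.span (Set.range fun i => (MvPolynomial.X i ^ p - MvPolynomial.C (y i) :
    MvPolynomial ι R))
  induction f using MvPolynomial.induction_on' with
  | monomial m c =>
    let r : ι →₀ ℕ := m.mapRange (· % p) (Nat.zero_mod p)
    refine ⟨MvPolynomial.monomial r (c * m.prod fun i n => y i ^ (n / p)), ?_, ?_⟩
    · intro m' hm' i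
      rw [MvPolynomial.coeff_monomial] at hm'
      split_ifs at hm' with h
      · rw [← h, Finsupp.mapRange_apply]
        exact Nat.mod_lt _ hp
      · exact absurd rfl hm'
    · rw [← Ideal.Quotient.mk_eq_mk_iff_sub_mem, MvPolynomial.monomial_eq, MvPolynomial.monomial_eq,
        Finsupp.prod_mapRange_index (by simp), Finsupp.prod, Finsupp.prod, Finsupp.prod, map_mul,
        map_mul, map_mul, map_mul, mul_assoc, map_prod, map_prod, map_prod, map_prod,
        ← Finset.prod_mul_distrib]
      congr 1
      refine Finset.prod_congr rfl fun i _ => ?_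
      have hX : Ideal.Quotient.mk I (MvPolynomial.X i) ^ p =
          Ideal.Quotient.mk I (MvPolynomial.C (y i)) := by
        rw [← map_pow, Ideal.Quotient.mk_eq_mk_iff_sub_mem]
        exact Ideal.subset_span ⟨i, rfl⟩
      rw [map_pow, map_pow, map_pow, map_pow, ← hX, ← pow_mul, ← pow_add, Nat.div_add_mod]
  | add f g hf hg =>
    obtain ⟨f', h1, h2⟩ := hf
    obtain ⟨g', h3, h4⟩ := hg
    refine ⟨f' + g', ?_, ?_⟩
    · intro m hm i
      rw [MvPolynomial.coeff_add] at hm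
      by_cases h5 : f'.coeff m = 0
      · rw [h5, zero_add] at hm
        exact h3 m hm i
      · exact h1 m h5 i
    · rw [add_sub_add_comm]
      exact I.add_mem h2 h4

end PolynomialRelations

/-! ### Invariant derivations -/

section PrimDer

variable {k : Type u} [Field k] {A : Type v} [CommRing A] [HopfAlgebra k A]
  [Coalgebra.IsCocomm k A]

/-- Contraction of the second factor with a functional. -/
def contractRight (v : CartierDual k A) : A ⊗[k] A →ₗ[k] A :=
  (TensorProduct.rid k A).toLinearMap ∘ₗ LinearMap.lTensor A (CartierDual.equivDual k A v)

@[simp] lemma contractRight_tmul (v : CartierDual k A) (a b : A) :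
    contractRight v (a ⊗ₜ b) = v b • a := rfl

lemma contractRight_one_comul (a : A) : contractRight (1 : CartierDual k A) (comul a) = a := by
  have h := lTensor_counit_comul (R := k) a
  have h2 : contractRight (1 : CartierDual k A) (comul a) =
      TensorProduct.rid k A (LinearMap.lTensor A (counit (R := k)) (comul a)) := rfl
  rw [h2, h]
  simp

variable [Module.Finite k A]

lemma contractRight_mul {v : CartierDual k A} (hv : IsPrim k v) (x y : A ⊗[k] A) :
    contractRight v (x * y) =
      contractRight v x * contractRight 1 y + contractRight 1 x * contractRight v y := by
  induction x with
  | zero => simp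
  | add x x' hx hx' => simp only [add_mul, map_add, hx, hx']; ring
  | tmul a b =>
    induction y with
    | zero => simp
    | add y y' hy hy' => simp only [mul_add, map_add, hy, hy']; ring
    | tmul c d =>
      rw [Algebra.TensorProduct.tmul_mul_tmul]
      simp only [contractRight_tmul, isPrim_dual_iff.1 hv, dual_one_apply, Algebra.smul_def,
        map_add, map_mul]
      ring

/-- The invariant derivation of `A` given by a primitive functional. -/
def primDer (v : CartierDual k A) (hv : IsPrim k v) : Derivation k A A :=
  Derivation.mk' (contractRight v ∘ₗ comul) fun a b => by
    simp only [LinearMap.comp_apply, Bialgebra.comul_mul, contractRight_mul hv,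
      contractRight_one_comul, smul_eq_mul]
    ring

lemma apply_primDer {v : CartierDual k A} (hv : IsPrim k v) (φ : CartierDual k A) (a : A) :
    φ (primDer v hv a) = (φ * v) a := by
  rw [dual_mul_eq]
  change φ (contractRight v (comul a)) = _
  generalize comul (R := k) a = w
  induction w with
  | zero => simp
  | add x y hx hy => simp only [map_add, hx, hy]
  | tmul a b => simp [dualPairing_tmul, mul_comm]

lemma counit_primDer {v : CartierDual k A} (hv : IsPrim k v) (a : A) :
    counit (R := k) (primDer v hv a) = v a := by
  rw [← dual_one_apply, apply_primDer, one_mul]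

lemma primDer_pow_mul (p : ℕ) [Fact p.Prime] [CharP k p] {v : CartierDual k A} (hv : IsPrim k v)
    (a b : A) : primDer v hv (a ^ p * b) = a ^ p * primDer v hv b := by
  have hp0 : (p : A) = 0 := by
    rw [← map_natCast (algebraMap k A), CharP.cast_eq_zero, map_zero]
  rw [Derivation.leibniz, Derivation.leibniz_pow, ← Nat.cast_smul_eq_nsmul A, hp0]
  simp

lemma primDer_pow (p : ℕ) [Fact p.Prime] [CharP k p] {v : CartierDual k A} (hv : IsPrim k v)
    (a : A) : primDer v hv (a ^ p) = 0 := by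
  have h := primDer_pow_mul p hv a 1
  simpa using h

lemma prim_mul_apply_one {v : CartierDual k A} (hv : IsPrim k v) (φ : CartierDual k A) :
    (φ * v) 1 = 0 := by
  rw [← apply_primDer hv]
  simp

end PrimDer

/-! ### Coordinates -/

section Coordinates

variable {k : Type u} [Field k] {A : Type v} [CommRing A] [HopfAlgebra k A]
  [Coalgebra.IsCocomm k A]

lemma exists_dual_family {ι : Type*} [Finite ι] [DecidableEq ι] {w : ι → CartierDual k A}
    (hw : LinearIndependent k w) : ∃ t : ι → A, ∀ i j, w i (t j) = if i = j then 1 else 0 := by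
  have := Fintype.ofFinite ι
  let L : A →ₗ[k] ι → k := LinearMap.pi fun i => CartierDual.equivDual k A (w i)
  have hL : LinearMap.range L = ⊤ := by
    by_contra hne
    obtain ⟨f, hf0, hf⟩ := Submodule.exists_le_ker_of_lt_top _ (lt_top_iff_ne_top.2 hne)
    have hsum : ∑ i, f (Pi.single i 1) • w i = 0 := by
      ext a
      have h1 : f (L a) = 0 := hf ⟨a, rfl⟩
      have h2 : L a = ∑ i, w i a • (Pi.single i 1 : ι → k) := by
        ext j
        simp [L, Finset.sum_apply, Pi.single_apply]
      rw [h2, map_sum] at h1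
      rw [dual_zero_apply, ← h1]
      have h3 : ∀ s : Finset ι, (∑ i ∈ s, f (Pi.single i 1) • w i) a =
          ∑ i ∈ s, f (w i a • (Pi.single i 1 : ι → k)) := by
        intro s
        induction s using Finset.induction_on with
        | empty => simp
        | insert i s hi ih =>
          rw [Finset.sum_insert hi, Finset.sum_insert hi, dual_add_apply, ih, dual_smul_apply,
            map_smul, smul_eq_mul, mul_comm]
      exact h3 _
    apply hf0
    ext i
    simpa using Fintype.linearIndependent_iff.1 hw _ hsum i
  choose t ht using fun j => LinearMap.range_eq_top.1 hL (Pi.single j 1)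
  refine ⟨t, fun i j => ?_⟩
  have h := congrFun (ht j) i
  rw [Pi.single_apply] at h
  exact h

variable [Module.Finite k A]

lemma linearIndependent_pointDual :
    LinearIndependent k (pointDual : (A →ₐ[k] k) → CartierDual k A) := by
  have h := linearIndep_groupLikeVal (R := k) (A := CartierDual k A)
  refine h.comp (fun χ => ⟨pointDual χ, isGroupLike_pointDual χ⟩) fun χ χ' h => ?_
  ext a
  exact DFunLike.congr_fun (congrArg GroupLike.val h) a

instance : Finite (A →ₐ[k] k) := linearIndependent_pointDual.finite_of_isNoetherian

lemma exists_interpolation [DecidableEq (A →ₐ[k] k)] :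
    ∃ e : (A →ₐ[k] k) → A, ∀ χ χ' : A →ₐ[k] k, χ (e χ') = if χ = χ' then 1 else 0 :=
  exists_dual_family linearIndependent_pointDual

variable (p : ℕ) [Fact p.Prime] [CharP k p]

lemma exists_coordinates (p : ℕ) [Fact p.Prime] [CharP k p] {ι : Type*} [Finite ι] [DecidableEq ι] (v : ι → CartierDual k A)
    (hv : ∀ i, IsPrim k (v i)) (hli : LinearIndependent k v) :
    ∃ t : ι → A, ∀ (χ : A →ₐ[k] k) (i j : ι),
      χ (primDer (v i) (hv i) (t j)) = if i = j then 1 else 0 := by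
  classical
  have := Fintype.ofFinite (A →ₐ[k] k)
  have h1 : ∀ χ : A →ₐ[k] k, ∃ t : ι → A, ∀ i j,
      (pointDual χ * v i) (t j) = if i = j then 1 else 0 := by
    intro χ
    obtain ⟨u, hu⟩ := (isGroupLike_pointDual χ).isUnit
    refine exists_dual_family (w := fun i => pointDual χ * v i) ?_
    have := Fintype.ofFinite ι
    rw [Fintype.linearIndependent_iff] at hli ⊢
    intro c hc
    refine hli c ((Units.mul_right_eq_zero u).1 ?_)
    rw [hu, Finset.mul_sum, ← hc]
    exact Finset.sum_congr rfl fun i _ => mul_smul_comm _ _ _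
  choose s hs using h1
  obtain ⟨e, he⟩ := exists_interpolation (k := k) (A := A)
  refine ⟨fun j => ∑ χ, e χ ^ p * s χ j, fun χ i j => ?_⟩
  rw [map_sum, map_sum, Finset.sum_eq_single χ]
  · rw [primDer_pow_mul, map_mul, map_pow, he, if_pos rfl, one_pow, one_mul]
    have h2 := apply_primDer (hv i) (pointDual χ) (s χ j)
    rw [hs, pointDual_apply] at h2
    exact h2
  · intro χ' _ hne
    rw [primDer_pow_mul, map_mul, map_pow, he, if_neg hne.symm,
      zero_pow (Fact.out : p.Prime).ne_zero, zero_mul]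
  · simp

/-- The Jacobian determinant takes the value 1 at every point, so it is a unit. -/
lemma exists_inverse_coordinates [IsAlgClosed k] {ι : Type*} [Fintype ι] [DecidableEq ι]
    {v : ι → CartierDual k A} {hv : ∀ i, IsPrim k (v i)} {t : ι → A}
    (ht : ∀ (χ : A →ₐ[k] k) (i j : ι),
      χ (primDer (v i) (hv i) (t j)) = if i = j then 1 else 0) :
    ∃ N : ι → ι → A, ∀ i j, ∑ l, N i l * primDer (v l) (hv l) (t j) = if i = j then 1 else 0 := by
  let M : Matrix ι ι A := fun i j => primDer (v i) (hv i) (t j)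
  have hM : IsUnit M.det := by
    refine isUnit_of_forall_point (k := k) fun χ => ?_
    have h1 : (χ : A →+* k).mapMatrix M = 1 := by
      ext i j
      simpa [Matrix.one_apply] using ht χ i j
    have h2 : χ M.det = 1 := by
      have h3 := RingHom.map_det (χ : A →+* k) M
      rw [h1, Matrix.det_one] at h3
      exact h3
    rw [h2]
    exact one_ne_zero
  refine ⟨fun i j => (M⁻¹ : Matrix ι ι A) i j, fun i j => ?_⟩
  have h := congrFun (congrFun (Matrix.nonsing_inv_mul M hM) i) j
  rw [Matrix.mul_apply, Matrix.one_apply] at h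
  exact h

/-- A function that vanishes at a point and is killed there by all invariant derivations vanishes
to second order. -/
lemma mem_ker_sq (χ : A →ₐ[k] k) {a : A} (h0 : χ a = 0)
    (h : ∀ v (hv : IsPrim k v), χ (primDer v hv a) = 0) : a ∈ RingHom.ker χ ^ 2 := by
  by_contra hnot
  obtain ⟨f, hf1, hf2⟩ := Submodule.exists_le_ker_of_notMem
    (p := (RingHom.ker χ ^ 2).restrictScalars k) (v := a)
    (fun h => hnot ((Submodule.restrictScalars_mem _ _ _).1 h))
  -- A functional that separates `a` from the square of the maximal ideal becomes a derivation at
  -- `χ` once its value at 1 is removed. Multiplication by the inverse of the group-like functional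
  -- `χ` translates it to the origin, where it is primitive.
  let ω : CartierDual k A := (CartierDual.equivDual k A).symm f - f 1 • pointDual χ
  have hω : ∀ x, ω x = f x - f 1 * χ x := fun x => by
    change (CartierDual.equivDual k A ω) x = _
    rw [map_sub, LinearMap.sub_apply]
    rfl
  have hω2 : ∀ x y, ω (x * y) = ω x * χ y + χ x * ω y := by
    intro x y
    have h1 : f ((x - algebraMap k A (χ x)) * (y - algebraMap k A (χ y))) = 0 := hf2 (by
      rw [Submodule.restrictScalars_mem, sq]
      exact Ideal.mul_mem_mul (by simp [RingHom.mem_ker]) (by simp [RingHom.mem_ker]))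
    have h2 : (x - algebraMap k A (χ x)) * (y - algebraMap k A (χ y)) =
        x * y - χ y • x - χ x • y + (χ x * χ y) • (1 : A) := by
      simp only [Algebra.smul_def, map_mul, mul_one]
      ring
    rw [h2, map_add, map_sub, map_sub, map_smul, map_smul, map_smul, smul_eq_mul, smul_eq_mul,
      smul_eq_mul] at h1
    rw [hω, hω, hω, map_mul χ]
    linear_combination h1
  have hΔ : comul (R := k) ω = ω ⊗ₜ[k] pointDual χ + pointDual χ ⊗ₜ[k] ω := by
    refine dualPairing_ext fun x y => ?_
    rw [comul_dual_apply, hω2, map_add, LinearMap.add_apply, dualPairing_tmul, dualPairing_tmul]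
    rfl
  have hg := isGroupLike_pointDual χ
  set g' := HopfAlgebra.antipode k (pointDual χ) with hg'
  have hgg : g' * pointDual χ = 1 := hg.antipode_mul_cancel
  have hv : IsPrim k (g' * ω) := by
    rw [IsPrim, Bialgebra.comul_mul, hΔ, hg.antipode.comul_eq_tmul_self, mul_add,
      Algebra.TensorProduct.tmul_mul_tmul, Algebra.TensorProduct.tmul_mul_tmul, hgg]
  have h1 := h _ hv
  have h2 : (pointDual χ * (g' * ω)) a = χ (primDer _ hv a) := (apply_primDer hv _ a).symm
  rw [← mul_assoc, mul_comm (pointDual χ), hgg, one_mul, h1, hω, h0, mul_zero, sub_zero] at h2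
  exact hf1 h2

variable [IsAlgClosed k]

variable (k A) in
/-- The subalgebra of `p`-th powers. -/
def frobSub : Subalgebra k A where
  carrier := {x | ∃ y, y ^ p = x}
  mul_mem' := by
    rintro _ _ ⟨x, rfl⟩ ⟨y, rfl⟩
    exact ⟨x * y, mul_pow x y p⟩
  add_mem' := by
    rintro _ _ ⟨x, rfl⟩ ⟨y, rfl⟩
    exact ⟨x + y, add_pow_p k p x y⟩
  algebraMap_mem' c := by
    obtain ⟨d, rfl⟩ := IsAlgClosed.exists_pow_nat_eq c (Fact.out : p.Prime).pos
    exact ⟨algebraMap k A d, (map_pow _ _ _).symm⟩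

/-- Functions are polynomials in coordinates, with `p`-th powers as coefficients. -/
theorem aeval_coordinates_surjective {ι : Type*} [Fintype ι] [DecidableEq ι]
    {v : ι → CartierDual k A} {hv : ∀ i, IsPrim k (v i)} {t : ι → A}
    (ht : ∀ (χ : A →ₐ[k] k) (i j : ι),
      χ (primDer (v i) (hv i) (t j)) = if i = j then 1 else 0)
    (hspan : ∀ w : CartierDual k A, IsPrim k w → w ∈ Submodule.span k (Set.range v)) :
    Function.Surjective (MvPolynomial.aeval t : MvPolynomial ι (frobSub k A p) →ₐ[_] A) := by
  classical
  set B := (MvPolynomial.aeval t : MvPolynomial ι (frobSub k A p) →ₐ[_] A).range with hB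
  have htB : ∀ i, t i ∈ B := fun i => ⟨MvPolynomial.X i, MvPolynomial.aeval_X _ _⟩
  have hpB : ∀ x : A, x ^ p ∈ B := fun x => B.algebraMap_mem ⟨x ^ p, x, rfl⟩
  have hkB : ∀ c : k, algebraMap k A c ∈ B := fun c =>
    B.algebraMap_mem (algebraMap k (frobSub k A p) c)
  -- first order
  have hone : ∀ (χ : A →ₐ[k] k) (a : A), χ a = 0 → ∃ b ∈ B, a - b ∈ RingHom.ker χ ^ 2 := by
    intro χ a ha
    refine ⟨∑ j, algebraMap k A (χ (primDer (v j) (hv j) a)) * (t j - algebraMap k A (χ (t j))),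
      B.sum_mem fun j _ => B.mul_mem (hkB _) (B.sub_mem (htB j) (hkB _)), ?_⟩
    have hvi : ∀ i, χ (primDer (v i) (hv i) (a - ∑ j, algebraMap k A
        (χ (primDer (v j) (hv j) a)) * (t j - algebraMap k A (χ (t j))))) = 0 := by
      intro i
      have h1 : ∀ j, χ (primDer (v i) (hv i) (algebraMap k A (χ (primDer (v j) (hv j) a)) *
          (t j - algebraMap k A (χ (t j))))) =
          χ (primDer (v j) (hv j) a) * if i = j then 1 else 0 := by
        intro j
        rw [← Algebra.smul_def, Derivation.map_smul, map_sub, Derivation.map_algebraMap, sub_zero,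
          map_smul, ht, smul_eq_mul]
      rw [map_sub, map_sub, map_sum, map_sum, Finset.sum_congr rfl fun j _ => h1 j]
      simp
    refine mem_ker_sq χ ?_ fun w hw => ?_
    · rw [map_sub, ha, map_sum]
      simp
    · have h2 : ∀ x : A, χ (primDer w hw x) = (pointDual χ * w) x := fun x =>
        apply_primDer hw (pointDual χ) x
      rw [h2]
      have h3 : ∀ i x, χ (primDer (v i) (hv i) x) = (pointDual χ * v i) x := fun i x =>
        apply_primDer (hv i) (pointDual χ) x
      generalize a - ∑ j, algebraMap k A (χ (primDer (v j) (hv j) a)) *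
        (t j - algebraMap k A (χ (t j))) = x at hvi
      have hw' := hspan w hw
      clear h2 hw
      induction hw' using Submodule.span_induction with
      | mem w hw =>
        obtain ⟨i, rfl⟩ := hw
        rw [← h3, hvi]
      | zero => simp
      | add y z _ _ hy hz => rw [mul_add, dual_add_apply, hy, hz, add_zero]
      | smul c y _ hy => rw [mul_smul_comm, dual_smul_apply, hy, mul_zero]
  -- Products of first-order approximations approximate products to the next order, and every power
  -- of the maximal ideal is spanned by products.
  have hr : ∀ (χ : A →ₐ[k] k) (r : ℕ), ∀ a ∈ RingHom.ker χ ^ (r + 1),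
      ∃ b ∈ B, a - b ∈ RingHom.ker χ ^ (r + 2) := by
    intro χ r
    induction r with
    | zero =>
      intro a ha
      exact hone χ a (by simpa using ha)
    | succ r ih =>
      intro a ha
      rw [pow_succ] at ha
      induction ha using Submodule.mul_induction_on' with
      | mem_mul_mem x hx y hy =>
        obtain ⟨b, hb, hxb⟩ := ih x hx
        obtain ⟨b', hb', hyb⟩ := hone χ y hy
        refine ⟨b * b', B.mul_mem hb hb', ?_⟩
        have hbm : b ∈ RingHom.ker χ ^ (r + 1) := by
          have := Ideal.pow_le_pow_right (by omega : r + 1 ≤ r + 2) hxb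
          rw [← sub_sub_cancel x b]
          exact Ideal.sub_mem _ hx this
        rw [show x * y - b * b' = (x - b) * y + b * (y - b') by ring]
        refine Ideal.add_mem _ ?_ ?_
        · rw [show r + 1 + 2 = (r + 2) + 1 by omega, pow_succ]
          exact Ideal.mul_mem_mul hxb hy
        · rw [show r + 1 + 2 = (r + 1) + 2 by omega, pow_add]
          exact Ideal.mul_mem_mul hbm hyb
      | add x _ y _ hx hy =>
        obtain ⟨b, hb, hxb⟩ := hx
        obtain ⟨b', hb', hyb⟩ := hy
        refine ⟨b + b', B.add_mem hb hb', ?_⟩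
        rw [add_sub_add_comm]
        exact Ideal.add_mem _ hxb hyb
  have hr' : ∀ (χ : A →ₐ[k] k) (r : ℕ) (a : A), ∃ b ∈ B, a - b ∈ RingHom.ker χ ^ r := by
    intro χ r a
    induction r with
    | zero => exact ⟨0, B.zero_mem, by simp⟩
    | succ r ih =>
      rcases Nat.eq_zero_or_pos r with rfl | hr0
      · exact ⟨algebraMap k A (χ a), hkB _, by simp [RingHom.mem_ker]⟩
      · obtain ⟨b, hb, hab⟩ := ih
        obtain ⟨s, rfl⟩ : ∃ s, r = s + 1 := ⟨r - 1, by omega⟩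
        obtain ⟨b', hb', hab'⟩ := hr χ s _ hab
        exact ⟨b + b', B.add_mem hb hb', by rwa [← sub_sub]⟩
  -- gluing
  have : IsNoetherianRing A := IsNoetherianRing.of_finite k A
  have : Nontrivial A := Bialgebra.nontrivial k
  have : CharP A p := charP_of_injective_algebraMap (algebraMap k A).injective p
  have := Fintype.ofFinite (A →ₐ[k] k)
  obtain ⟨r, hnil⟩ := IsNoetherianRing.isNilpotent_nilradical A
  obtain ⟨e, he⟩ := exists_interpolation (k := k) (A := A)
  -- The exponent `p ^ (r + 1)` serves three purposes: it is at least `r`, so that the power of `e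
  -- χ` kills the `r`-th power of the maximal ideal of `χ`; it is a power of `p`, so that these
  -- powers sum to 1; and it is divisible by `p`, so that they lie in `B`.
  have hrp : r ≤ p ^ (r + 1) :=
    (Nat.le_succ r).trans (Nat.lt_pow_self (Fact.out : p.Prime).one_lt).le
  have hker : ∀ χ : A →ₐ[k] k, ∀ x ∈ RingHom.ker χ ^ r, e χ ^ p ^ (r + 1) * x = 0 := by
    intro χ x hx
    have h1 : Ideal.span {e χ} * RingHom.ker χ ≤ nilradical A := by
      rw [Ideal.span_singleton_mul_le_iff]
      intro y hy
      rw [mem_nilradical]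
      refine isNilpotent_of_forall_point (k := k) fun χ' => ?_
      rw [map_mul, he]
      split_ifs with h
      · rw [h, show χ y = 0 from hy, mul_zero]
      · rw [zero_mul]
    have h2 : e χ ^ r * x ∈ (Ideal.span {e χ} * RingHom.ker χ) ^ r := by
      rw [mul_pow]
      exact Ideal.mul_mem_mul (Ideal.pow_mem_pow (Ideal.mem_span_singleton_self _) _) hx
    have h3 := Ideal.pow_right_mono h1 r h2
    rw [hnil] at h3
    rw [← Nat.sub_add_cancel hrp, pow_add, mul_assoc, show e χ ^ r * x = 0 from h3, mul_zero]
  have hsum : ∑ χ, e χ ^ p ^ (r + 1) = 1 := by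
    have h1 : ∑ χ, e χ - 1 ∈ nilradical A := by
      rw [mem_nilradical]
      refine isNilpotent_of_forall_point (k := k) fun χ' => ?_
      rw [map_sub, map_sum, map_one, Finset.sum_eq_single χ', he, if_pos rfl, sub_self]
      · intro χ _ hne
        rw [he, if_neg hne.symm]
      · simp
    have h2 : (∑ χ, e χ - 1) ^ p ^ (r + 1) = 0 := by
      have h3 := Ideal.pow_mem_pow h1 r
      rw [hnil] at h3
      rw [← Nat.sub_add_cancel hrp, pow_add, show (∑ χ, e χ - 1) ^ r = 0 from h3, mul_zero]
    rw [sub_pow_char_pow, one_pow, sum_pow_char_pow, sub_eq_zero] at h2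
    exact h2
  intro a
  change a ∈ B
  choose b hb hab using fun χ => hr' χ r a
  have h1 : a = ∑ χ, e χ ^ p ^ (r + 1) * b χ := by
    calc a = ∑ χ, e χ ^ p ^ (r + 1) * a := by rw [← Finset.sum_mul, hsum, one_mul]
      _ = _ := Finset.sum_congr rfl fun χ _ => by
        have h2 := hker χ _ (hab χ)
        rw [mul_sub, sub_eq_zero] at h2
        exact h2
  rw [h1]
  refine B.sum_mem fun χ _ => B.mul_mem ?_ (hb χ)
  rw [pow_succ, pow_mul]
  exact hpB _

end Coordinates

/-! ### Dimensions -/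

section Reduced

variable {R : Type u} {A : Type v} [CommRing R] [CommRing A] [Algebra R A] {ι : Type w} [Fintype ι]
  {p : ℕ}

/-- The exponent vector with entries `e i < p`. -/
def expVec (e : ι → Fin p) : ι →₀ ℕ := Finsupp.equivFunOnFinite.symm fun i => (e i : ℕ)

lemma expVec_apply (e : ι → Fin p) (i : ι) : expVec e i = (e i : ℕ) := rfl

lemma expVec_injective : Function.Injective (expVec : (ι → Fin p) → ι →₀ ℕ) := fun e e' h => by
  ext i
  exact DFunLike.congr_fun h i

lemma exists_expVec {m : ι →₀ ℕ} (h : ∀ i, m i < p) : ∃ e : ι → Fin p, expVec e = m :=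
  ⟨fun i => ⟨m i, h i⟩, by ext i; rfl⟩

variable [DecidableEq ι]

/-- The polynomial with coefficients `c e`, of degree less than `p` in each variable. -/
def reducedPoly (c : (ι → Fin p) → R) : MvPolynomial ι R :=
  ∑ e, MvPolynomial.monomial (expVec e) (c e)

lemma coeff_reducedPoly (c : (ι → Fin p) → R) (e : ι → Fin p) :
    (reducedPoly c).coeff (expVec e) = c e := by
  rw [reducedPoly, MvPolynomial.coeff_sum, Finset.sum_eq_single e]
  · rw [MvPolynomial.coeff_monomial, if_pos rfl]
  · intro e' _ hne
    rw [MvPolynomial.coeff_monomial, if_neg fun h => hne (expVec_injective h)]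
  · simp

lemma lt_of_coeff_reducedPoly_ne_zero (c : (ι → Fin p) → R) (m : ι →₀ ℕ)
    (h : (reducedPoly c).coeff m ≠ 0) (i : ι) : m i < p := by
  rw [reducedPoly, MvPolynomial.coeff_sum] at h
  obtain ⟨e, -, he⟩ := Finset.exists_ne_zero_of_sum_ne_zero h
  rw [MvPolynomial.coeff_monomial] at he
  split_ifs at he with h1
  · rw [← h1, expVec_apply]
    exact (e i).2
  · exact absurd rfl he

lemma exists_eq_reducedPoly (f : MvPolynomial ι R) (h : ∀ m, f.coeff m ≠ 0 → ∀ i, m i < p) :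
    f = reducedPoly fun e => f.coeff (expVec (p := p) e) := by
  ext m
  by_cases hm : ∀ i, m i < p
  · obtain ⟨e, rfl⟩ := exists_expVec hm
    rw [coeff_reducedPoly]
  · rw [not_imp_comm.1 (h m) hm, eq_comm, ← not_ne_iff]
    exact fun h1 => hm (lt_of_coeff_reducedPoly_ne_zero _ m h1)

lemma aeval_reducedPoly (t : ι → A) (c : (ι → Fin p) → R) :
    MvPolynomial.aeval t (reducedPoly c) = ∑ e, c e • ∏ i, t i ^ (e i : ℕ) := by
  rw [reducedPoly, map_sum]
  refine Finset.sum_congr rfl fun e _ => ?_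
  rw [MvPolynomial.aeval_monomial, Algebra.smul_def, Finsupp.prod_fintype _ _ fun i => pow_zero _]
  rfl

/-- Evaluation of reduced polynomials. -/
def reducedEval (k : Type*) [CommRing k] [Algebra k R] [Algebra k A] [IsScalarTower k R A]
    (t : ι → A) : ((ι → Fin p) → R) →ₗ[k] A where
  toFun c := ∑ e, c e • ∏ i, t i ^ (e i : ℕ)
  map_add' c c' := by simp only [Pi.add_apply, add_smul, Finset.sum_add_distrib]
  map_smul' r c := by simp only [Pi.smul_apply, smul_assoc, Finset.smul_sum, RingHom.id_apply]

end Reduced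

/-! ### Freeness over the `p`-th powers and the order of a self-dual `BT₁`. -/

section Dimension

variable {k : Type u} [Field k] {A : Type v} [CommRing A] [HopfAlgebra k A]
  [Coalgebra.IsCocomm k A] [Module.Finite k A] (p : ℕ) [Fact p.Prime] [CharP k p]

variable (k) in
lemma isUnit_natCast {R : Type*} [CommRing R] [Algebra k R] (n : ℕ) (h0 : 0 < n) (hn : n < p) :
    IsUnit (n : R) := by
  rw [← map_natCast (algebraMap k R)]
  refine IsUnit.map _ (IsUnit.mk0 _ fun h => ?_)
  rw [CharP.cast_eq_zero_iff k p] at h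
  exact absurd (Nat.le_of_dvd h0 h) (by omega)

lemma primDer_mem_kerFrobIdeal {v : CartierDual k A} (hv : IsPrim k v) {a : A}
    (ha : a ∈ kerFrobIdeal k p A) : primDer v hv a ∈ kerFrobIdeal k p A := by
  induction ha using Submodule.span_induction with
  | mem x hx =>
    obtain ⟨y, -, rfl⟩ := hx
    rw [primDer_pow]
    exact zero_mem _
  | zero => simp
  | add x y _ _ hx hy =>
    rw [map_add]
    exact add_mem hx hy
  | smul b x hx ih =>
    rw [smul_eq_mul, Derivation.leibniz]
    exact add_mem (Ideal.mul_mem_left _ _ ih) (Ideal.mul_mem_right _ _ hx)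

lemma counit_of_mem_kerFrobIdeal {a : A} (ha : a ∈ kerFrobIdeal k p A) :
    counit (R := k) a = 0 := by
  have h : kerFrobIdeal k p A ≤ RingHom.ker (Bialgebra.counitAlgHom k A) := by
    refine Ideal.span_le.2 ?_
    rintro _ ⟨x, hx, rfl⟩
    change Bialgebra.counitAlgHom k A (x ^ p) = 0
    rw [map_pow, show Bialgebra.counitAlgHom k A x = 0 from hx,
      zero_pow (Fact.out : p.Prime).ne_zero]
  exact h ha

lemma pow_sub_mem_kerFrobIdeal (x : A) :
    x ^ p - algebraMap k A (counit (R := k) x) ^ p ∈ kerFrobIdeal k p A := by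
  have : Nontrivial A := Bialgebra.nontrivial k
  have : CharP A p := charP_of_injective_algebraMap (algebraMap k A).injective p
  rw [← sub_pow_char]
  refine Ideal.subset_span ⟨_, ?_, rfl⟩
  change Bialgebra.counitAlgHom k A _ = 0
  simp

variable [IsAlgClosed k]

/-- An invariant derivation as a derivation over the ring of `p`-th powers. -/
def primDerFrob (v : CartierDual k A) (hv : IsPrim k v) : Derivation (frobSub k A p) A A :=
  Derivation.mk'
    { toFun := primDer v hv
      map_add' := map_add _
      map_smul' := by
        rintro ⟨_, y, rfl⟩ a
        exact primDer_pow_mul p hv y a }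
    (primDer v hv).leibniz

variable (k A) in
/-- Coordinates dual to a basis of invariant derivations. -/
structure Coords where
  /-- the index type is `Fin d` -/
  d : ℕ
  /-- the primitive elements -/
  v : Fin d → CartierDual k A
  hv : ∀ i, IsPrim k (v i)
  span : ∀ w : CartierDual k A, IsPrim k w → w ∈ Submodule.span k (Set.range v)
  finrank : Module.finrank k (primSubmodule k (CartierDual k A)) = d
  /-- the coordinate functions -/
  t : Fin d → A
  ht : ∀ (χ : A →ₐ[k] k) (i j : Fin d), χ (primDer (v i) (hv i) (t j)) = if i = j then 1 else 0

lemma exists_coords (k : Type u) [Field k] (A : Type v) [CommRing A] [HopfAlgebra k A]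
    [Coalgebra.IsCocomm k A] [Module.Finite k A] (p : ℕ) [Fact p.Prime] [CharP k p] :
    Nonempty (Coords k A) := by
  let b := Module.finBasis k (primSubmodule k (CartierDual k A))
  have hli : LinearIndependent k fun i => (b i : CartierDual k A) :=
    b.linearIndependent.map' (Submodule.subtype _) (Submodule.ker_subtype _)
  obtain ⟨t, ht⟩ := exists_coordinates p (fun i => (b i : CartierDual k A)) (fun i => (b i).2) hli
  refine ⟨⟨_, fun i => b i, fun i => (b i).2, fun w hw => ?_, rfl, t, ht⟩⟩
  have h1 : (⟨w, hw⟩ : primSubmodule k (CartierDual k A)) ∈ Submodule.span k (Set.range b) := by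
    rw [b.span_eq]
    trivial
  have h2 := Submodule.mem_map_of_mem (f := Submodule.subtype _) h1
  rw [Submodule.map_span, ← Set.range_comp] at h2
  exact h2

namespace Coords

variable {p} (X : Coords k A)

lemma exists_inverse : ∃ N : Fin X.d → Fin X.d → A,
    ∀ i j, ∑ l, N i l * primDer (X.v l) (X.hv l) (X.t j) = if i = j then 1 else 0 :=
  exists_inverse_coordinates X.ht

/-- Invariant derivations are linear over the `p`-th powers, so `coeff_mem_of_aeval_mem` applies
with these as the ring of constants. It is used for the zero ideal, for the ideal of the kernel of
Frobenius, and for the annihilator of `primAlg`. -/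
lemma coeff_mem (I : Ideal A) (hI : ∀ v (hv : IsPrim k v), ∀ a ∈ I, primDer v hv a ∈ I)
    (c : (Fin X.d → Fin p) → frobSub k A p)
    (h : reducedEval k X.t c ∈ I) (e : Fin X.d → Fin p) : (c e : A) ∈ I := by
  obtain ⟨N, hN⟩ := X.exists_inverse
  have h1 := coeff_mem_of_aeval_mem (isUnit_natCast k p (R := A)) X.t
    (fun l => primDerFrob p (X.v l) (X.hv l)) N hN I (fun l a ha => hI _ (X.hv l) a ha) (reducedPoly c)
    (lt_of_coeff_reducedPoly_ne_zero c) (by rw [aeval_reducedPoly]; exact h) (expVec e)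
  rw [coeff_reducedPoly] at h1
  exact h1

lemma reducedEval_injective :
    Function.Injective (reducedEval k X.t : ((Fin X.d → Fin p) → frobSub k A p) →ₗ[k] A) := by
  rw [← LinearMap.ker_eq_bot, LinearMap.ker_eq_bot']
  intro c hc
  funext e
  have h := X.coeff_mem ⊥ (fun v hv a ha => by rw [(Submodule.mem_bot A).1 ha]; simp) c
    (by rw [hc]; simp) e
  exact Subtype.ext ((Submodule.mem_bot A).1 h)

lemma reducedEval_surjective :
    Function.Surjective (reducedEval k X.t : ((Fin X.d → Fin p) → frobSub k A p) →ₗ[k] A) := by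
  intro a
  obtain ⟨f, rfl⟩ := aeval_coordinates_surjective p X.ht X.span a
  obtain ⟨g, hg, hfg⟩ := exists_reduced p (Fact.out : p.Prime).pos
    (fun i => (⟨X.t i ^ p, X.t i, rfl⟩ : frobSub k A p)) f
  refine ⟨fun e => g.coeff (expVec e), ?_⟩
  have h1 : MvPolynomial.aeval X.t (f - g) = 0 := by
    have h2 : Ideal.span (Set.range fun i => (MvPolynomial.X i ^ p - MvPolynomial.C
        (⟨X.t i ^ p, X.t i, rfl⟩ : frobSub k A p) : MvPolynomial (Fin X.d) (frobSub k A p))) ≤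
        RingHom.ker (MvPolynomial.aeval X.t : _ →ₐ[frobSub k A p] A) := by
      rw [Ideal.span_le]
      rintro _ ⟨i, rfl⟩
      rw [SetLike.mem_coe, RingHom.mem_ker, map_sub, map_pow, MvPolynomial.aeval_X,
        MvPolynomial.aeval_C, sub_eq_zero]
      rfl
    exact h2 hfg
  rw [map_sub, sub_eq_zero] at h1
  rw [h1]
  conv_rhs => rw [exists_eq_reducedPoly g hg, aeval_reducedPoly]
  rfl

/-- The monomials in the coordinates with all exponents less than `p` form a basis of `A` over the
ring of `p`-th powers. -/
lemma finrank_eq : Module.finrank k A = p ^ X.d * Module.finrank k (frobSub k A p) := by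
  rw [← (LinearEquiv.ofBijective _ ⟨X.reducedEval_injective (p := p), X.reducedEval_surjective⟩).finrank_eq,
    Module.finrank_pi_fintype]
  simp

/-- Every function is congruent to a reduced polynomial with constant coefficients modulo the ideal
of the kernel of Frobenius. -/
lemma exists_sub_mem_kerFrobIdeal (a : A) : ∃ c : (Fin X.d → Fin p) → k,
    a - reducedEval k X.t c ∈ kerFrobIdeal k p A := by
  obtain ⟨c, rfl⟩ := X.reducedEval_surjective (p := p) a
  refine ⟨fun e => counit (R := k) (c e : A), ?_⟩
  change (∑ e, c e • ∏ i, X.t i ^ (e i : ℕ)) -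
    ∑ e, counit (R := k) (c e : A) • ∏ i, X.t i ^ (e i : ℕ) ∈ _
  rw [← Finset.sum_sub_distrib]
  refine Ideal.sum_mem _ fun e _ => ?_
  obtain ⟨y, hy⟩ := (c e).2
  have h1 : c e • ∏ i, X.t i ^ (e i : ℕ) = y ^ p * ∏ i, X.t i ^ (e i : ℕ) := by
    rw [hy]
    rfl
  rw [h1, Algebra.smul_def, ← sub_mul, ← hy, Bialgebra.counit_pow, map_pow]
  exact Ideal.mul_mem_right _ _ (pow_sub_mem_kerFrobIdeal p y)

lemma eq_zero_of_reducedEval_mem (I : Ideal A)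
    (hI : ∀ v (hv : IsPrim k v), ∀ a ∈ I, primDer v hv a ∈ I)
    (h0 : ∀ a ∈ I, counit (R := k) a = 0)
    (c : (Fin X.d → Fin p) → k) (h : reducedEval k X.t c ∈ I) : c = 0 := by
  funext e
  have h1 := X.coeff_mem (p := p) I hI (fun e => algebraMap k _ (c e)) (by
    convert h using 1
    refine Finset.sum_congr rfl fun e _ => ?_
    rw [algebraMap_smul]) e
  have h2 := h0 _ h1
  have h3 : ((algebraMap k (frobSub k A p) (c e) : frobSub k A p) : A) = algebraMap k A (c e) := rfl
  rw [h3] at h2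
  simpa using h2

/-- Modulo this ideal a `p`-th power equals its value at the origin, so the reduced monomials span
over `k`. They stay independent because the ideal is stable under invariant derivations and vanishes
at the origin. -/
lemma finrank_quotient : Module.finrank k (A ⧸ kerFrobIdeal k p A) = p ^ X.d := by
  let L : ((Fin X.d → Fin p) → k) →ₗ[k] A ⧸ kerFrobIdeal k p A :=
    (Ideal.Quotient.mkₐ k (kerFrobIdeal k p A)).toLinearMap ∘ₗ reducedEval k X.t
  have hi : Function.Injective L := by
    rw [← LinearMap.ker_eq_bot, LinearMap.ker_eq_bot']
    intro c hc
    refine X.eq_zero_of_reducedEval_mem (kerFrobIdeal k p A)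
      (fun v hv a ha => primDer_mem_kerFrobIdeal p hv ha)
      (fun a ha => counit_of_mem_kerFrobIdeal p ha) c ?_
    exact Ideal.Quotient.eq_zero_iff_mem.1 hc
  have hs : Function.Surjective L := by
    intro a
    obtain ⟨a, rfl⟩ := Ideal.Quotient.mk_surjective a
    obtain ⟨c, hc⟩ := X.exists_sub_mem_kerFrobIdeal (p := p) a
    exact ⟨c, (Ideal.Quotient.eq.2 hc).symm⟩
  rw [← (LinearEquiv.ofBijective L ⟨hi, hs⟩).finrank_eq]
  simp

end Coords

lemma verschiebung_eq_zero_iff (a : A) :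
    verschiebung k p A a = 0 ↔ ∀ φ : CartierDual k A, (φ ^ p) a = 0 := by
  constructor
  · intro h φ
    rw [← verschiebung_spec, h, map_zero, zero_pow (Fact.out : p.Prime).ne_zero]
  · intro h
    refine dual_sep k fun φ => ?_
    have h1 := verschiebung_spec k p A a φ
    rw [h] at h1
    exact pow_eq_zero_iff (Fact.out : p.Prime).ne_zero |>.1 h1

variable {p} in
lemma IsBT1.mem_kerFrobIdeal_iff (hG : IsBT1 k p A) (a : A) :
    a ∈ kerFrobIdeal k p A ↔ ∀ φ : CartierDual k A, (φ ^ p) a = 0 :=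
  (hG.kerFrob_eq_imVer a).trans (verschiebung_eq_zero_iff p a)

variable {p} in
-- Since Verschiebung is the transpose of the `p`-power map of the dual, ker Frob = im Ver says that
-- `kerFrobIdeal` is exactly the annihilator of the `p`-th powers of the dual. Their dimension is
-- thus the codimension of this ideal.
lemma IsBT1.finrank_frobSub_dual (hG : IsBT1 k p A) :
    Module.finrank k (frobSub k (CartierDual k A) p) =
      p ^ Module.finrank k (primSubmodule k (CartierDual k A)) := by
  obtain ⟨X⟩ := exists_coords k A p
  let W : Subspace k (Module.Dual k A) :=
    (frobSub k (CartierDual k A) p).toSubmodule.map (CartierDual.equivDual k A).toLinearMap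
  have h1 : Module.finrank k W = Module.finrank k (frobSub k (CartierDual k A) p) :=
    LinearEquiv.finrank_map_eq (CartierDual.equivDual k A) _
  have h2 : W.dualCoannihilator = (kerFrobIdeal k p A).restrictScalars k := by
    ext a
    rw [Submodule.restrictScalars_mem, hG.mem_kerFrobIdeal_iff, Submodule.mem_dualCoannihilator]
    constructor
    · exact fun h φ => h _ ⟨φ ^ p, ⟨φ, rfl⟩, rfl⟩
    · rintro h _ ⟨_, ⟨φ, rfl⟩, rfl⟩
      exact h φ
  have h3 := Subspace.finrank_add_finrank_dualCoannihilator_eq W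
  rw [h2, h1] at h3
  have h4 := Submodule.finrank_quotient_add_finrank ((kerFrobIdeal k p A).restrictScalars k)
  have h5 : Module.finrank k (A ⧸ (kerFrobIdeal k p A).restrictScalars k) =
      p ^ X.d := X.finrank_quotient
  rw [X.finrank, ← h5]
  omega

variable {p} in
/-- The order of a self-dual `BT₁` in terms of its tangent space. -/
lemma IsBT1.finrank_eq (hG : IsBT1 k p A) (ψ : CartierDual k A ≃ₐc[k] A) :
    Module.finrank k A = p ^ (2 * Module.finrank k (primSubmodule k (CartierDual k A))) := by
  obtain ⟨X⟩ := exists_coords k A p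
  have h1 : Module.finrank k (frobSub k A p) = Module.finrank k (frobSub k (CartierDual k A) p) := by
    have h2 : (frobSub k (CartierDual k A) p).toSubmodule.map
        ((ψ : CartierDual k A ≃ₐ[k] A).toLinearEquiv : CartierDual k A →ₗ[k] A) =
        (frobSub k A p).toSubmodule := by
      ext a
      constructor
      · rintro ⟨_, ⟨φ, rfl⟩, rfl⟩
        exact ⟨ψ φ, (map_pow ψ φ p).symm⟩
      · rintro ⟨b, rfl⟩
        exact ⟨ψ.symm b ^ p, ⟨_, rfl⟩, (map_pow ψ _ p).trans (by simp)⟩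
    have h3 := LinearEquiv.finrank_map_eq (ψ : CartierDual k A ≃ₐ[k] A).toLinearEquiv
      (frobSub k (CartierDual k A) p).toSubmodule
    rw [h2] at h3
    exact h3
  rw [X.finrank_eq (p := p), h1, hG.finrank_frobSub_dual, X.finrank, two_mul, pow_add]

end Dimension

/-! ### Primitive elements generate `p`-th powers -/

section Generation

variable {k : Type u} [Field k] {A : Type v} [CommRing A] [HopfAlgebra k A]
  [Coalgebra.IsCocomm k A] [Module.Finite k A]

variable (k A) in
/-- The subalgebra generated by the primitive elements. -/
def primAlg (B : Type v) [CommRing B] [Bialgebra k B] : Subalgebra k B :=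
  Algebra.adjoin k {b | IsPrim k b}

/-- Factors are added on the right one primitive element at a time because `φ * v` is `φ` composed
with the invariant derivation of `v`. -/
lemma primAlg_induction {B : Type v} [CommRing B] [Bialgebra k B]
    {P : ∀ b : B, b ∈ primAlg k B → Prop} (one : P 1 (one_mem _))
    (mul : ∀ v x (hv : IsPrim k v) hx, P x hx → P (x * v) (mul_mem hx (Algebra.subset_adjoin hv)))
    (add : ∀ x y hx hy, P x hx → P y hy → P (x + y) (add_mem hx hy))
    (smul : ∀ (c : k) x hx, P x hx → P (c • x) (Subalgebra.smul_mem _ hx c))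
    {b : B} (hb : b ∈ primAlg k B) : P b hb := by
  have h : b ∈ Submodule.span k (Submonoid.closure {b : B | IsPrim k b} : Set B) := by
    rw [← Algebra.adjoin_eq_span]
    exact hb
  have key : ∃ hb, P b hb := by
    clear hb
    induction h using Submodule.span_induction with
    | mem x hx =>
      induction hx using Submonoid.closure_induction_right with
      | one => exact ⟨_, one⟩
      | mul_right x hx y hy ih => exact ⟨_, mul y x hy _ ih.2⟩
    | zero => exact ⟨_, by simpa using smul 0 1 _ one⟩
    | add x y hx hy ihx ihy => exact ⟨_, add x y _ _ ihx.2 ihy.2⟩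
    | smul c x hx ih => exact ⟨_, smul c x _ ih.2⟩
  exact key.2

/-- A function killed by the functionals generated by primitive elements lies in the ideal of the
kernel of Frobenius. -/
lemma mem_kerFrobIdeal_of_primAlg (p : ℕ) [Fact p.Prime] [CharP k p] [IsAlgClosed k] {a : A}
    (ha : ∀ φ ∈ primAlg k (CartierDual k A), φ a = 0) : a ∈ kerFrobIdeal k p A := by
  obtain ⟨X⟩ := exists_coords k A p
  have hone : (1 : CartierDual k A) ∈ primAlg k (CartierDual k A) := one_mem _
  have hmul : ∀ φ ∈ primAlg k (CartierDual k A), ∀ v, IsPrim k v →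
      φ * v ∈ primAlg k (CartierDual k A) := fun φ hφ v hv =>
    mul_mem hφ (Algebra.subset_adjoin hv)
  have hideal : ∀ φ ∈ primAlg k (CartierDual k A), ∀ a b : A,
      (∀ φ ∈ primAlg k (CartierDual k A), φ a = 0) → φ (b * a) = 0 := by
    intro φ hφ
    induction hφ using primAlg_induction with
    | one =>
      intro a b h
      rw [dual_one_apply, Bialgebra.counit_mul, ← dual_one_apply (k := k) a, h 1 hone, mul_zero]
    | mul v x hv _ ih =>
      intro a b h
      rw [← apply_primDer hv, Derivation.leibniz, map_add, smul_eq_mul, smul_eq_mul, mul_comm a,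
        ih a _ h, ih _ b fun φ hφ => ?_, add_zero]
      rw [apply_primDer]
      exact h _ (hmul φ hφ v hv)
    | add x y _ _ hx hy =>
      intro a b h
      rw [dual_add_apply, hx a b h, hy a b h, add_zero]
    | smul c x _ hx =>
      intro a b h
      rw [dual_smul_apply, hx a b h, mul_zero]
  -- The annihilator of `primAlg` is an ideal by the Leibniz rule. It is stable under invariant
  -- derivations, contains `kerFrobIdeal` and vanishes at the origin; a reduced polynomial with
  -- constant coefficients that lies in it is therefore 0.
  let J : Ideal A :=
    { carrier := {a | ∀ φ ∈ primAlg k (CartierDual k A), φ a = 0}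
      add_mem' := fun {a b} h h' φ hφ => by rw [map_add, h φ hφ, h' φ hφ, add_zero]
      zero_mem' := fun φ _ => map_zero φ
      smul_mem' := fun b a h φ hφ => hideal φ hφ a b h }
  have hJ : ∀ v (hv : IsPrim k v), ∀ a ∈ J, primDer v hv a ∈ J := by
    intro v hv a h φ hφ
    rw [apply_primDer]
    exact h _ (hmul φ hφ v hv)
  have hker : kerFrobIdeal k p A ≤ J := by
    refine Ideal.span_le.2 ?_
    rintro _ ⟨x, hx, rfl⟩ φ hφ
    change φ (x ^ p) = 0
    rw [← mul_one (x ^ p)]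
    generalize (1 : A) = y
    induction hφ using primAlg_induction generalizing y with
    | one =>
      have h0 : counit (R := k) x = 0 := hx
      rw [dual_one_apply, Bialgebra.counit_mul, Bialgebra.counit_pow, h0,
        zero_pow (Fact.out : p.Prime).ne_zero, zero_mul]
    | mul v φ hv _ ih => rw [← apply_primDer hv, primDer_pow_mul, ih]
    | add φ χ _ _ hx hy => rw [dual_add_apply, hx, hy, add_zero]
    | smul c φ _ hx => rw [dual_smul_apply, hx, mul_zero]
  obtain ⟨c, hc⟩ := X.exists_sub_mem_kerFrobIdeal (p := p) a
  have h1 : reducedEval k X.t c ∈ J := by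
    rw [← sub_sub_cancel a (reducedEval k X.t c)]
    exact J.sub_mem ha (hker hc)
  rw [X.eq_zero_of_reducedEval_mem J hJ (fun a h => h 1 hone) c h1, map_zero, sub_zero] at hc
  exact hc

/-- In the dual of a `BT₁`, the `p`-th powers are polynomials in primitive elements. -/
theorem IsBT1.pow_mem_primAlg {p : ℕ} [Fact p.Prime] [CharP k p] [IsAlgClosed k]
    (hG : IsBT1 k p A) (χ : CartierDual k A) : χ ^ p ∈ primAlg k (CartierDual k A) := by
  by_contra hnot
  -- A functional separating `χ ^ p` from `primAlg` is an element of `A` killed by `primAlg`. It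
  -- lies in `kerFrobIdeal`, and so is killed by all `p`-th powers of the dual, including `χ ^ p`.
  obtain ⟨f, hf1, hf2⟩ := Submodule.exists_le_ker_of_notMem
    (p := (primAlg k (CartierDual k A)).toSubmodule) (v := χ ^ p) (fun h => hnot h)
  apply hf1
  rw [← apply_bidualElem f]
  exact (hG.mem_kerFrobIdeal_iff _).1 (mem_kerFrobIdeal_of_primAlg p fun φ hφ => by
    rw [apply_bidualElem]
    exact hf2 hφ) χ

lemma primAlg_map {B : Type v} [CommRing B] [Bialgebra k B] {C : Type w} [CommRing C]
    [Bialgebra k C] (f : B →ₐc[k] C) {b : B} (hb : b ∈ primAlg k B) : f b ∈ primAlg k C := by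
  induction hb using primAlg_induction with
  | one => rw [map_one]; exact one_mem _
  | mul v x hv _ ih => rw [map_mul]; exact mul_mem ih (Algebra.subset_adjoin (hv.map f))
  | add x y _ _ hx hy => rw [map_add]; exact add_mem hx hy
  | smul c x _ hx => rw [map_smul]; exact Subalgebra.smul_mem _ hx c

/-- In a self-dual `BT₁`, the `p`-th powers are polynomials in primitive elements. -/
theorem IsBT1.pow_mem_primAlg' {p : ℕ} [Fact p.Prime] [CharP k p] [IsAlgClosed k]
    (hG : IsBT1 k p A) (ψ : CartierDual k A ≃ₐc[k] A) (x : A) : x ^ p ∈ primAlg k A := by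
  have h := primAlg_map (ψ : CartierDual k A →ₐc[k] A) (hG.pow_mem_primAlg (ψ.symm x))
  rw [map_pow] at h
  convert h
  exact (ψ.apply_symm_apply x).symm

/-- A primitive element of the dual with `p`-th power zero kills the ideal of the kernel of
Verschiebung. -/
lemma prim_apply_kerVer {p : ℕ} [Fact p.Prime] [CharP k p] [IsAlgClosed k]
    {c : CartierDual k A} (hc : IsPrim k c) (hcp : c ^ p = 0) {a : A}
    (ha : a ∈ kerVerIdeal k p A) : c a = 0 := by
  have hp := (Fact.out : p.Prime).ne_zero
  have h : c a = 0 ∧ counit (R := k) a = 0 := by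
    induction ha using Submodule.span_induction with
    | mem x hx =>
      obtain ⟨y, hy, rfl⟩ := hx
      have h0 : counit (R := k) y = 0 := hy
      constructor
      · rw [← pow_eq_zero_iff hp, verschiebung_spec, hcp, dual_zero_apply]
      · rw [← dual_one_apply, ← pow_eq_zero_iff hp, verschiebung_spec, one_pow, dual_one_apply, h0]
    | zero => simp
    | add x y _ _ hx hy => simp [hx.1, hx.2, hy.1, hy.2]
    | smul b x _ hx =>
      rw [smul_eq_mul, isPrim_dual_iff.1 hc, Bialgebra.counit_mul, hx.1, hx.2]
      simp
  exact h.1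

lemma IsBT1.prim_apply_eq_zero {p : ℕ} [Fact p.Prime] [CharP k p] [IsAlgClosed k]
    (hG : IsBT1 k p A) {c : CartierDual k A} (hc : IsPrim k c) (hcp : c ^ p = 0) {a : A}
    (ha : a ^ p = 0) : c a = 0 :=
  prim_apply_kerVer hc hcp ((hG.kerVer_eq_imFrob a).2 ha)

end Generation

/-! ### Truncated polynomial algebras -/

section Trunc

namespace TruncPoly

variable {k : Type u} [Field k] {n : ℕ}

variable (k n) in
/-- The projection from polynomials. -/
def mk : k[X] →ₐ[k] TruncPoly k n := AdjoinRoot.mkₐ (Polynomial.X ^ n : k[X])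

lemma mk_X : mk k n Polynomial.X = gen k n := rfl

lemma mk_surjective : Function.Surjective (mk k n) := AdjoinRoot.mk_surjective

lemma mk_eq_zero {f : k[X]} : mk k n f = 0 ↔ ∀ i < n, f.coeff i = 0 :=
  AdjoinRoot.mk_eq_zero.trans Polynomial.X_pow_dvd_iff

/-- The coefficient of `x ^ i`. -/
def coef (i : ℕ) : TruncPoly k n →ₗ[k] k :=
  Polynomial.lcoeff k i ∘ₗ AdjoinRoot.modByMonicHom (Polynomial.monic_X_pow n)

lemma coef_mk {i : ℕ} (hi : i < n) (f : k[X]) : coef i (mk k n f) = f.coeff i := by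
  have h1 : coef i (mk k n f) = (f %ₘ Polynomial.X ^ n).coeff i :=
    congrArg (fun g => Polynomial.coeff g i)
      (AdjoinRoot.modByMonicHom_mk (Polynomial.monic_X_pow n) f)
  conv_rhs => rw [← Polynomial.modByMonic_add_div f (Polynomial.X ^ n)]
  rw [h1, Polynomial.coeff_add, Polynomial.coeff_X_pow_mul', if_neg (by omega), add_zero]

lemma ext {x y : TruncPoly k n} (h : ∀ i < n, coef i x = coef i y) : x = y := by
  obtain ⟨f, rfl⟩ := mk_surjective x
  obtain ⟨g, rfl⟩ := mk_surjective y
  rw [← sub_eq_zero, ← map_sub, mk_eq_zero]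
  intro i hi
  rw [Polynomial.coeff_sub, ← coef_mk hi, ← coef_mk hi, h i hi, sub_self]

lemma coef_mul {i : ℕ} (hi : i < n) (x y : TruncPoly k n) :
    coef i (x * y) = ∑ m ∈ Finset.HasAntidiagonal.antidiagonal i, coef m.1 x * coef m.2 y := by
  obtain ⟨f, rfl⟩ := mk_surjective x
  obtain ⟨g, rfl⟩ := mk_surjective y
  rw [← map_mul, coef_mk hi, Polynomial.coeff_mul]
  refine Finset.sum_congr rfl fun m hm => ?_
  rw [Finset.HasAntidiagonal.mem_antidiagonal] at hm
  rw [coef_mk (by omega), coef_mk (by omega)]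

lemma coef_gen_pow {i : ℕ} (hi : i < n) (j : ℕ) :
    coef i (gen k n ^ j) = if i = j then 1 else 0 := by
  rw [← mk_X, ← map_pow, coef_mk hi, Polynomial.coeff_X_pow]

lemma coef_one {i : ℕ} (hi : i < n) : coef i (1 : TruncPoly k n) = if i = 0 then 1 else 0 := by
  simpa using coef_gen_pow (k := k) hi 0

lemma coef_zero_mul (hn : 0 < n) (x y : TruncPoly k n) :
    coef 0 (x * y) = coef 0 x * coef 0 y := by
  rw [coef_mul hn]
  simp

lemma finrank_eq : Module.finrank k (TruncPoly k n) = n := by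
  have h := (AdjoinRoot.powerBasis' (Polynomial.monic_X_pow (R := k) n)).finrank
  rw [AdjoinRoot.powerBasis'_dim, Polynomial.natDegree_X_pow] at h
  exact h

instance : Module.Finite k (TruncPoly k n) :=
  (AdjoinRoot.powerBasis' (Polynomial.monic_X_pow (R := k) n)).finite

end TruncPoly

end Trunc

/-! ### The group scheme `α_p` and its self-duality. -/

section Alpha

variable {k : Type u} [Field k] {p : ℕ} [Fact p.Prime] [CharP k p]

namespace AlphaP

instance : Module.Finite k (AlphaP k p) := inferInstanceAs (Module.Finite k (TruncPoly k p))

lemma convInverse_of_gen (L : AlphaP k p ⊗[k] AlphaP k p →ₐ[k] AlphaP k p)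
    (h : L (gen k p ⊗ₜ 1) + L (1 ⊗ₜ gen k p) = 0) :
    L.comp (Bialgebra.comulAlgHom k (AlphaP k p)) =
      (Algebra.ofId k (AlphaP k p)).comp (Bialgebra.counitAlgHom k (AlphaP k p)) := by
  apply hom_ext
  rw [AlgHom.comp_apply, Bialgebra.comulAlgHom_apply, comul_gen, map_add, h]
  simp

lemma neg_gen_pow : (-gen k p) ^ p = 0 := by rw [neg_pow, gen_pow, mul_zero]

instance : HopfAlgebra k (AlphaP k p) :=
  HopfAlgebra.ofAlgHom (lift (-gen k p) neg_gen_pow)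
    (convInverse_of_gen _ (by
      erw [Algebra.TensorProduct.lift_tmul, Algebra.TensorProduct.lift_tmul]
      simp))
    (convInverse_of_gen _ (by
      erw [Algebra.TensorProduct.lift_tmul, Algebra.TensorProduct.lift_tmul]
      simp))

instance : Coalgebra.IsCocomm k (AlphaP k p) where
  comm_comp_comul := by
    have h : (Algebra.TensorProduct.comm k (AlphaP k p) (AlphaP k p)).toAlgHom.comp
        (Bialgebra.comulAlgHom k (AlphaP k p)) = Bialgebra.comulAlgHom k (AlphaP k p) := by
      apply hom_ext
      simp only [AlgHom.comp_apply, Bialgebra.comulAlgHom_apply, comul_gen, map_add,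
        AlgEquiv.toAlgHom_apply, Algebra.TensorProduct.comm_tmul]
      rw [add_comm (_ ⊗ₜ[k] _)]
    exact congr(($h).toLinearMap)

lemma isPrim_gen : IsPrim k (gen k p) := comul_gen

/-- The homomorphism to a bialgebra given by a primitive element with `p`-th power zero. -/
def liftPrim {B : Type v} [CommRing B] [Bialgebra k B] (b : B) (hb : IsPrim k b) (hbp : b ^ p = 0) :
    AlphaP k p →ₐc[k] B :=
  BialgHom.ofAlgHom (lift b hbp) (hom_ext (by simp [hb.counit]))
    (hom_ext (by
      rw [AlgHom.comp_apply, Bialgebra.comulAlgHom_apply, comul_gen, AlgHom.comp_apply, lift_gen,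
        Bialgebra.comulAlgHom_apply, hb]
      simp))

@[simp] lemma liftPrim_gen {B : Type v} [CommRing B] [Bialgebra k B] (b : B) (hb : IsPrim k b)
    (hbp : b ^ p = 0) : liftPrim b hb hbp (gen k p) = b := lift_gen b hbp

lemma counit_eq_coef (y : AlphaP k p) :
    counit (R := k) y = TruncPoly.coef (k := k) (n := p) 0 y := by
  have hp := (Fact.out : p.Prime).pos
  let f : AlphaP k p →ₐ[k] k := AlgHom.ofLinearMap (TruncPoly.coef (k := k) (n := p) 0)
    (by
      have h := TruncPoly.coef_one (k := k) hp
      rwa [if_pos rfl] at h) (TruncPoly.coef_zero_mul hp)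
  have h : Bialgebra.counitAlgHom k (AlphaP k p) = f := hom_ext (by
    have h1 := TruncPoly.coef_gen_pow (k := k) hp 1
    rw [pow_one, if_neg zero_ne_one] at h1
    exact counit_gen.trans h1.symm)
  exact DFunLike.congr_fun h y

variable (k p) in
/-- The functional `x ^ i ↦ δ_{i1}`. -/
def dualGen : CartierDual k (AlphaP k p) :=
  (CartierDual.equivDual k (AlphaP k p)).symm (TruncPoly.coef (k := k) (n := p) 1)

lemma dualGen_apply (y : AlphaP k p) :
    dualGen k p y = TruncPoly.coef (k := k) (n := p) 1 y := rfl

lemma isPrim_dualGen : IsPrim k (dualGen k p) := by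
  rw [isPrim_dual_iff]
  intro a b
  rw [dualGen_apply, counit_eq_coef, counit_eq_coef]
  refine (TruncPoly.coef_mul (Fact.out : p.Prime).one_lt a b).trans ?_
  rw [Finset.Nat.antidiagonal_succ]
  simp [dualGen_apply, add_comm]

lemma dualGen_gen : dualGen k p (gen k p) = 1 := by
  have h := TruncPoly.coef_gen_pow (k := k) (Fact.out : p.Prime).one_lt 1
  rwa [pow_one, if_pos rfl] at h

end AlphaP

lemma IsPrim.apply_pow_succ {A : Type v} [CommRing A] [HopfAlgebra k A] [Coalgebra.IsCocomm k A]
    [Module.Finite k A] {v : CartierDual k A} (hv : IsPrim k v) {x : A}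
    (hx : Coalgebra.counit (R := k) x = 0) (n : ℕ) : v (x ^ (n + 2)) = 0 := by
  rw [pow_succ, isPrim_dual_iff.1 hv, Bialgebra.counit_pow, hx]
  simp

lemma IsPrim.apply_one {A : Type v} [CommRing A] [HopfAlgebra k A] [Coalgebra.IsCocomm k A]
    [Module.Finite k A] {v : CartierDual k A} (hv : IsPrim k v) : v 1 = 0 := by
  simpa using prim_mul_apply_one hv 1

namespace AlphaP

lemma linearMap_ext {M : Type*} [AddCommGroup M] [Module k M] {f g : AlphaP k p →ₗ[k] M}
    (h : ∀ i, f (gen k p ^ i) = g (gen k p ^ i)) : f = g := by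
  ext y
  obtain ⟨q, rfl⟩ := TruncPoly.mk_surjective y
  have h1 : ∀ q : k[X], f (TruncPoly.mk k p q) = g (TruncPoly.mk k p q) := by
    intro q
    induction q using Polynomial.induction_on' with
    | add a b ha hb => 
      have h2 : TruncPoly.mk k p (a + b) = TruncPoly.mk k p a + TruncPoly.mk k p b := map_add _ _ _
      exact (congrArg f h2).trans (((map_add f _ _).trans (congrArg₂ (· + ·) ha hb)).trans
        ((congrArg g h2).trans (map_add g _ _)).symm)
    | monomial i c =>
      have h2 : TruncPoly.mk k p (Polynomial.monomial i c) = c • gen k p ^ i := by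
        rw [← Polynomial.C_mul_X_pow_eq_monomial, ← Polynomial.smul_eq_C_mul, map_smul, map_pow]
        rfl
      exact (congrArg f h2).trans ((map_smul f c _).trans ((congrArg (c • ·) (h i)).trans
        ((congrArg g h2).trans (map_smul g c _)).symm))
  exact h1 q

/-- A primitive functional is determined by its value at the generator. -/
lemma prim_ext {v w : CartierDual k (AlphaP k p)} (hv : IsPrim k v) (hw : IsPrim k w)
    (h : v (gen k p) = w (gen k p)) : v = w := by
  refine (CartierDual.equivDual k (AlphaP k p)).injective (linearMap_ext fun i => ?_)
  rw [equivDual_apply, equivDual_apply]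
  match i with
  | 0 => rw [pow_zero, hv.apply_one, hw.apply_one]
  | 1 => rw [pow_one, h]
  | i + 2 => rw [hv.apply_pow_succ counit_gen, hw.apply_pow_succ counit_gen]

/-- Multiplication by `dualGen` is the transpose of `d/dx`. -/
lemma dualGen_pow_apply (i j : ℕ) :
    (dualGen k p ^ i) (gen k p ^ j) = if i = j then (i.factorial : k) else 0 := by
  induction i generalizing j with
  | zero => cases j <;> simp
  | succ i ih =>
    rw [pow_succ, ← apply_primDer isPrim_dualGen, Derivation.leibniz_pow]
    have h1 : primDer (dualGen k p) isPrim_dualGen (gen k p) = 1 := by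
      refine (congrArg (contractRight _) comul_gen).trans ?_
      rw [map_add, contractRight_tmul, contractRight_tmul, dualGen_gen, isPrim_dualGen.apply_one]
      simp
    rw [h1]
    cases j with
    | zero => simp
    | succ j =>
      rw [map_nsmul, Nat.add_sub_cancel, smul_eq_mul, mul_one, ih, Nat.factorial_succ]
      simp only [Nat.add_right_cancel_iff]
      split_ifs with h
      · subst h
        simp
      · simp

lemma dualGen_pow : dualGen k p ^ p = 0 := by
  refine (CartierDual.equivDual k (AlphaP k p)).injective (linearMap_ext fun j => ?_)
  rw [equivDual_apply, dualGen_pow_apply, map_zero, LinearMap.zero_apply]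
  split_ifs
  · rw [CharP.cast_eq_zero_iff k p]
    exact Nat.dvd_factorial (Fact.out : p.Prime).pos le_rfl
  · rfl

/-- Self-duality of `α_p`: for `i < p` the power `dualGen ^ i` is `i!` times the functional dual to
`x ^ i`, and `i!` is nonzero in `k`. -/
lemma liftPrim_dualGen_bijective :
    Function.Bijective (liftPrim (dualGen k p) isPrim_dualGen dualGen_pow) := by
  have hinj : Function.Injective (liftPrim (dualGen k p) isPrim_dualGen dualGen_pow) := by
    rw [injective_iff_map_eq_zero]
    intro y hy
    have h1 : ∀ j < p, ∀ y : AlphaP k p, (liftPrim (dualGen k p) isPrim_dualGen dualGen_pow y)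
        (gen k p ^ j) = TruncPoly.coef (k := k) (n := p) j y * j.factorial := by
      intro j hj y
      let f₁ : AlphaP k p →ₗ[k] k := (Module.Dual.eval k _ (gen k p ^ j) ∘ₗ
        (CartierDual.equivDual k (AlphaP k p)).toLinearMap) ∘ₗ
        (liftPrim (dualGen k p) isPrim_dualGen dualGen_pow : AlphaP k p →ₗ[k] _)
      let f₂ : AlphaP k p →ₗ[k] k := (j.factorial : k) • TruncPoly.coef (k := k) (n := p) j
      have h2 : f₁ = f₂ := linearMap_ext fun i => by
        change (liftPrim (dualGen k p) isPrim_dualGen dualGen_pow (gen k p ^ i)) (gen k p ^ j) =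
          (j.factorial : k) * TruncPoly.coef (k := k) (n := p) j (TruncPoly.gen k p ^ i)
        rw [map_pow (liftPrim (dualGen k p) isPrim_dualGen dualGen_pow), liftPrim_gen,
          dualGen_pow_apply, TruncPoly.coef_gen_pow hj]
        simp only [eq_comm (a := j)]
        split_ifs with h
        · rw [h, mul_one]
        · rw [mul_zero]
      rw [mul_comm]
      exact DFunLike.congr_fun h2 y
    refine TruncPoly.ext fun j hj => ?_
    have h2 := h1 j hj y
    rw [hy, dual_zero_apply, eq_comm, mul_eq_zero, CharP.cast_eq_zero_iff k p,
      (Fact.out : p.Prime).dvd_factorial] at h2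
    exact (h2.resolve_right (by omega)).trans (map_zero (TruncPoly.coef (k := k) (n := p) j)).symm
  have h2 := LinearMap.injective_iff_surjective_of_finrank_eq_finrank
    (f := (liftPrim (dualGen k p) isPrim_dualGen dualGen_pow : AlphaP k p →ₗ[k] _))
    finrank_dual.symm
  exact ⟨hinj, h2.1 hinj⟩

end AlphaP
end Alpha

/-! ### Homomorphisms to `μ_p` and `α_p` -/

section PrimeField

variable {k : Type u} [Field k] (p : ℕ) [Fact p.Prime] [CharP k p]

variable (k) in
/-- The inclusion of the prime field. -/
def zmodHom : ZMod p →+* k := ZMod.castHom dvd_rfl k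

lemma zmodHom_pow (n : ZMod p) : zmodHom k p n ^ p = zmodHom k p n := by
  rw [← map_pow, ZMod.pow_card]

lemma exists_zmodHom_eq {d : k} (h : d ^ p = d) : ∃ n : ZMod p, zmodHom k p n = d := by
  have h1 := (Subfield.mem_bot_iff_pow_eq_self k p).2 h
  exact (bot_le : (⊥ : Subfield k) ≤ (zmodHom k p).fieldRange) h1

/-- Frobenius-fixed elements that are independent over the prime field are independent. -/
lemma linearIndependent_of_fixed {B : Type v} [CommRing B] [Algebra k B] {ι : Type*} {u : ι → B}
    (hu : ∀ i, u i ^ p = u i)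
    (h : ∀ (s : Finset ι) (n : ι → ZMod p), ∑ i ∈ s, zmodHom k p (n i) • u i = 0 →
      ∀ i ∈ s, n i = 0) : LinearIndependent k u := by
  classical
  rw [linearIndependent_iff']
  intro s
  induction s using Finset.induction_on with
  | empty => simp
  | insert i₀ s hi₀ ih =>
    intro c hc
    by_cases h0 : c i₀ = 0
    · rw [Finset.sum_insert hi₀, h0, zero_smul, zero_add] at hc
      intro i hi
      obtain rfl | hi := Finset.mem_insert.1 hi
      · exact h0
      · exact ih c hc i hi
    exfalso
    have h1 : ∑ i ∈ insert i₀ s, (c i / c i₀) • u i = 0 := by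
      have h2 := congrArg ((c i₀)⁻¹ • ·) hc
      simp only [Finset.smul_sum, smul_zero, smul_smul] at h2
      simpa only [div_eq_inv_mul] using h2
    have h2 : ∑ i ∈ insert i₀ s, (c i / c i₀) ^ p • u i = 0 := by
      have hp : ∀ t : Finset ι, (∑ i ∈ t, (c i / c i₀) • u i) ^ p =
          ∑ i ∈ t, (c i / c i₀) ^ p • u i := by
        intro t
        induction t using Finset.induction_on with
        | empty => simp [(Fact.out : p.Prime).ne_zero]
        | insert j t hj ih => rw [Finset.sum_insert hj, Finset.sum_insert hj, add_pow_p k p, ih,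
            smul_pow, hu]
      rw [← hp, h1, zero_pow (Fact.out : p.Prime).ne_zero]
    -- The relation is normalised to have coefficient 1 at `i₀` and subtracted from its `p`-th
    -- power. The term at `i₀` cancels, so by induction all coefficients are fixed by Frobenius and
    -- lie in the prime field.
    have h3 : ∀ i ∈ insert i₀ s, (c i / c i₀) ^ p = c i / c i₀ := by
      intro i hi
      obtain rfl | hi := Finset.mem_insert.1 hi
      · rw [div_self h0, one_pow]
      rw [← sub_eq_zero]
      refine ih (fun i => (c i / c i₀) ^ p - c i / c i₀) ?_ i hi
      have h4 : ∑ i ∈ insert i₀ s, ((c i / c i₀) ^ p - c i / c i₀) • u i = 0 := by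
        simp only [sub_smul, Finset.sum_sub_distrib]
        rw [h1, h2, sub_zero]
      rw [Finset.sum_insert hi₀, div_self h0, one_pow, sub_self, zero_smul, zero_add] at h4
      exact h4
    have h4 : ∀ i, ∃ n : ZMod p, i ∈ insert i₀ s → zmodHom k p n = c i / c i₀ := by
      intro i
      by_cases hi : i ∈ insert i₀ s
      · obtain ⟨n, hn⟩ := exists_zmodHom_eq p (h3 i hi)
        exact ⟨n, fun _ => hn⟩
      · exact ⟨0, fun h => absurd h hi⟩
    choose n hn using h4
    have h5 := h (insert i₀ s) n (by
      rw [← h1]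
      exact Finset.sum_congr rfl fun i hi => by rw [hn i hi]) i₀ (Finset.mem_insert_self _ _)
    have h6 := hn i₀ (Finset.mem_insert_self _ _)
    rw [h5, map_zero, div_self h0] at h6
    exact zero_ne_one h6

end PrimeField

/-! ### Functions on the constant group scheme `ℤ/p`. -/

section Const

variable {k : Type u} [Field k] {p : ℕ} [Fact p.Prime] [CharP k p]

namespace ConstZp

lemma ext_single {φ χ : ConstZp k p}
    (h : ∀ g, φ (MonoidAlgebra.single g 1) = χ (MonoidAlgebra.single g 1)) : φ = χ := by
  ext x
  induction x using MonoidAlgebra.induction_linear with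
  | zero => rw [map_zero, map_zero]
  | add x y hx hy => rw [map_add, map_add, hx, hy]
  | single m r =>
    have h1 : (MonoidAlgebra.single m r : MuP k p) = r • MonoidAlgebra.single m 1 := by
      rw [MonoidAlgebra.smul_single, smul_eq_mul, mul_one]
    rw [h1, map_smul, map_smul, h]

lemma mul_single (φ χ : ConstZp k p) (g : Multiplicative (ZMod p)) :
    (φ * χ) (MonoidAlgebra.single g 1) =
      φ (MonoidAlgebra.single g 1) * χ (MonoidAlgebra.single g 1) :=
  (isGroupLike_iff.1 (MonoidAlgebra.isGroupLikeElem_single_one g)).2 φ χ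

lemma one_single (g : Multiplicative (ZMod p)) :
    (1 : ConstZp k p) (MonoidAlgebra.single g 1) = 1 := by
  rw [dual_one_apply]
  exact (MonoidAlgebra.isGroupLikeElem_single_one g).counit_eq_one

variable (k p) in
/-- The tautological function on `ℤ/p`. -/
def delta : ConstZp k p :=
  (CartierDual.equivDual k (MuP k p)).symm
    ((Finsupp.linearCombination k fun g => zmodHom k p (Multiplicative.toAdd g)) ∘ₗ
      (MonoidAlgebra.coeffLinearEquiv k).toLinearMap)

lemma delta_single (g : Multiplicative (ZMod p)) :
    delta k p (MonoidAlgebra.single g 1) = zmodHom k p (Multiplicative.toAdd g) := by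
  have h : delta k p (MonoidAlgebra.single g 1) = Finsupp.linearCombination k
    (fun g => zmodHom k p (Multiplicative.toAdd g)) (MonoidAlgebra.single g (1 : k)).coeff := rfl
  rw [h, MonoidAlgebra.coeff_single, Finsupp.linearCombination_single, one_smul]

lemma delta_pow_single (n : ℕ) (g : Multiplicative (ZMod p)) :
    (delta k p ^ n) (MonoidAlgebra.single g 1) = zmodHom k p (Multiplicative.toAdd g) ^ n := by
  induction n with
  | zero => rw [pow_zero, pow_zero, one_single]
  | succ n ih => rw [pow_succ, mul_single, ih, delta_single, pow_succ]

lemma delta_pow : delta k p ^ p = delta k p :=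
  ext_single fun g => by rw [delta_pow_single, delta_single, zmodHom_pow]

lemma isPrim_delta : IsPrim k (delta k p) := by
  have hs : ∀ (m : Multiplicative (ZMod p)) (r : k), (MonoidAlgebra.single m r : MuP k p) =
      r • MonoidAlgebra.single m 1 := fun m r => by
    rw [MonoidAlgebra.smul_single, smul_eq_mul, mul_one]
  rw [isPrim_dual_iff]
  intro a b
  induction a using MonoidAlgebra.induction_linear with
  | zero => simp
  | add x y hx hy => rw [add_mul, map_add, hx, hy, map_add, map_add]; ring
  | single m r =>
    induction b using MonoidAlgebra.induction_linear with
    | zero => simp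
    | add x y hx hy => rw [mul_add, map_add, hx, hy, map_add, map_add]; ring
    | single n s =>
      rw [hs m, hs n, smul_mul_smul_comm, MonoidAlgebra.single_mul_single, mul_one]
      simp only [map_smul, delta_single, smul_eq_mul,
        (MonoidAlgebra.isGroupLikeElem_single_one (R := k) (A := k) _).counit_eq_one]
      rw [toAdd_mul, map_add]
      ring

lemma finrank_eq : Module.finrank k (ConstZp k p) = p := by
  rw [finrank_dual, (MonoidAlgebra.coeffLinearEquiv (R := k) (S := k)
    (M := Multiplicative (ZMod p))).finrank_eq]
  simp

variable (k p) in
/-- The polynomial `X ^ p - X`. -/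
abbrev asPoly : k[X] := Polynomial.X ^ p - Polynomial.X

variable (k p) in
/-- `k[X]/(X ^ p - X) → O(ℤ/p)`. -/
def ofAdjoin : AdjoinRoot (asPoly k p) →ₐ[k] ConstZp k p :=
  AdjoinRoot.liftAlgHom _ (Algebra.ofId k _) (delta k p) (by simp [delta_pow])

lemma ofAdjoin_root : ofAdjoin k p (AdjoinRoot.root _) = delta k p :=
  AdjoinRoot.liftAlgHom_root ..

lemma ofAdjoin_mk (f : k[X]) :
    ofAdjoin k p (AdjoinRoot.mk _ f) = Polynomial.aeval (delta k p) f := by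
  have h : (ofAdjoin k p).comp (AdjoinRoot.mkₐ (asPoly k p)) = Polynomial.aeval (delta k p) :=
    Polynomial.algHom_ext (by
      rw [AlgHom.comp_apply, Polynomial.aeval_X]
      exact ofAdjoin_root)
  exact DFunLike.congr_fun h f

lemma aeval_delta_single (f : k[X]) (g : Multiplicative (ZMod p)) :
    (Polynomial.aeval (delta k p) f) (MonoidAlgebra.single g 1) =
      f.eval (zmodHom k p (Multiplicative.toAdd g)) := by
  induction f using Polynomial.induction_on' with
  | add a b ha hb => rw [map_add, dual_add_apply, ha, hb, Polynomial.eval_add]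
  | monomial i c =>
    rw [Polynomial.aeval_monomial, ← Algebra.smul_def, dual_smul_apply, delta_pow_single,
      Polynomial.eval_monomial]

lemma natDegree_asPoly : (asPoly k p).natDegree = p :=
  FiniteField.X_pow_card_sub_X_natDegree_eq k (Fact.out : p.Prime).one_lt

lemma monic_asPoly : (asPoly k p).Monic :=
  Polynomial.monic_X_pow_sub (by
    rw [Polynomial.degree_X]
    exact_mod_cast (Fact.out : p.Prime).one_lt)

/-- A polynomial of degree less than `p` that vanishes on the `p` elements of the prime field is 0;
both sides have dimension `p`. -/
lemma ofAdjoin_bijective : Function.Bijective (ofAdjoin k p) := by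
  have hinj : Function.Injective (ofAdjoin k p) := by
    rw [injective_iff_map_eq_zero]
    intro y hy
    obtain ⟨f, rfl⟩ := AdjoinRoot.mk_surjective y
    have h1 : AdjoinRoot.mk (asPoly k p) f = AdjoinRoot.mk (asPoly k p) (f %ₘ asPoly k p) := by
      rw [AdjoinRoot.mk_eq_mk]
      exact ⟨f /ₘ asPoly k p, by
        rw [sub_eq_iff_eq_add', Polynomial.modByMonic_add_div]⟩
    rw [h1] at hy ⊢
    have h2 : f %ₘ asPoly k p = 0 := by
      refine Polynomial.eq_zero_of_natDegree_lt_card_of_eval_eq_zero (ι := ZMod p) _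
        (f := zmodHom k p) (zmodHom k p).injective (fun n => ?_) ?_
      · rw [← toAdd_ofAdd n, ← aeval_delta_single, ← ofAdjoin_mk, hy, dual_zero_apply]
      · rw [ZMod.card]
        refine (Polynomial.natDegree_modByMonic_lt f monic_asPoly fun h => ?_).trans_eq
          natDegree_asPoly
        have h3 := natDegree_asPoly (k := k) (p := p)
        rw [h, Polynomial.natDegree_one] at h3
        exact (Fact.out : p.Prime).ne_zero h3.symm
    rw [h2, map_zero]
  have hdim : Module.finrank k (AdjoinRoot (asPoly k p)) = Module.finrank k (ConstZp k p) := by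
    rw [finrank_eq, (AdjoinRoot.powerBasis' monic_asPoly).finrank, AdjoinRoot.powerBasis'_dim,
      natDegree_asPoly]
  have : Module.Finite k (AdjoinRoot (asPoly k p)) := (AdjoinRoot.powerBasis' monic_asPoly).finite
  exact ⟨hinj, (LinearMap.injective_iff_surjective_of_finrank_eq_finrank
    (f := (ofAdjoin k p).toLinearMap) hdim).1 hinj⟩

lemma algHom_ext {B : Type*} [CommRing B] [Algebra k B] {f g : ConstZp k p →ₐ[k] B}
    (h : f (delta k p) = g (delta k p)) : f = g := by
  have h1 : f.comp (ofAdjoin k p) = g.comp (ofAdjoin k p) := AdjoinRoot.algHom_ext (by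
    rw [AlgHom.comp_apply, AlgHom.comp_apply, ofAdjoin_root, h])
  ext x
  obtain ⟨y, rfl⟩ := ofAdjoin_bijective.2 x
  exact DFunLike.congr_fun h1 y

/-- The homomorphism given by an element equal to its `p`-th power. -/
def lift {B : Type*} [CommRing B] [Algebra k B] (b : B) (hb : b ^ p = b) : ConstZp k p →ₐ[k] B :=
  (AdjoinRoot.liftAlgHom (asPoly k p) (Algebra.ofId k B) b (by simp [hb])).comp
    (AlgEquiv.ofBijective (ofAdjoin k p) ofAdjoin_bijective).symm.toAlgHom

@[simp] lemma lift_delta {B : Type*} [CommRing B] [Algebra k B] (b : B) (hb : b ^ p = b) :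
    lift b hb (delta k p) = b := by
  have h : (AlgEquiv.ofBijective (ofAdjoin k p) ofAdjoin_bijective).symm (delta k p) =
      AdjoinRoot.root _ := by
    rw [AlgEquiv.symm_apply_eq]
    exact ofAdjoin_root.symm
  rw [lift, AlgHom.comp_apply]
  refine Eq.trans (congrArg _ h) ?_
  exact AdjoinRoot.liftAlgHom_root ..

/-- The homomorphism to a bialgebra given by a primitive element equal to its `p`-th power. -/
def liftPrim {B : Type v} [CommRing B] [Bialgebra k B] (b : B) (hb : IsPrim k b) (hbp : b ^ p = b) :
    ConstZp k p →ₐc[k] B :=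
  BialgHom.ofAlgHom (lift b hbp) (algHom_ext (by
      rw [AlgHom.comp_apply, lift_delta]
      exact hb.counit.trans isPrim_delta.counit.symm))
    (algHom_ext (by
      rw [AlgHom.comp_apply, Bialgebra.comulAlgHom_apply, isPrim_delta, AlgHom.comp_apply,
        lift_delta, Bialgebra.comulAlgHom_apply, hb]
      simp))

@[simp] lemma liftPrim_delta {B : Type v} [CommRing B] [Bialgebra k B] (b : B) (hb : IsPrim k b)
    (hbp : b ^ p = b) : liftPrim b hb hbp (delta k p) = b := lift_delta b hbp

end ConstZp

end Const

/-! ### `Hom(μ_p, G)` and `Hom(α_p, G)` inside the tangent space. -/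

section Homs

variable {k : Type u} [Field k] {p : ℕ} [Fact p.Prime] [CharP k p] {A : Type v} [CommRing A]
  [HopfAlgebra k A] [Coalgebra.IsCocomm k A] [Module.Finite k A]

lemma eq_of_dualMap_eq {B : Type w} [CommRing B] [HopfAlgebra k B] [Coalgebra.IsCocomm k B]
    [Module.Finite k B] {f g : A →ₐc[k] B} (h : ∀ φ, dualMap f φ = dualMap g φ) : f = g :=
  DFunLike.ext _ _ fun a => dual_sep' k fun φ => by
    rw [← dualMap_apply, ← dualMap_apply, h]

/-- The primitive element attached to a homomorphism to `μ_p`. -/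
def muElem (f : HomMuP k p A) : CartierDual k A :=
  dualMap (Additive.toMul f).ofConv (ConstZp.delta k p)

lemma muElem_isPrim (f : HomMuP k p A) : IsPrim k (muElem f) :=
  ConstZp.isPrim_delta.map _

lemma muElem_pow (f : HomMuP k p A) : muElem f ^ p = muElem f := by
  rw [muElem, ← map_pow, ConstZp.delta_pow]

/-- A primitive functional is additive on homomorphisms. -/
lemma prim_apply_conv {B : Type w} [CommRing B] [HopfAlgebra k B] [Coalgebra.IsCocomm k B]
    [Module.Finite k B] {v : CartierDual k B} (hv : IsPrim k v)
    (f g : WithConv (A →ₐc[k] B)) (a : A) :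
    v ((f * g).ofConv a) = v (f.ofConv a) + v (g.ofConv a) := by
  have h1 : ∀ w : A ⊗[k] A, v (Algebra.TensorProduct.lmul' k
      (Algebra.TensorProduct.map (f.ofConv : A →ₐ[k] B) (g.ofConv : A →ₐ[k] B) w)) =
      v (f.ofConv (TensorProduct.rid k A (LinearMap.lTensor A (counit (R := k)) w))) +
        v (g.ofConv (TensorProduct.lid k A (LinearMap.rTensor A (counit (R := k)) w))) := by
    intro w
    induction w with
    | zero => simp
    | add x y hx hy => simp only [map_add, hx, hy]; ring
    | tmul b c =>
      have hf : counit (R := k) (f.ofConv b) = counit (R := k) b :=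
        CoalgHomClass.counit_comp_apply f.ofConv b
      have hg : counit (R := k) (g.ofConv c) = counit (R := k) c :=
        CoalgHomClass.counit_comp_apply g.ofConv c
      rw [Algebra.TensorProduct.map_tmul, Algebra.TensorProduct.lmul'_apply_tmul,
        isPrim_dual_iff.1 hv, LinearMap.lTensor_tmul, LinearMap.rTensor_tmul,
        TensorProduct.rid_tmul, TensorProduct.lid_tmul, map_smul, map_smul, map_smul, map_smul]
      change v (f.ofConv b) * counit (R := k) (g.ofConv c) +
        counit (R := k) (f.ofConv b) * v (g.ofConv c) = _
      rw [hf, hg, smul_eq_mul, smul_eq_mul]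
      ring
  refine (h1 (comul a)).trans ?_
  rw [lTensor_counit_comul, rTensor_counit_comul]
  simp

lemma muElem_apply (f : HomMuP k p A) (a : A) :
    muElem f a = ConstZp.delta k p ((Additive.toMul f).ofConv a) := dualMap_apply _ _ _

lemma muElem_add (f g : HomMuP k p A) : muElem (f + g) = muElem f + muElem g := by
  ext a
  rw [dual_add_apply, muElem_apply, muElem_apply, muElem_apply]
  exact prim_apply_conv ConstZp.isPrim_delta (Additive.toMul f) (Additive.toMul g) a

/-- The map `f ↦ muElem f` as a homomorphism. -/
def muElemHom : HomMuP k p A →+ CartierDual k A := AddMonoidHom.mk' muElem muElem_add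

lemma muElem_smul (n : ZMod p) (f : HomMuP k p A) :
    muElem (n • f) = zmodHom k p n • muElem f := by
  obtain ⟨m, rfl⟩ := ZMod.natCast_zmod_surjective n
  rw [Nat.cast_smul_eq_nsmul, map_natCast, Nat.cast_smul_eq_nsmul]
  exact map_nsmul muElemHom m f

lemma muElem_injective : Function.Injective (muElem : HomMuP k p A → CartierDual k A) := by
  intro f g h
  apply Additive.toMul.injective
  apply WithConv.ofConv_injective
  have h1 : (dualMap (Additive.toMul f).ofConv : ConstZp k p →ₐ[k] CartierDual k A) =
      dualMap (Additive.toMul g).ofConv := ConstZp.algHom_ext h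
  exact eq_of_dualMap_eq fun φ => DFunLike.congr_fun h1 φ

/-- A fixed primitive element is a homomorphism from `O(ℤ/p)` to the dual, and its transpose is the
required homomorphism from `A` to `O(μ_p)`. -/
lemma exists_muElem_eq {u : CartierDual k A} (hu : IsPrim k u) (hup : u ^ p = u) :
    ∃ f : HomMuP k p A, muElem f = u := by
  refine ⟨Additive.ofMul (WithConv.toConv (undual (ConstZp.liftPrim u hu hup))), ?_⟩
  ext a
  rw [muElem_apply]
  refine (apply_undual _ _ a).trans ?_
  rw [ConstZp.liftPrim_delta]

lemma linearIndependent_muElem {ι : Type*} {b : ι → HomMuP k p A}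
    (hb : LinearIndependent (ZMod p) b) : LinearIndependent k fun i => muElem (b i) := by
  let _ : AddCommGroup (HomMuP k p A) := Module.addCommMonoidToAddCommGroup (ZMod p)
  refine linearIndependent_of_fixed p (fun i => muElem_pow (b i)) fun s n h => ?_
  refine linearIndependent_iff'.1 hb s n (muElem_injective ?_)
  have h1 : muElem (∑ i ∈ s, n i • b i) = ∑ i ∈ s, muElem (n i • b i) :=
    map_sum (muElemHom (k := k) (p := p) (A := A)) _ s
  rw [h1, show muElem (0 : HomMuP k p A) = 0 from map_zero muElemHom, ← h]
  exact Finset.sum_congr rfl fun i _ => muElem_smul _ _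

variable (k p A) in
/-- A basis of `Hom(μ_p, G)` gives independent primitive elements that span the fixed ones. -/
lemma exists_fixed_basis : ∃ u : Fin (pRank k p A) → CartierDual k A,
    (∀ i, IsPrim k (u i)) ∧ (∀ i, u i ^ p = u i) ∧ LinearIndependent k u ∧
      ∀ w : CartierDual k A, IsPrim k w → w ^ p = w → w ∈ Submodule.span k (Set.range u) := by
  let _ : AddCommGroup (HomMuP k p A) := Module.addCommMonoidToAddCommGroup (ZMod p)
  let b₀ := Module.Basis.ofVectorSpace (ZMod p) (HomMuP k p A)
  have hli := linearIndependent_muElem b₀.linearIndependent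
  -- Independence over `k` inside the finite-dimensional dual shows that `Hom(μ_p, G)` is finite
  -- over `𝔽_p`. Only then is `pRank` the true dimension rather than the default value 0 of
  -- `finrank`.
  have := hli.finite_of_isNoetherian
  have : Module.Finite (ZMod p) (HomMuP k p A) := Module.Finite.of_basis b₀
  let b := Module.finBasis (ZMod p) (HomMuP k p A)
  refine ⟨fun i => muElem (b i), fun i => muElem_isPrim _, fun i => muElem_pow _,
    linearIndependent_muElem b.linearIndependent, fun w hw hwp => ?_⟩
  obtain ⟨f, rfl⟩ := exists_muElem_eq hw hwp
  rw [← b.sum_repr f, show muElem (∑ i, b.repr f i • b i) = ∑ i, muElem (b.repr f i • b i) from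
    map_sum (muElemHom (k := k) (p := p) (A := A)) _ _]
  refine Submodule.sum_mem _ fun i _ => ?_
  rw [muElem_smul]
  exact Submodule.smul_mem _ _ (Submodule.subset_span ⟨i, rfl⟩)

variable (k p A) in
/-- The primitive elements with `p`-th power zero. -/
def nilPrim : Submodule k (CartierDual k A) where
  carrier := {c | IsPrim k c ∧ c ^ p = 0}
  add_mem' := fun {c d} hc hd => ⟨hc.1.add hd.1, by rw [add_pow_p k p, hc.2, hd.2, add_zero]⟩
  zero_mem' := ⟨IsPrim.zero, zero_pow (Fact.out : p.Prime).ne_zero⟩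
  smul_mem' := fun r c hc => ⟨hc.1.smul r, by rw [smul_pow, hc.2, smul_zero]⟩

namespace AlphaP

lemma dual_algHom_ext {B : Type*} [CommRing B] [Algebra k B]
    {f g : CartierDual k (AlphaP k p) →ₐ[k] B} (h : f (dualGen k p) = g (dualGen k p)) : f = g := by
  let e : AlphaP k p →ₐ[k] CartierDual k (AlphaP k p) :=
    liftPrim (dualGen k p) isPrim_dualGen dualGen_pow
  have he : e (gen k p) = dualGen k p := liftPrim_gen _ isPrim_dualGen dualGen_pow
  have h1 : f.comp e = g.comp e := hom_ext (by rw [AlgHom.comp_apply, AlgHom.comp_apply, he, h])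
  ext x
  obtain ⟨y, hy⟩ := liftPrim_dualGen_bijective.2 x
  rw [← hy]
  exact DFunLike.congr_fun h1 y

/-- The homomorphism from the dual of `α_p` given by a primitive element. -/
def dualLift {B : Type v} [CommRing B] [Bialgebra k B] (b : B) (hb : IsPrim k b) (hbp : b ^ p = 0) :
    CartierDual k (AlphaP k p) →ₐc[k] B :=
  (liftPrim b hb hbp).comp
    (BialgEquiv.ofBijective _ (liftPrim_dualGen_bijective (k := k) (p := p))).symm.toBialgHom

lemma dualLift_dualGen {B : Type v} [CommRing B] [Bialgebra k B] (b : B) (hb : IsPrim k b)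
    (hbp : b ^ p = 0) : dualLift b hb hbp (dualGen k p) = b := by
  let e := BialgEquiv.ofBijective _ (liftPrim_dualGen_bijective (k := k) (p := p))
  have h1 : e (gen k p) = dualGen k p := liftPrim_gen _ isPrim_dualGen dualGen_pow
  have h2 : e.symm (dualGen k p) = gen k p := by
    rw [← h1]
    exact e.toEquiv.symm_apply_apply _
  exact (congrArg (liftPrim b hb hbp) h2).trans (liftPrim_gen b hb hbp)

end AlphaP

/-- The primitive element attached to a homomorphism to `α_p`. -/
def alphaElem : HomAlphaP k p A →ₗ[k] CartierDual k A where
  toFun f := dualMap f.hom (AlphaP.dualGen k p)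
  map_add' f g := by
    ext a
    rw [dual_add_apply, dualMap_apply, dualMap_apply, dualMap_apply]
    exact prim_apply_conv AlphaP.isPrim_dualGen (Additive.toMul f) (Additive.toMul g) a
  map_smul' c f := by
    have h : dualMap (AlphaP.scale c) (AlphaP.dualGen k p) = c • AlphaP.dualGen k p :=
      AlphaP.prim_ext (AlphaP.isPrim_dualGen.map _) (AlphaP.isPrim_dualGen.smul c) (by
        rw [dualMap_apply, AlphaP.scale_gen, map_smul]
        rfl)
    ext a
    rw [RingHom.id_apply, dual_smul_apply, dualMap_apply, dualMap_apply]
    exact DFunLike.congr_fun h (f.hom a)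

lemma alphaElem_apply (f : HomAlphaP k p A) (a : A) :
    alphaElem f a = AlphaP.dualGen k p (f.hom a) := dualMap_apply _ _ _

lemma alphaElem_mem (f : HomAlphaP k p A) : alphaElem f ∈ nilPrim k p A :=
  ⟨AlphaP.isPrim_dualGen.map (dualMap f.hom), by
    change dualMap f.hom (AlphaP.dualGen k p) ^ p = 0
    rw [← map_pow, AlphaP.dualGen_pow, map_zero]⟩

lemma alphaElem_injective : Function.Injective (alphaElem : HomAlphaP k p A →ₗ[k] CartierDual k A) := by
  intro f g h
  apply HomAlphaP.ext
  exact congrArg (fun h : A →ₐc[k] AlphaP k p => (h : A →ₐ[k] AlphaP k p))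
    (eq_of_dualMap_eq fun φ => DFunLike.congr_fun (AlphaP.dual_algHom_ext
      (f := (dualMap f.hom : CartierDual k (AlphaP k p) →ₐ[k] CartierDual k A))
      (g := (dualMap g.hom : CartierDual k (AlphaP k p) →ₐ[k] CartierDual k A)) h) φ)

lemma exists_alphaElem_eq {c : CartierDual k A} (hc : c ∈ nilPrim k p A) :
    ∃ f : HomAlphaP k p A, alphaElem f = c := by
  refine ⟨Additive.ofMul (WithConv.toConv (undual (AlphaP.dualLift c hc.1 hc.2))), ?_⟩
  ext a
  rw [alphaElem_apply]
  refine (apply_undual _ _ a).trans ?_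
  rw [AlphaP.dualLift_dualGen]

variable (k p A) in
lemma finrank_nilPrim : Module.finrank k (nilPrim k p A) = aNumber k p A := by
  have h : LinearMap.range (alphaElem : HomAlphaP k p A →ₗ[k] CartierDual k A) = nilPrim k p A := by
    ext c
    exact ⟨fun ⟨f, hf⟩ => hf ▸ alphaElem_mem f, fun hc => exists_alphaElem_eq hc⟩
  rw [← h]
  exact LinearMap.finrank_range_of_inj alphaElem_injective

end Homs

/-! ### The case of maximal `a`-number: decomposition of the tangent space -/

section Decomposition

variable {k : Type u} [Field k] {p : ℕ} [Fact p.Prime] [CharP k p] {A : Type v} [CommRing A]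
  [HopfAlgebra k A] [Coalgebra.IsCocomm k A] [Module.Finite k A]

variable (p) in
lemma sum_pow_p {B : Type*} [CommRing B] [Algebra k B] {ι : Type*} (s : Finset ι) (x : ι → B) :
    (∑ i ∈ s, x i) ^ p = ∑ i ∈ s, x i ^ p := by
  classical
  induction s using Finset.induction_on with
  | empty => simp [(Fact.out : p.Prime).ne_zero]
  | insert i s hi ih => rw [Finset.sum_insert hi, Finset.sum_insert hi, add_pow_p k p, ih]

lemma fixed_sum_pow {B : Type*} [CommRing B] [Algebra k B] {ι : Type*} [Fintype ι] {u : ι → B}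
    (hu : ∀ i, u i ^ p = u i) (c : ι → k) :
    (∑ i, c i • u i) ^ p = ∑ i, c i ^ p • u i := by
  rw [sum_pow_p (k := k) p]
  exact Finset.sum_congr rfl fun i _ => by rw [smul_pow, hu]

lemma fixed_sum_eq_zero {B : Type*} [CommRing B] [Algebra k B] {ι : Type*} [Fintype ι] {u : ι → B}
    (hu : ∀ i, u i ^ p = u i) (hli : LinearIndependent k u) {c : ι → k}
    (h : (∑ i, c i • u i) ^ p = 0) (i : ι) : c i = 0 := by
  rw [fixed_sum_pow hu] at h
  exact (pow_eq_zero_iff (Fact.out : p.Prime).ne_zero).1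
    (Fintype.linearIndependent_iff.1 hli _ h i)

/-- On the span of fixed independent elements the `p`-power map is Frobenius on coordinates, hence
injective, whereas it is zero on `nilPrim`; the sum is direct. -/
lemma finrank_span_sup_nilPrim {ι : Type*} [Fintype ι] {u : ι → CartierDual k A}
    (hu : ∀ i, u i ^ p = u i) (hli : LinearIndependent k u) :
    Module.finrank k (Submodule.span k (Set.range u) ⊔ nilPrim k p A : Submodule k _) =
      Fintype.card ι + aNumber k p A := by
  have h1 := Submodule.finrank_sup_add_finrank_inf_eq (Submodule.span k (Set.range u))
    (nilPrim k p A)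
  have h2 : Submodule.span k (Set.range u) ⊓ nilPrim k p A = ⊥ := by
    rw [eq_bot_iff]
    rintro x ⟨hx1, hx2⟩
    obtain ⟨c, rfl⟩ := (Submodule.mem_span_range_iff_exists_fun k).1 hx1
    rw [Submodule.mem_bot]
    exact Finset.sum_eq_zero fun i _ => by rw [fixed_sum_eq_zero hu hli hx2.2, zero_smul]
  rw [h2, finrank_bot, add_zero, finrank_span_eq_card hli, finrank_nilPrim] at h1
  exact h1

lemma span_sup_nilPrim_le {ι : Type*} {u : ι → CartierDual k A} (hu : ∀ i, IsPrim k (u i)) :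
    Submodule.span k (Set.range u) ⊔ nilPrim k p A ≤ primSubmodule k (CartierDual k A) :=
  sup_le (Submodule.span_le.2 (by rintro _ ⟨i, rfl⟩; exact hu i)) fun _ h => h.1

variable (k p A) in
theorem pRank_add_aNumber_le : pRank k p A + aNumber k p A ≤
    Module.finrank k (primSubmodule k (CartierDual k A)) := by
  obtain ⟨u, hu, hup, hli, -⟩ := exists_fixed_basis k p A
  have h := Submodule.finrank_mono (span_sup_nilPrim_le (p := p) hu)
  rw [finrank_span_sup_nilPrim hup hli, Fintype.card_fin] at h
  exact h

/-- If the `a`-number is maximal then the tangent space splits. -/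
lemma exists_decomposition {f : ℕ} {u : Fin f → CartierDual k A} (hu : ∀ i, IsPrim k (u i))
    (hup : ∀ i, u i ^ p = u i) (hli : LinearIndependent k u)
    (h : f + aNumber k p A = Module.finrank k (primSubmodule k (CartierDual k A)))
    {v : CartierDual k A} (hv : IsPrim k v) :
    ∃ c : Fin f → k, v - ∑ i, c i • u i ∈ nilPrim k p A := by
  have h1 : Submodule.span k (Set.range u) ⊔ nilPrim k p A = primSubmodule k (CartierDual k A) :=
    Submodule.eq_of_le_of_finrank_eq (span_sup_nilPrim_le hu) (by
      rw [finrank_span_sup_nilPrim hup hli, Fintype.card_fin, h])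
  have h2 : v ∈ Submodule.span k (Set.range u) ⊔ nilPrim k p A := h1 ▸ hv
  obtain ⟨x, hx, y, hy, rfl⟩ := Submodule.mem_sup.1 h2
  obtain ⟨c, rfl⟩ := (Submodule.mem_span_range_iff_exists_fun k).1 hx
  exact ⟨c, by simpa using hy⟩

end Decomposition

/-! ### Witt elements -/

section Witt

variable {k : Type u} [Field k] {p : ℕ} [Fact p.Prime] [CharP k p]

/-- Four-variable form of the cocycle identity, from two ways of grouping the sum. It becomes an
identity of polynomials after multiplication by `p`, which is harmless over `ℤ`. -/
lemma wittCocycle_add_add {R : Type*} [CommRing R] (x y x' y' : R) :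
    wittCocycle p (x + x') (y + y') + wittCocycle p x x' + wittCocycle p y y' =
      wittCocycle p x y + wittCocycle p x' y' + wittCocycle p (x + y) (x' + y') := by
  have key : ∀ a b c d : MvPolynomial (Fin 4) ℤ,
      wittCocycle p (a + c) (b + d) + wittCocycle p a c + wittCocycle p b d =
        wittCocycle p a b + wittCocycle p c d + wittCocycle p (a + b) (c + d) := by
    intro a b c d
    have hp : ((p : ℕ) : MvPolynomial (Fin 4) ℤ) ≠ 0 :=
      Nat.cast_ne_zero.2 (Fact.out : p.Prime).ne_zero
    apply mul_left_cancel₀ hp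
    simp only [mul_add, mul_wittCocycle]
    ring
  have h := congrArg (MvPolynomial.eval₂Hom (Int.castRingHom R) ![x, y, x', y'])
    (key (MvPolynomial.X 0) (MvPolynomial.X 1) (MvPolynomial.X 2) (MvPolynomial.X 3))
  simp only [map_add, map_wittCocycle, MvPolynomial.eval₂Hom_X'] at h
  exact h

/-- `(c, b)` behaves like the components of a Witt vector of length two. -/
def IsWitt (k : Type u) [Field k] (p : ℕ) {B : Type v} [CommRing B] [Bialgebra k B] (c b : B) :
    Prop :=
  comul (R := k) b = b ⊗ₜ[k] 1 + 1 ⊗ₜ[k] b + wittCocycle p (c ⊗ₜ[k] 1) (1 ⊗ₜ[k] c)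

section General

variable {B : Type v} [CommRing B] [Bialgebra k B]

lemma IsWitt.add_prim {c b v : B} (h : IsWitt k p c b) (hv : IsPrim k v) :
    IsWitt k p c (b + v) := by
  rw [IsWitt, map_add, h, hv, TensorProduct.add_tmul, TensorProduct.tmul_add]
  ring

lemma IsWitt.sub_isPrim {c b b' : B} (h : IsWitt k p c b) (h' : IsWitt k p c b') :
    IsPrim k (b - b') := by
  rw [IsPrim, map_sub, h, h', TensorProduct.sub_tmul, TensorProduct.tmul_sub]
  ring

lemma tmul_one_wittCocycle (x y : B) :
    wittCocycle p x y ⊗ₜ[k] (1 : B) = wittCocycle p (x ⊗ₜ[k] (1 : B)) (y ⊗ₜ[k] (1 : B)) :=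
  I11.map_wittCocycle' (Algebra.TensorProduct.includeLeft (R := k) (S := k) (A := B) (B := B)) x y

lemma one_tmul_wittCocycle (x y : B) :
    (1 : B) ⊗ₜ[k] wittCocycle p x y = wittCocycle p ((1 : B) ⊗ₜ[k] x) ((1 : B) ⊗ₜ[k] y) :=
  I11.map_wittCocycle' (Algebra.TensorProduct.includeRight (R := k) (A := B) (B := B)) x y

/-- This is addition of Witt vectors of length two, up to the sign of the cocycle. -/
lemma IsWitt.add {c b c' b' : B} (hc : IsPrim k c) (hc' : IsPrim k c') (h : IsWitt k p c b)
    (h' : IsWitt k p c' b') : IsWitt k p (c + c') (b + b' + wittCocycle p c c') := by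
  have h1 : comul (R := k) (wittCocycle p c c') =
      wittCocycle p (comul (R := k) c) (comul (R := k) c') :=
    I11.map_wittCocycle' (Bialgebra.comulAlgHom k B) c c'
  have h2 := wittCocycle_add_add (p := p) (c ⊗ₜ[k] (1 : B)) ((1 : B) ⊗ₜ[k] c)
    (c' ⊗ₜ[k] (1 : B)) ((1 : B) ⊗ₜ[k] c')
  rw [IsWitt, map_add, map_add, h, h', h1, hc, hc']
  simp only [TensorProduct.add_tmul, TensorProduct.tmul_add, tmul_one_wittCocycle,
    one_tmul_wittCocycle]
  linear_combination -h2

/-- The cocycle is homogeneous of degree `p`. For this reason `b ^ p` will depend on `c`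
semilinearly with respect to the square of Frobenius. -/
lemma IsWitt.smul {c b : B} (r : k) (h : IsWitt k p c b) : IsWitt k p (r • c) (r ^ p • b) := by
  have h1 : wittCocycle p ((r • c) ⊗ₜ[k] (1 : B)) ((1 : B) ⊗ₜ[k] (r • c)) =
      r ^ p • wittCocycle p (c ⊗ₜ[k] (1 : B)) ((1 : B) ⊗ₜ[k] c) := by
    rw [TensorProduct.tmul_smul, ← TensorProduct.smul_tmul', Algebra.smul_def, Algebra.smul_def r,
      wittCocycle_mul, Algebra.smul_def, map_pow]
  rw [IsWitt, map_smul, h, h1, smul_add, smul_add, TensorProduct.tmul_smul,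
    ← TensorProduct.smul_tmul']

/-- The cocycle is divisible by `c ⊗ 1`, so its `p`-th power vanishes. -/
lemma IsWitt.pow_isPrim {c b : B} (hc : c ^ p = 0) (h : IsWitt k p c b) : IsPrim k (b ^ p) := by
  rw [IsPrim, Bialgebra.comul_pow, h, add_pow_p k p, add_pow_p k p, I11.wittCocycle_pow]
  · simp [Algebra.TensorProduct.tmul_pow]
  · simp [Algebra.TensorProduct.tmul_pow, hc]

lemma IsWitt.counit {c b : B} (hc : Coalgebra.counit (R := k) c = 0) (h : IsWitt k p c b) :
    Coalgebra.counit (R := k) b = 0 := by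
  have h1 := congrArg (Algebra.TensorProduct.lift (Bialgebra.counitAlgHom k B)
    (Bialgebra.counitAlgHom k B) fun _ _ => Commute.all _ _) h
  have h2 : ∀ b, (Algebra.TensorProduct.lift (Bialgebra.counitAlgHom k B)
    (Bialgebra.counitAlgHom k B) fun _ _ => Commute.all _ _) (comul (R := k) b) =
      Coalgebra.counit (R := k) b := by
    intro b
    have h3 := AlgHom.convMul_apply (1 : WithConv (B →ₐ[k] k)) 1 b
    rw [mul_one] at h3
    exact h3.symm
  rw [h2, map_add, map_add, I11.map_wittCocycle', Algebra.TensorProduct.lift_tmul,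
    Algebra.TensorProduct.lift_tmul, Algebra.TensorProduct.lift_tmul] at h1
  simp [hc, wittCocycle_zero_left] at h1
  exact h1

/-- The homomorphism from `I_{1,1}` given by a Witt element `b` with components `(b ^ p, b)`. -/
def I11.liftWitt (b : B) (hb : IsWitt k p (b ^ p) b) (hbp : (b ^ p) ^ p = 0)
    (h0 : Coalgebra.counit (R := k) b = 0) : I11 k p →ₐc[k] B :=
  BialgHom.ofAlgHom (I11.lift b hbp) (I11.hom_ext (by simp [h0]))
    (I11.hom_ext (by
      rw [AlgHom.comp_apply, Bialgebra.comulAlgHom_apply, I11.comul_gen, I11.comulGen,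
        AlgHom.comp_apply, I11.lift_gen, Bialgebra.comulAlgHom_apply, hb]
      simp [I11.map_wittCocycle']))

@[simp] lemma I11.liftWitt_gen (b : B) (hb : IsWitt k p (b ^ p) b) (hbp : (b ^ p) ^ p = 0)
    (h0 : Coalgebra.counit (R := k) b = 0) :
    I11.liftWitt b hb hbp h0 (I11.gen k p) = b := I11.lift_gen b hbp

end General

variable {A : Type v} [CommRing A] [HopfAlgebra k A] [Coalgebra.IsCocomm k A] [Module.Finite k A]

lemma dualPairing_wittCocycle (c : CartierDual k A) (x y : A) :
    dualPairing k A (wittCocycle p (c ⊗ₜ[k] 1) (1 ⊗ₜ[k] c)) (x ⊗ₜ y) =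
      ∑ i ∈ Finset.Ioo 0 p, ((p.choose i / p : ℕ) : k) * ((c ^ i) x * (c ^ (p - i)) y) := by
  rw [wittCocycle, map_sum, LinearMap.sum_apply]
  refine Finset.sum_congr rfl fun i _ => ?_
  rw [Algebra.TensorProduct.tmul_pow, Algebra.TensorProduct.tmul_pow,
    Algebra.TensorProduct.tmul_mul_tmul, one_pow, one_pow, one_mul, mul_one,
    ← map_natCast (algebraMap k _), ← Algebra.smul_def, map_smul, LinearMap.smul_apply,
    dualPairing_tmul, smul_eq_mul]

lemma isWitt_dual_iff {c b : CartierDual k A} : IsWitt k p c b ↔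
    ∀ x y, b (x * y) = b x * counit (R := k) y + counit (R := k) x * b y +
      ∑ i ∈ Finset.Ioo 0 p, ((p.choose i / p : ℕ) : k) * ((c ^ i) x * (c ^ (p - i)) y) := by
  constructor
  · intro h x y
    rw [← comul_dual_apply, h, map_add, map_add, LinearMap.add_apply, LinearMap.add_apply,
      dualPairing_wittCocycle, dualPairing_tmul, dualPairing_tmul]
    simp
  · intro h
    refine dualPairing_ext fun x y => ?_
    rw [comul_dual_apply, h, map_add, map_add, LinearMap.add_apply, LinearMap.add_apply,
      dualPairing_wittCocycle, dualPairing_tmul, dualPairing_tmul]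
    simp

end Witt

/-! ### Lifting homomorphisms to truncated polynomials -/

section TruncLift

variable {k : Type u} [Field k] {p : ℕ} [Fact p.Prime] [CharP k p]

namespace TruncPoly

/-- Such an element is divisible by the square of the generator, and `2 * p ≥ p + 1`. -/
lemma pow_eq_zero_of_coef {x : TruncPoly k (p + 1)} (h0 : coef 0 x = 0) (h1 : coef 1 x = 0) :
    x ^ p = 0 := by
  have hp := (Fact.out : p.Prime).one_lt
  obtain ⟨f, rfl⟩ := mk_surjective x
  rw [coef_mk (by omega)] at h0 h1
  obtain ⟨g, rfl⟩ : Polynomial.X ^ 2 ∣ f := Polynomial.X_pow_dvd_iff.2 fun i hi => by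
    interval_cases i <;> assumption
  rw [map_mul, map_pow, mk_X, mul_pow, ← pow_mul,
    show 2 * p = (p + 1) + (p - 1) by omega, pow_add, gen_pow, zero_mul, zero_mul]

lemma pow_eq_pow_of_coef {x y : TruncPoly k (p + 1)} (h0 : coef 0 x = coef 0 y)
    (h1 : coef 1 x = coef 1 y) : x ^ p = y ^ p := by
  have h := pow_eq_zero_of_coef (p := p) (x := x - y) (by rw [map_sub, h0, sub_self])
    (by rw [map_sub, h1, sub_self])
  have h2 := add_pow_p k p (x - y) y
  rw [sub_add_cancel, h, zero_add] at h2
  exact h2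

lemma coef_pow (x : TruncPoly k (p + 1)) : coef p (x ^ p) = coef 1 x ^ p := by
  have hp := (Fact.out : p.Prime).one_lt
  have h : x ^ p = (coef 0 x • 1 + coef 1 x • gen k (p + 1)) ^ p := by
    have h1 := coef_gen_pow (k := k) (n := p + 1) (i := 0) (by omega) 1
    have h2 := coef_gen_pow (k := k) (n := p + 1) (i := 1) (by omega) 1
    rw [pow_one] at h1 h2
    refine pow_eq_pow_of_coef ?_ ?_
    · rw [map_add, map_smul, map_smul, coef_one (by omega), h1]
      simp
    · rw [map_add, map_smul, map_smul, coef_one (by omega), h2]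
      simp
  rw [h, add_pow_p k p, smul_pow, smul_pow, one_pow, map_add, map_smul, map_smul,
    coef_one (by omega), coef_gen_pow (by omega), if_neg (by omega), if_pos rfl]
  simp

variable (k p) in
/-- The projection to `k[x]/(x ^ p)`. -/
def toAlphaP : TruncPoly k (p + 1) →ₐ[k] AlphaP k p :=
  lift (AlphaP.gen k p) (by rw [pow_succ, AlphaP.gen_pow, zero_mul])

lemma toAlphaP_mk (f : k[X]) : toAlphaP k p (mk k (p + 1) f) = mk k p f := by
  have h : (toAlphaP k p).comp (mk k (p + 1)) = mk k p := Polynomial.algHom_ext (by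
    rw [AlgHom.comp_apply, mk_X]
    exact lift_gen _ _)
  exact DFunLike.congr_fun h f

lemma toAlphaP_surjective : Function.Surjective (toAlphaP k p) := fun y => by
  obtain ⟨f, rfl⟩ := mk_surjective y
  exact ⟨_, toAlphaP_mk f⟩

lemma coef_toAlphaP {i : ℕ} (hi : i < p) (x : TruncPoly k (p + 1)) :
    coef (k := k) (n := p) i (toAlphaP k p x) = coef i x := by
  obtain ⟨f, rfl⟩ := mk_surjective x
  rw [coef_mk (by omega)]
  exact (congrArg (coef (k := k) (n := p) i) (toAlphaP_mk f)).trans (coef_mk hi f)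

end TruncPoly

variable [IsAlgClosed k] {A : Type v} [CommRing A] [HopfAlgebra k A] [Coalgebra.IsCocomm k A]
  [Module.Finite k A]

/-- Since `(y - y') ^ p = 0` and ker Ver = im Frob, the difference `y - y'` lies in the ideal of ker
Ver. The tangent vector of `E` has `p`-th power zero, so it vanishes on that ideal. Hence `x - x'`
has no terms of degree 0 and 1, and its `p`-th power is 0. -/
lemma IsBT1.trunc_pow_eq (hG : IsBT1 k p A) (E : A →ₐc[k] AlphaP k p) {y y' : A}
    (h : y ^ p = y' ^ p) {x x' : TruncPoly k (p + 1)} (hx : TruncPoly.toAlphaP k p x = E y)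
    (hx' : TruncPoly.toAlphaP k p x' = E y') : x ^ p = x' ^ p := by
  have hp := (Fact.out : p.Prime).one_lt
  have hz : (y - y') ^ p = 0 := by
    have h2 := add_pow_p k p (y - y') y'
    rwa [sub_add_cancel, h, right_eq_add] at h2
  have h0 : counit (R := k) (y - y') = 0 := by
    have h1 := congrArg (counit (R := k)) hz
    rw [Bialgebra.counit_pow, map_zero] at h1
    exact (pow_eq_zero_iff (by omega)).1 h1
  have h1 : dualMap E (AlphaP.dualGen k p) (y - y') = 0 :=
    hG.prim_apply_eq_zero (AlphaP.isPrim_dualGen.map _)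
      (by rw [← map_pow, AlphaP.dualGen_pow, map_zero]) hz
  rw [dualMap_apply, AlphaP.dualGen_apply] at h1
  have h2 : TruncPoly.toAlphaP k p (x - x') = E (y - y') := by rw [map_sub, map_sub, hx, hx']
  rw [← sub_eq_zero]
  have h3 := add_pow_p k p (x - x') x'
  rw [sub_add_cancel] at h3
  rw [h3, add_sub_cancel_right]
  refine TruncPoly.pow_eq_zero_of_coef ?_ ?_
  · rw [← TruncPoly.coef_toAlphaP (by omega), h2, ← AlphaP.counit_eq_coef]
    exact (CoalgHomClass.counit_comp_apply E _).trans h0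
  · rw [← TruncPoly.coef_toAlphaP (by omega), h2, h1]

/-- A homomorphism to `k[x]/(x ^ p)` determines one on `p`-th powers to `k[x]/(x ^ (p + 1))`. -/
lemma IsBT1.exists_frobSub_lift (hG : IsBT1 k p A) (E : A →ₐc[k] AlphaP k p) :
    ∃ e : frobSub k A p →+* TruncPoly k (p + 1), ∀ (r : frobSub k A p) (y : A)
      (x : TruncPoly k (p + 1)), y ^ p = r → TruncPoly.toAlphaP k p x = E y → e r = x ^ p := by
  choose y hy using fun r : frobSub k A p => r.2
  choose x hx using fun r => TruncPoly.toAlphaP_surjective (E (y r))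
  have key : ∀ (r : frobSub k A p) (z : A) (w : TruncPoly k (p + 1)), z ^ p = r →
      TruncPoly.toAlphaP k p w = E z → x r ^ p = w ^ p := fun r z w hz hw =>
    hG.trunc_pow_eq E ((hy r).trans hz.symm) (hx r) hw
  refine ⟨{ toFun := fun r => x r ^ p
            map_one' := ?_
            map_mul' := fun r s => ?_
            map_zero' := ?_
            map_add' := fun r s => ?_ }, key⟩
  · rw [key 1 1 1 (one_pow p) (by rw [map_one, map_one]), one_pow]
  · rw [key (r * s) (y r * y s) (x r * x s) (by rw [mul_pow, hy, hy]; rfl)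
      (by rw [map_mul, map_mul, hx, hx]), mul_pow]
  · have hp := (Fact.out : p.Prime).ne_zero
    rw [key 0 0 0 (by rw [zero_pow hp]; rfl) (by rw [map_zero, map_zero]), zero_pow hp]
  · rw [key (r + s) (y r + y s) (x r + x s) (by rw [add_pow_p k p, hy, hy]; rfl)
      (by rw [map_add, map_add, hx, hx]), add_pow_p k p]

/-- The ring `A` is presented over its `p`-th powers by the coordinates and the values of their
`p`-th powers alone, so these are the only relations that a homomorphism has to respect. -/
lemma Coords.ker_aeval_le (X : Coords k A) {S : Type*} [CommRing S]
    (Φ : MvPolynomial (Fin X.d) (frobSub k A p) →+* S)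
    (hΦ : ∀ i, Φ (MvPolynomial.X i) ^ p = Φ (MvPolynomial.C ⟨X.t i ^ p, X.t i, rfl⟩)) :
    RingHom.ker (MvPolynomial.aeval X.t : _ →ₐ[frobSub k A p] A) ≤ RingHom.ker Φ := by
  intro f hf
  obtain ⟨g, hg, hfg⟩ := exists_reduced p (Fact.out : p.Prime).pos
    (fun i => (⟨X.t i ^ p, X.t i, rfl⟩ : frobSub k A p)) f
  have h1 : MvPolynomial.aeval X.t (f - g) = 0 := by
    have h2 : Ideal.span (Set.range fun i => (MvPolynomial.X i ^ p - MvPolynomial.C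
        (⟨X.t i ^ p, X.t i, rfl⟩ : frobSub k A p) : MvPolynomial (Fin X.d) (frobSub k A p))) ≤
        RingHom.ker (MvPolynomial.aeval X.t : _ →ₐ[frobSub k A p] A) := by
      rw [Ideal.span_le]
      rintro _ ⟨i, rfl⟩
      rw [SetLike.mem_coe, RingHom.mem_ker, map_sub, map_pow, MvPolynomial.aeval_X,
        MvPolynomial.aeval_C, sub_eq_zero]
      rfl
    exact h2 hfg
  have h3 : Φ (f - g) = 0 := by
    have h2 : Ideal.span (Set.range fun i => (MvPolynomial.X i ^ p - MvPolynomial.C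
        (⟨X.t i ^ p, X.t i, rfl⟩ : frobSub k A p) : MvPolynomial (Fin X.d) (frobSub k A p))) ≤
        RingHom.ker Φ := by
      rw [Ideal.span_le]
      rintro _ ⟨i, rfl⟩
      rw [SetLike.mem_coe, RingHom.mem_ker, map_sub, map_pow, hΦ, sub_self]
    exact h2 hfg
  have h4 : g = 0 := by
    have h5 : MvPolynomial.aeval X.t g = 0 := by
      rw [map_sub, RingHom.mem_ker.1 hf, zero_sub, neg_eq_zero] at h1
      exact h1
    rw [exists_eq_reducedPoly g hg, aeval_reducedPoly] at h5
    have h6 := X.reducedEval_injective (p := p) (h5.trans (map_zero (reducedEval k X.t)).symm)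
    rw [exists_eq_reducedPoly g hg, h6]
    simp [reducedPoly]
  rw [h4, sub_zero] at h3
  exact h3

/-- A homomorphism `G ← α_p` extends to an infinitesimally larger curve. -/
theorem IsBT1.exists_trunc_lift (hG : IsBT1 k p A) (E : A →ₐc[k] AlphaP k p) :
    ∃ L : A →ₐ[k] TruncPoly k (p + 1), ∀ a, TruncPoly.toAlphaP k p (L a) = E a := by
  obtain ⟨X⟩ := exists_coords k A p
  -- The map is prescribed on `p`-th powers by `e` and on the coordinates by arbitrary lifts of
  -- their images under `E`. The relations `X_i ^ p = t_i ^ p` hold because `e` is computed by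
  -- `p`-th powers of any lift.
  obtain ⟨e, he⟩ := hG.exists_frobSub_lift E
  choose t' ht' using fun i => TruncPoly.toAlphaP_surjective (E (X.t i))
  let Φ := MvPolynomial.eval₂Hom e t'
  have hker := X.ker_aeval_le Φ (fun i => by
    rw [MvPolynomial.eval₂Hom_X', MvPolynomial.eval₂Hom_C]
    exact (he _ (X.t i) _ rfl (ht' i)).symm)
  have hsurj := aeval_coordinates_surjective p X.ht X.span
  choose s hs using hsurj
  have key : ∀ f, Φ (s (MvPolynomial.aeval X.t f)) = Φ f := fun f => by
    rw [← sub_eq_zero, ← map_sub]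
    refine hker ?_
    rw [RingHom.mem_ker, map_sub, hs, sub_self]
  have hE : ∀ f, TruncPoly.toAlphaP k p (Φ f) = E (MvPolynomial.aeval X.t f) := by
    intro f
    have h1 : (TruncPoly.toAlphaP k p : TruncPoly k (p + 1) →+* AlphaP k p).comp Φ =
        ((E : A →ₐ[k] AlphaP k p) : A →+* AlphaP k p).comp
          (MvPolynomial.aeval X.t : _ →ₐ[frobSub k A p] A).toRingHom := by
      refine MvPolynomial.ringHom_ext (fun r => ?_) fun i => ?_
      · obtain ⟨y, hy⟩ := r.2
        obtain ⟨x, hx⟩ := TruncPoly.toAlphaP_surjective (E y)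
        have h2 : Φ (MvPolynomial.C r) = x ^ p := by
          rw [MvPolynomial.eval₂Hom_C]
          exact he r y x hy hx
        have h3 : (MvPolynomial.aeval X.t : _ →ₐ[frobSub k A p] A) (MvPolynomial.C r) = y ^ p := by
          rw [MvPolynomial.aeval_C, hy]
          rfl
        change TruncPoly.toAlphaP k p (Φ (MvPolynomial.C r)) =
          E ((MvPolynomial.aeval X.t : _ →ₐ[frobSub k A p] A) (MvPolynomial.C r))
        rw [h2, h3, map_pow, map_pow, hx]
      · change TruncPoly.toAlphaP k p (Φ (MvPolynomial.X i)) =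
          E ((MvPolynomial.aeval X.t : _ →ₐ[frobSub k A p] A) (MvPolynomial.X i))
        rw [MvPolynomial.eval₂Hom_X', MvPolynomial.aeval_X, ht']
    exact DFunLike.congr_fun h1 f
  refine ⟨{ toFun := fun a => Φ (s a)
            map_one' := ?_
            map_mul' := fun a b => ?_
            map_zero' := ?_
            map_add' := fun a b => ?_
            commutes' := fun c => ?_ }, fun a => ?_⟩
  · have h := key 1
    rwa [map_one, map_one] at h
  · have h := key (s a * s b)
    rwa [map_mul, map_mul, hs, hs] at h
  · have h := key 0
    rwa [map_zero, map_zero] at h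
  · have h := key (s a + s b)
    rwa [map_add, map_add, hs, hs] at h
  · obtain ⟨d, rfl⟩ := IsAlgClosed.exists_pow_nat_eq c (Fact.out : p.Prime).pos
    have h := key (MvPolynomial.C (algebraMap k (frobSub k A p) (d ^ p)))
    rw [MvPolynomial.aeval_C, MvPolynomial.eval₂Hom_C,
      he _ (algebraMap k A d) (algebraMap k _ d) (map_pow _ _ _).symm (by
        rw [AlgHom.commutes]
        exact ((E : A →ₐ[k] AlphaP k p).commutes d).symm), ← map_pow] at h
    exact h
  · exact (hE _).trans (congrArg E (hs a))

end TruncLift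

/-! ### Existence of Witt elements -/

section WittExistence

variable {k : Type u} [Field k] {p : ℕ} [Fact p.Prime] [CharP k p]

namespace AlphaP

lemma dualGen_pow_apply_eq {j : ℕ} (hj : j < p) (y : AlphaP k p) :
    (dualGen k p ^ j) y = j.factorial * TruncPoly.coef (k := k) (n := p) j y := by
  let f₁ : AlphaP k p →ₗ[k] k := CartierDual.equivDual k (AlphaP k p) (dualGen k p ^ j)
  let f₂ : AlphaP k p →ₗ[k] k := (j.factorial : k) • TruncPoly.coef (k := k) (n := p) j
  have h2 : f₁ = f₂ := linearMap_ext fun i => by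
    change (dualGen k p ^ j) (gen k p ^ i) =
      (j.factorial : k) * TruncPoly.coef (k := k) (n := p) j (TruncPoly.gen k p ^ i)
    rw [dualGen_pow_apply, TruncPoly.coef_gen_pow hj]
    split_ifs with h
    · rw [mul_one]
    · rw [mul_zero]
  exact DFunLike.congr_fun h2 y

end AlphaP

lemma choose_div_mul_factorial {i : ℕ} (hi : i ∈ Finset.Ioo 0 p) :
    (p.choose i / p) * (i.factorial * (p - i).factorial) = (p - 1).factorial := by
  rw [Finset.mem_Ioo] at hi
  have hp : p.Prime := Fact.out
  have h1 := Nat.choose_mul_factorial_mul_factorial hi.2.le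
  have h2 : p * (p.choose i / p) = p.choose i :=
    Nat.mul_div_cancel' (hp.dvd_choose_self hi.1.ne' hi.2)
  rw [← h2, ← Nat.mul_factorial_pred hp.ne_zero] at h1
  apply Nat.eq_of_mul_eq_mul_left hp.pos
  rw [← h1]
  ring

variable [IsAlgClosed k] {A : Type v} [CommRing A] [HopfAlgebra k A] [Coalgebra.IsCocomm k A]
  [Module.Finite k A]

/-- Every primitive element with `p`-th power zero is the first component of a Witt element. -/
theorem IsBT1.exists_isWitt (hG : IsBT1 k p A) {c : CartierDual k A} (hc : c ∈ nilPrim k p A) :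
    ∃ b : CartierDual k A, IsWitt k p c b ∧
      ∀ x, b (x ^ p) = ((p - 1).factorial : k) * c x ^ p := by
  have hp := (Fact.out : p.Prime).one_lt
  obtain ⟨f, hf⟩ := exists_alphaElem_eq hc
  obtain ⟨L, hL⟩ := hG.exists_trunc_lift f.hom
  -- Below degree `p` the coefficients of `L` are the divided powers `c ^ i / i!`. The coefficient
  -- in degree `p` stands in for the missing `c ^ p / p!`, and `b` is `(p - 1)!` times it;
  -- multiplicativity of `L` then yields the Witt cocycle, as `(p choose i) / p = (p - 1)! / (i! (p
  -- - i)!)`.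
  have hcoef : ∀ i < p, ∀ a, (i.factorial : k) * TruncPoly.coef i (L a) = (c ^ i) a := by
    intro i hi a
    have h1 : c ^ i = dualMap f.hom (AlphaP.dualGen k p ^ i) := by
      rw [map_pow, ← hf]
      rfl
    rw [h1, dualMap_apply, AlphaP.dualGen_pow_apply_eq hi, ← TruncPoly.coef_toAlphaP hi, hL]
  have h0 : ∀ a, TruncPoly.coef 0 (L a) = counit (R := k) a := fun a => by
    have h := hcoef 0 (by omega) a
    rwa [Nat.factorial_zero, Nat.cast_one, one_mul, pow_zero, dual_one_apply] at h
  have h1 : ∀ a, TruncPoly.coef 1 (L a) = c a := fun a => by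
    have h := hcoef 1 hp a
    rwa [Nat.factorial_one, Nat.cast_one, one_mul, pow_one] at h
  refine ⟨(CartierDual.equivDual k A).symm
    (((p - 1).factorial : k) • (TruncPoly.coef p ∘ₗ L.toLinearMap)), ?_, fun x => ?_⟩
  · rw [isWitt_dual_iff]
    intro x y
    have h2 : TruncPoly.coef p (L (x * y)) = TruncPoly.coef p (L x) * counit (R := k) y +
        counit (R := k) x * TruncPoly.coef p (L y) +
        ∑ i ∈ Finset.Ioo 0 p, TruncPoly.coef i (L x) * TruncPoly.coef (p - i) (L y) := by
      rw [map_mul, TruncPoly.coef_mul (by omega), Finset.Nat.sum_antidiagonal_eq_sum_range_succ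
        (fun i j => TruncPoly.coef i (L x) * TruncPoly.coef j (L y)), Finset.sum_range_succ,
        Finset.range_eq_Ico, Finset.sum_eq_sum_Ico_succ_bot (by omega), Nat.sub_zero, Nat.sub_self,
        h0, h0]
      rw [show Finset.Ico (0 + 1) p = Finset.Ioo 0 p from rfl]
      ring
    change ((p - 1).factorial : k) * TruncPoly.coef p (L (x * y)) =
      ((p - 1).factorial : k) * TruncPoly.coef p (L x) * counit (R := k) y +
        counit (R := k) x * (((p - 1).factorial : k) * TruncPoly.coef p (L y)) + _
    rw [h2, mul_add, Finset.mul_sum]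
    congr 1
    · ring
    refine Finset.sum_congr rfl fun i hi => ?_
    have hi' := Finset.mem_Ioo.1 hi
    rw [← hcoef i hi'.2, ← hcoef (p - i) (by omega), ← choose_div_mul_factorial hi]
    push_cast
    ring
  · change ((p - 1).factorial : k) * TruncPoly.coef p (L (x ^ p)) = _
    rw [map_pow, TruncPoly.coef_pow, h1]

/-- A functional whose `p`-th power is 0 kills the image of Verschiebung. As `b` is not a
derivation, the statement has to be proved for all multiples `z * a`; the extra terms contain a
factor `c ^ (p - i)` evaluated on that image, which vanishes too. -/
lemma IsWitt.apply_kerVer {c b : CartierDual k A} (h : IsWitt k p c b) (hcp : c ^ p = 0)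
    (hbp : b ^ p = 0) {a : A} (ha : a ∈ kerVerIdeal k p A) : b a = 0 := by
  have hp := (Fact.out : p.Prime).ne_zero
  have hV : ∀ (φ : CartierDual k A) (y : A), φ ^ p = 0 → φ (verschiebung k p A y) = 0 := by
    intro φ y hφ
    rw [← pow_eq_zero_iff hp, verschiebung_spec, hφ, dual_zero_apply]
  suffices H : ∀ z, b (z * a) = 0 by simpa using H 1
  induction ha using Submodule.span_induction with
  | mem x hx =>
    obtain ⟨y, hy, rfl⟩ := hx
    intro z
    have h0 : Coalgebra.counit (R := k) (verschiebung k p A y) = 0 := by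
      rw [← dual_one_apply, ← pow_eq_zero_iff hp, verschiebung_spec, one_pow, dual_one_apply]
      exact hy
    rw [isWitt_dual_iff.1 h, h0, hV b y hbp, mul_zero, mul_zero, add_zero, zero_add]
    refine Finset.sum_eq_zero fun i hi => ?_
    have hi' := Finset.mem_Ioo.1 hi
    rw [hV (c ^ (p - i)) y (by rw [← pow_mul, mul_comm, pow_mul, hcp, zero_pow (by omega)]),
      mul_zero, mul_zero]
  | zero => simp
  | add x y _ _ hx hy =>
    intro z
    rw [mul_add, map_add, hx, hy, add_zero]
  | smul w x _ hx =>
    intro z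
    rw [smul_eq_mul, ← mul_assoc, hx]

/-- If the `a`-number is maximal then `p ^ 2`-th powers in a self-dual `BT₁` are `p ^ 3`-th
powers. -/
lemma IsBT1.exists_pow_eq (hG : IsBT1 k p A) (ψ : CartierDual k A ≃ₐc[k] A)
    (h : pRank k p A + aNumber k p A = Module.finrank k (primSubmodule k (CartierDual k A)))
    (x : A) : ∃ z, x ^ p ^ 2 = z ^ p ^ 3 := by
  obtain ⟨u, hu, hup, hli, -⟩ := exists_fixed_basis k p A
  -- Under `ψ` the `p`-th power of `v` becomes a combination `∑ c i ^ p • u i` of fixed elements,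
  -- the nilpotent part being killed. With `d i ^ (p ^ 2) = c i` this is the `p ^ 3`-th power of `∑
  -- d i • u i`.
  have hprim : ∀ v : A, IsPrim k v → ∃ w, v ^ p = w ^ p ^ 3 := by
    intro v hv
    obtain ⟨c, hc⟩ := exists_decomposition hu hup hli h
      (hv.map (ψ.symm : A →ₐc[k] CartierDual k A))
    have h1 : ψ.symm v ^ p = ∑ i, c i ^ p • u i := by
      have h2 := add_pow_p k p (ψ.symm v - ∑ i, c i • u i) (∑ i, c i • u i)
      rw [sub_add_cancel] at h2
      rw [h2, fixed_sum_pow hup]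
      exact (congrArg (· + _) hc.2).trans (zero_add _)
    choose d hd using fun i => IsAlgClosed.exists_pow_nat_eq (c i)
      (pow_pos (Fact.out : p.Prime).pos 2)
    have h3 : (∑ i, d i • u i) ^ p ^ 3 = ∑ i, c i ^ p • u i := by
      rw [show p ^ 3 = p * p * p by ring, pow_mul, pow_mul, fixed_sum_pow hup, fixed_sum_pow hup,
        fixed_sum_pow hup]
      refine Finset.sum_congr rfl fun i _ => ?_
      rw [← hd i]
      ring_nf
    refine ⟨ψ (∑ i, d i • u i), ?_⟩
    rw [← map_pow, h3, ← h1, map_pow]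
    exact congrArg (· ^ p) (ψ.toEquiv.apply_symm_apply v).symm
  -- The property is stable under sums, products and scalars, so it passes to the algebra generated
  -- by primitive elements, which contains every `x ^ p`.
  have halg : ∀ y ∈ primAlg k A, ∃ z, y ^ p = z ^ p ^ 3 := by
    intro y hy
    induction hy using primAlg_induction with
    | one => exact ⟨1, by rw [one_pow, one_pow]⟩
    | mul v x hv _ ih =>
      obtain ⟨w, hw⟩ := hprim v hv
      obtain ⟨z, hz⟩ := ih
      exact ⟨z * w, by rw [mul_pow, mul_pow, hw, hz]⟩
    | add x y _ _ hx hy =>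
      obtain ⟨w, hw⟩ := hx
      obtain ⟨z, hz⟩ := hy
      refine ⟨w + z, ?_⟩
      rw [add_pow_p k p, hw, hz, show p ^ 3 = p * p * p by ring]
      simp only [pow_mul, add_pow_p k p]
    | smul c x _ hx =>
      obtain ⟨z, hz⟩ := hx
      obtain ⟨d, rfl⟩ := IsAlgClosed.exists_pow_nat_eq c (pow_pos (Fact.out : p.Prime).pos 2)
      refine ⟨d • z, ?_⟩
      rw [smul_pow, smul_pow, hz, ← pow_mul]
      rfl
  obtain ⟨z, hz⟩ := halg _ (hG.pow_mem_primAlg' ψ x)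
  exact ⟨z, by rw [← hz, ← pow_mul, sq]⟩

/-- If `x ^ (p ^ 2) = z ^ (p ^ 3)`, then `x ^ p - z ^ (p ^ 2)` has `p`-th power 0, so it lies in the
ideal of ker Ver and is killed by `b`. On `p`-th powers `b` is `(p - 1)!` times the `p`-th power of
the value of `c`, and `c` vanishes at `z ^ p`; hence `c x = 0`. -/
lemma IsBT1.eq_zero_of_isWitt (hG : IsBT1 k p A) (ψ : CartierDual k A ≃ₐc[k] A)
    (h : pRank k p A + aNumber k p A = Module.finrank k (primSubmodule k (CartierDual k A)))
    {c b : CartierDual k A} (hc : c ∈ nilPrim k p A) (hb : IsWitt k p c b) (hbp : b ^ p = 0) :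
    c = 0 := by
  have hp := (Fact.out : p.Prime)
  obtain ⟨b', hb', hval⟩ := hG.exists_isWitt hc
  have hval2 : ∀ x, b (x ^ p) = ((p - 1).factorial : k) * c x ^ p := by
    intro x
    have h1 := (hb.sub_isPrim hb')
    have h2 : (b - b') (x ^ p) = 0 := by
      have h3 := counit_primDer h1 (x ^ p)
      rw [primDer_pow, map_zero] at h3
      exact h3.symm
    have h4 : b = (b - b') + b' := (sub_add_cancel b b').symm
    rw [h4, dual_add_apply, h2, zero_add, hval]
  have hfac : ((p - 1).factorial : k) ≠ 0 := by
    rw [Ne, CharP.cast_eq_zero_iff k p, hp.dvd_factorial]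
    have := hp.pos
    omega
  ext x
  obtain ⟨z, hz⟩ := hG.exists_pow_eq ψ h x
  have h1 : (x ^ p - z ^ p ^ 2) ^ p = 0 := by
    have h2 := add_pow_p k p (x ^ p - z ^ p ^ 2) (z ^ p ^ 2)
    rw [sub_add_cancel, ← pow_mul, ← sq, hz, ← pow_mul, ← pow_succ, right_eq_add] at h2
    exact h2
  have h3 := hb.apply_kerVer hc.2 hbp ((hG.kerVer_eq_imFrob _).2 h1)
  have h4 : c (z ^ p) = 0 := by
    have h5 := counit_primDer hc.1 (z ^ p)
    rw [primDer_pow, map_zero] at h5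
    exact h5.symm
  rw [map_sub, hval2, sq, pow_mul, hval2, h4, zero_pow hp.ne_zero, mul_zero, sub_zero,
    mul_eq_zero] at h3
  rw [dual_zero_apply]
  exact (pow_eq_zero_iff hp.ne_zero).1 (h3.resolve_left hfac)

/-- Witt elements can be normalised. -/
lemma IsBT1.exists_isWitt_nilPrim (hG : IsBT1 k p A)
    (h : pRank k p A + aNumber k p A = Module.finrank k (primSubmodule k (CartierDual k A)))
    {c : CartierDual k A} (hc : c ∈ nilPrim k p A) :
    ∃ b : CartierDual k A, IsWitt k p c b ∧ b ^ p ∈ nilPrim k p A := by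
  obtain ⟨u, hu, hup, hli, -⟩ := exists_fixed_basis k p A
  obtain ⟨b, hb, -⟩ := hG.exists_isWitt hc
  -- The fixed part `∑ r i • u i` of the primitive element `b ^ p` is removed by subtracting from
  -- `b` its `p`-th root `∑ d i • u i`, which is primitive.
  obtain ⟨r, hr⟩ := exists_decomposition hu hup hli h (hb.pow_isPrim hc.2)
  choose d hd using fun i => IsAlgClosed.exists_pow_nat_eq (r i) (Fact.out : p.Prime).pos
  have hprim : IsPrim k (-∑ i, d i • u i) :=
    (primSubmodule k (CartierDual k A)).neg_mem
      (Submodule.sum_mem _ fun i _ => (hu i).smul (d i))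
  refine ⟨b + -∑ i, d i • u i, hb.add_prim hprim, ?_⟩
  have h1 : (b + -∑ i, d i • u i) ^ p = b ^ p - ∑ i, r i • u i := by
    have h2 := add_pow_p k p (b + -∑ i, d i • u i) (∑ i, d i • u i)
    rw [neg_add_cancel_right, fixed_sum_pow hup] at h2
    simp only [hd] at h2
    rw [h2, add_sub_cancel_right]
  rw [h1]
  exact hr

/-- The difference `b - b'` is primitive, so its `p`-th power is a combination of fixed elements; it
also lies in `nilPrim`, which meets their span in 0. -/
lemma IsBT1.pow_eq_of_isWitt
    (h : pRank k p A + aNumber k p A = Module.finrank k (primSubmodule k (CartierDual k A)))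
    {c b b' : CartierDual k A} (hb : IsWitt k p c b) (hb' : IsWitt k p c b')
    (hbp : b ^ p ∈ nilPrim k p A) (hbp' : b' ^ p ∈ nilPrim k p A) : b ^ p = b' ^ p := by
  obtain ⟨u, hu, hup, hli, -⟩ := exists_fixed_basis k p A
  obtain ⟨r, hr⟩ := exists_decomposition hu hup hli h (hb.sub_isPrim hb')
  have h1 : (b - b') ^ p = ∑ i, r i ^ p • u i := by
    have h2 := add_pow_p k p (b - b' - ∑ i, r i • u i) (∑ i, r i • u i)
    rw [sub_add_cancel, hr.2, fixed_sum_pow hup, zero_add] at h2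
    exact h2
  have h2 := add_pow_p k p (b - b') b'
  rw [sub_add_cancel] at h2
  have h3 : (∑ i, r i ^ p • u i) ^ p = 0 := by
    rw [← h1, show (b - b') ^ p = b ^ p - b' ^ p by rw [h2, add_sub_cancel_right]]
    exact ((nilPrim k p A).sub_mem hbp hbp').2
  have h4 : ∀ i, r i ^ p = 0 := fixed_sum_eq_zero hup hli h3
  rw [h2, h1]
  simp [h4]

/-- If the `a`-number is maximal, the primitive elements with `p`-th power zero have a basis of
`p`-th powers of Witt elements. -/
theorem IsBT1.exists_witt_basis (hG : IsBT1 k p A) (ψ : CartierDual k A ≃ₐc[k] A)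
    (h : pRank k p A + aNumber k p A = Module.finrank k (primSubmodule k (CartierDual k A))) :
    ∃ b : Fin (aNumber k p A) → CartierDual k A, (∀ j, IsWitt k p (b j ^ p) (b j)) ∧
      (∀ j, b j ^ p ∈ nilPrim k p A) ∧ LinearIndependent k fun j => b j ^ p := by
  have hp := (Fact.out : p.Prime)
  choose β hβ hβp using fun c : nilPrim k p A => hG.exists_isWitt_nilPrim h c.2
  have huniq : ∀ (c : nilPrim k p A) (b : CartierDual k A), IsWitt k p (c : CartierDual k A) b →
      b ^ p ∈ nilPrim k p A → β c ^ p = b ^ p := fun c b hb hbp =>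
    IsBT1.pow_eq_of_isWitt h (hβ c) hb (hβp c) hbp
  let σ : k →+* k := (frobenius k p).comp (frobenius k p)
  have hσ : ∀ x, σ x = x ^ p ^ 2 := fun x => by
    rw [sq, pow_mul]
    rfl
  -- `c` goes to `b ^ p` for a normalised Witt element `b` with first component `c`. Uniqueness of
  -- `b ^ p` gives additivity and semilinearity. A fixed vector satisfies `c = b ^ p`, which is the
  -- defining relation of `I_{1,1}`.
  let Φ : nilPrim k p A →ₛₗ[σ] nilPrim k p A :=
    { toFun := fun c => ⟨β c ^ p, hβp c⟩
      map_add' := fun c c' => by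
        have h1 := (hβ c).add c.2.1 c'.2.1 (hβ c')
        have h2 : (β c + β c' + wittCocycle p (c : CartierDual k A) c') ^ p =
            β c ^ p + β c' ^ p := by
          rw [add_pow_p k p, add_pow_p k p, I11.wittCocycle_pow _ c.2.2, add_zero]
        refine Subtype.ext ((huniq (c + c') _ h1 ?_).trans h2)
        rw [h2]
        exact add_mem (hβp c) (hβp c')
      map_smul' := fun r c => by
        have h1 := (hβ c).smul r
        have h2 : (r ^ p • β c) ^ p = σ r • β c ^ p := by
          rw [smul_pow, hσ, sq, pow_mul]
        refine Subtype.ext ((huniq (r • c) _ h1 ?_).trans h2)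
        rw [h2]
        exact Submodule.smul_mem _ _ (hβp c) }
  have hΦ : Function.Injective Φ := by
    rw [injective_iff_map_eq_zero]
    intro c hc
    exact Subtype.ext (hG.eq_zero_of_isWitt ψ h c.2 (hβ c) (congrArg Subtype.val hc))
  have hspan := span_fixed_eq_top (Nat.one_lt_pow two_ne_zero hp.one_lt) hσ Φ hΦ
  obtain ⟨s, hs1, hs2, hs3⟩ := exists_linearIndependent k {v | Φ v = v}
  rw [hspan] at hs2
  let B := Module.Basis.mk hs3 (by rw [Subtype.range_coe, hs2])
  have : Finite s := hs3.finite_of_isNoetherian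
  have := Fintype.ofFinite s
  have hcard : Fintype.card s = aNumber k p A := by
    rw [← finrank_nilPrim, Module.finrank_eq_card_basis B]
  let e := (Fintype.equivFinOfCardEq hcard).symm
  have hfix : ∀ j, β (e j : nilPrim k p A) ^ p = (e j : nilPrim k p A) := fun j =>
    congrArg Subtype.val (hs1 (e j).2)
  refine ⟨fun j => β (e j : nilPrim k p A), fun j => ?_, fun j => hβp _, ?_⟩
  · rw [hfix]
    exact hβ _
  · simp only [hfix]
    exact (hs3.comp e e.injective).map' (Submodule.subtype _) (Submodule.ker_subtype _)

end WittExistence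

/-! ### Products of group schemes -/

section Tensor

variable {k : Type u} [Field k]

section Maps

variable (k) (B : Type v) [CommRing B] [HopfAlgebra k B] (C : Type w) [CommRing C] [HopfAlgebra k C]

/-- The first projection `b ⊗ c ↦ ε(c) b`. -/
def tensorFst : B ⊗[k] C →ₐc[k] B :=
  (Bialgebra.TensorProduct.rid k k B : B ⊗[k] k →ₐc[k] B).comp
    (Bialgebra.TensorProduct.map (BialgHom.id k B) (Bialgebra.counitBialgHom k C))

/-- The second projection `b ⊗ c ↦ ε(b) c`. -/
def tensorSnd : B ⊗[k] C →ₐc[k] C :=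
  (Bialgebra.TensorProduct.lid k C : k ⊗[k] C →ₐc[k] C).comp
    (Bialgebra.TensorProduct.map (Bialgebra.counitBialgHom k B) (BialgHom.id k C))

/-- The inclusion of the first factor. -/
def tensorInl : B →ₐc[k] B ⊗[k] C :=
  (Bialgebra.TensorProduct.map (BialgHom.id k B) (Bialgebra.unitBialgHom k C)).comp
    ((Bialgebra.TensorProduct.rid k k B).symm : B →ₐc[k] B ⊗[k] k)

/-- The inclusion of the second factor. -/
def tensorInr : C →ₐc[k] B ⊗[k] C :=
  (Bialgebra.TensorProduct.map (Bialgebra.unitBialgHom k B) (BialgHom.id k C)).comp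
    ((Bialgebra.TensorProduct.lid k C).symm : C →ₐc[k] k ⊗[k] C)

variable {k B C}

@[simp] lemma tensorFst_tmul (b : B) (c : C) :
    tensorFst k B C (b ⊗ₜ[k] c) = counit (R := k) c • b := rfl

@[simp] lemma tensorSnd_tmul (b : B) (c : C) :
    tensorSnd k B C (b ⊗ₜ[k] c) = counit (R := k) b • c := rfl

@[simp] lemma tensorInl_apply (b : B) : tensorInl k B C b = b ⊗ₜ[k] 1 := by
  change b ⊗ₜ[k] algebraMap k C 1 = _
  rw [map_one]

@[simp] lemma tensorInr_apply (c : C) : tensorInr k B C c = 1 ⊗ₜ[k] c := by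
  change algebraMap k B 1 ⊗ₜ[k] c = _
  rw [map_one]

/-- A point of a product is the sum of its two components. Both sides are algebra homomorphisms in
`x`, so it is enough to check the two factors. Applied to primitive and group-like elements it gives
their decompositions. -/
lemma map_tensorFst_tensorSnd_comul (x : B ⊗[k] C) :
    TensorProduct.map (tensorFst k B C : B ⊗[k] C →ₗ[k] B) (tensorSnd k B C : B ⊗[k] C →ₗ[k] C)
      (comul x) = x := by
  let Φ : B ⊗[k] C →ₐ[k] B ⊗[k] C := (Algebra.TensorProduct.map (tensorFst k B C : B ⊗[k] C →ₐ[k] B)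
    (tensorSnd k B C : B ⊗[k] C →ₐ[k] C)).comp (Bialgebra.comulAlgHom k (B ⊗[k] C))
  have h : Φ = AlgHom.id k _ := by
    refine Algebra.TensorProduct.ext (AlgHom.ext fun b => ?_) (AlgHom.ext fun c => ?_)
    · change TensorProduct.map (tensorFst k B C : B ⊗[k] C →ₗ[k] B)
        (tensorSnd k B C : B ⊗[k] C →ₗ[k] C) (comul (b ⊗ₜ[k] 1)) = b ⊗ₜ[k] 1
      rw [← tensorInl_apply, ← CoalgHomClass.map_comp_comul_apply]
      have h1 : ∀ w : B ⊗[k] B, TensorProduct.map (tensorFst k B C : B ⊗[k] C →ₗ[k] B)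
          (tensorSnd k B C : B ⊗[k] C →ₗ[k] C) (TensorProduct.map
            (tensorInl k B C : B →ₗ[k] B ⊗[k] C) (tensorInl k B C : B →ₗ[k] B ⊗[k] C) w) =
          tensorInl k B C (TensorProduct.rid k B (LinearMap.lTensor B (counit (R := k)) w)) := by
        intro w
        induction w with
        | zero => simp only [map_zero]
        | add x y hx hy => simp only [map_add, hx, hy]
        | tmul x y => simp [TensorProduct.smul_tmul']
      refine (h1 (comul b)).trans ?_
      rw [lTensor_counit_comul, TensorProduct.rid_tmul, one_smul]
    · change TensorProduct.map (tensorFst k B C : B ⊗[k] C →ₗ[k] B)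
        (tensorSnd k B C : B ⊗[k] C →ₗ[k] C) (comul (1 ⊗ₜ[k] c)) = 1 ⊗ₜ[k] c
      rw [← tensorInr_apply, ← CoalgHomClass.map_comp_comul_apply]
      have h1 : ∀ w : C ⊗[k] C, TensorProduct.map (tensorFst k B C : B ⊗[k] C →ₗ[k] B)
          (tensorSnd k B C : B ⊗[k] C →ₗ[k] C) (TensorProduct.map
            (tensorInr k B C : C →ₗ[k] B ⊗[k] C) (tensorInr k B C : C →ₗ[k] B ⊗[k] C) w) =
          tensorInr k B C (TensorProduct.lid k C (LinearMap.rTensor C (counit (R := k)) w)) := by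
        intro w
        induction w with
        | zero => simp only [map_zero]
        | add x y hx hy => simp only [map_add, hx, hy]
        | tmul x y => simp [TensorProduct.smul_tmul']
      refine (h1 (comul c)).trans ?_
      rw [rTensor_counit_comul, TensorProduct.lid_tmul, one_smul]
  exact DFunLike.congr_fun h x

lemma IsPrim.tensor_eq {v : B ⊗[k] C} (hv : IsPrim k v) :
    v = tensorInl k B C (tensorFst k B C v) + tensorInr k B C (tensorSnd k B C v) := by
  have h := map_tensorFst_tensorSnd_comul v
  rw [hv] at h
  conv_lhs => rw [← h]
  simp

lemma tensor_groupLike_eq {t : B ⊗[k] C} (ht : IsGroupLikeElem k t) :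
    t = tensorInl k B C (tensorFst k B C t) * tensorInr k B C (tensorSnd k B C t) := by
  have h := map_tensorFst_tensorSnd_comul t
  rw [ht.comul_eq_tmul_self] at h
  conv_lhs => rw [← h]
  simp

variable {D : Type*} [CommRing D] [HopfAlgebra k D]

/-- The homomorphism from a tensor product given by homomorphisms from the factors. -/
def tensorLift (f : B →ₐc[k] D) (g : C →ₐc[k] D) : B ⊗[k] C →ₐc[k] D :=
  (Bialgebra.mulBialgHom k D).comp (Bialgebra.TensorProduct.map f g)

@[simp] lemma tensorLift_inl (f : B →ₐc[k] D) (g : C →ₐc[k] D) (b : B) :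
    tensorLift f g (tensorInl k B C b) = f b := by
  rw [tensorInl_apply]
  change f b * g 1 = f b
  rw [map_one, mul_one]

@[simp] lemma tensorLift_inr (f : B →ₐc[k] D) (g : C →ₐc[k] D) (c : C) :
    tensorLift f g (tensorInr k B C c) = g c := by
  rw [tensorInr_apply]
  change f 1 * g c = g c
  rw [map_one, one_mul]

lemma IsPrim.tensorLift_apply (f : B →ₐc[k] D) (g : C →ₐc[k] D) {v : B ⊗[k] C}
    (hv : IsPrim k v) : tensorLift f g v = f (tensorFst k B C v) + g (tensorSnd k B C v) := by
  conv_lhs => rw [hv.tensor_eq]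
  rw [map_add, tensorLift_inl, tensorLift_inr]

lemma tensorLift_groupLike (f : B →ₐc[k] D) (g : C →ₐc[k] D) {t : B ⊗[k] C}
    (ht : IsGroupLikeElem k t) :
    tensorLift f g t = f (tensorFst k B C t) * g (tensorSnd k B C t) := by
  conv_lhs => rw [tensor_groupLike_eq ht]
  rw [map_mul, tensorLift_inl, tensorLift_inr]

lemma tensorSnd_inr (c : C) : tensorSnd k B C (tensorInr k B C c) = c := by simp

lemma tensorSnd_surjective : Function.Surjective (tensorSnd k B C) := fun c => ⟨_, tensorSnd_inr c⟩

lemma tensor_point_ext {R : Type*} [CommRing R] [Algebra k R] {χ χ' : B ⊗[k] C →ₐ[k] R}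
    (h1 : χ.comp (tensorInl k B C : B →ₐ[k] B ⊗[k] C) = χ'.comp (tensorInl k B C : B →ₐ[k] B ⊗[k] C))
    (h2 : χ.comp (tensorInr k B C : C →ₐ[k] B ⊗[k] C) = χ'.comp (tensorInr k B C : C →ₐ[k] B ⊗[k] C)) :
    χ = χ' := by
  refine Algebra.TensorProduct.ext (AlgHom.ext fun b => ?_) (AlgHom.ext fun c => ?_)
  · have h := DFunLike.congr_fun h1 b
    change χ (tensorInl k B C b) = χ' (tensorInl k B C b) at h
    rwa [tensorInl_apply] at h
  · have h := DFunLike.congr_fun h2 c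
    change χ (tensorInr k B C c) = χ' (tensorInr k B C c) at h
    rwa [tensorInr_apply] at h

variable [Coalgebra.IsCocomm k B] [Coalgebra.IsCocomm k C] [Module.Finite k B] [Module.Finite k C]

lemma IsPrim.dual_tensor_eq {v : CartierDual k (B ⊗[k] C)} (hv : IsPrim k v) :
    v = dualMap (tensorFst k B C) (dualMap (tensorInl k B C) v) +
      dualMap (tensorSnd k B C) (dualMap (tensorInr k B C) v) := by
  ext x
  induction x with
  | zero => simp only [map_zero]
  | add x y hx hy => simp only [map_add, hx, hy]
  | tmul b c =>
    have h1 : b ⊗ₜ[k] c = (b ⊗ₜ[k] (1 : C)) * ((1 : B) ⊗ₜ[k] c) := by simp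
    have h2 : Coalgebra.counit (R := k) (b ⊗ₜ[k] (1 : C)) = Coalgebra.counit (R := k) b := by simp
    have h3 : Coalgebra.counit (R := k) ((1 : B) ⊗ₜ[k] c) = Coalgebra.counit (R := k) c := by simp
    rw [dual_add_apply, dualMap_apply, dualMap_apply, dualMap_apply, dualMap_apply,
      tensorFst_tmul, tensorSnd_tmul, map_smul, map_smul, map_smul, map_smul, tensorInl_apply,
      tensorInr_apply, h1, isPrim_dual_iff.1 hv, h2, h3, smul_eq_mul, smul_eq_mul]
    ring

lemma finrank_prim_dual_tensor :
    Module.finrank k (primSubmodule k (CartierDual k B)) +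
      Module.finrank k (primSubmodule k (CartierDual k C)) ≤
    Module.finrank k (primSubmodule k (CartierDual k (B ⊗[k] C))) := by
  let L : primSubmodule k (CartierDual k B) × primSubmodule k (CartierDual k C) →ₗ[k]
      primSubmodule k (CartierDual k (B ⊗[k] C)) :=
    { toFun := fun x => ⟨dualMap (tensorFst k B C) (x.1 : CartierDual k B) +
          dualMap (tensorSnd k B C) (x.2 : CartierDual k C),
        (x.1.2.map (dualMap (tensorFst k B C))).add (x.2.2.map (dualMap (tensorSnd k B C)))⟩
      map_add' := fun x y => Subtype.ext (by simp; abel)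
      map_smul' := fun c x => Subtype.ext (by simp) }
  have hL : ∀ x, (L x : CartierDual k (B ⊗[k] C)) = dualMap (tensorFst k B C) (x.1 : CartierDual k B) +
          dualMap (tensorSnd k B C) (x.2 : CartierDual k C) := fun _ => rfl
  have hinj : Function.Injective L := by
    rw [← LinearMap.ker_eq_bot, LinearMap.ker_eq_bot']
    rintro ⟨v, w⟩ h
    have h1 : ∀ x, dualMap (tensorFst k B C) (v : CartierDual k B) x +
        dualMap (tensorSnd k B C) (w : CartierDual k C) x = 0 := fun x => by
      rw [← dual_add_apply, ← hL (v, w), h]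
      rfl
    have hv : v = 0 := by
      refine Subtype.ext (CartierDual.ext fun b => ?_)
      have h2 := h1 (b ⊗ₜ[k] 1)
      rw [dualMap_apply, dualMap_apply, tensorFst_tmul, tensorSnd_tmul, map_smul, map_smul,
        w.2.apply_one] at h2
      simpa using h2
    have hw : w = 0 := by
      refine Subtype.ext (CartierDual.ext fun c => ?_)
      have h2 := h1 (1 ⊗ₜ[k] c)
      rw [dualMap_apply, dualMap_apply, tensorFst_tmul, tensorSnd_tmul, map_smul, map_smul,
        v.2.apply_one] at h2
      simpa using h2
    rw [hv, hw]
    rfl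
  have h := LinearMap.finrank_le_finrank_of_injective hinj
  rwa [Module.finrank_prod] at h

end Maps

end Tensor

/-! ### Powers of a group scheme -/

section GroupPow

variable {k : Type u} [Field k] (B : CommHopfAlgCat.{u} k)

namespace groupPow

instance isCocomm [Coalgebra.IsCocomm k B] : ∀ n, Coalgebra.IsCocomm k (groupPow B n)
  | 0 => inferInstanceAs (Coalgebra.IsCocomm k k)
  | n + 1 => by
    have := isCocomm n
    exact inferInstanceAs (Coalgebra.IsCocomm k (B ⊗[k] groupPow B n))

instance finite [Module.Finite k B] : ∀ n, Module.Finite k (groupPow B n)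
  | 0 => inferInstanceAs (Module.Finite k k)
  | n + 1 => by
    have := finite n
    exact inferInstanceAs (Module.Finite k (B ⊗[k] groupPow B n))

lemma finrank_eq [Module.Finite k B] :
    ∀ n, Module.finrank k (groupPow B n) = Module.finrank k B ^ n
  | 0 => by rw [pow_zero]; exact Module.finrank_self k
  | n + 1 => by
    rw [pow_succ', ← finrank_eq n]
    exact Module.finrank_tensorProduct

variable {B}

/-- The projection to the first factor. -/
def fst (n : ℕ) : groupPow B (n + 1) →ₐc[k] B := tensorFst k B (groupPow B n)

/-- The projection to the remaining factors. -/
def snd (n : ℕ) : groupPow B (n + 1) →ₐc[k] groupPow B n := tensorSnd k B (groupPow B n)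

/-- The inclusion of the first factor. -/
def inl (n : ℕ) : B →ₐc[k] groupPow B (n + 1) := tensorInl k B (groupPow B n)

/-- The inclusion of the remaining factors. -/
def inr (n : ℕ) : groupPow B n →ₐc[k] groupPow B (n + 1) := tensorInr k B (groupPow B n)

lemma prim_eq_zero {v : groupPow B 0} (hv : IsPrim k v) : v = 0 := hv.counit

lemma groupLike_eq_one_zero {t : groupPow B 0} (ht : IsGroupLikeElem k t) : t = 1 :=
  ht.counit_eq_one

lemma prim_eq {n : ℕ} {v : groupPow B (n + 1)} (hv : IsPrim k v) :
    v = inl n (fst n v) + inr n (snd n v) :=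
  IsPrim.tensor_eq (B := B) (C := groupPow B n) hv

lemma groupLike_eq {n : ℕ} {t : groupPow B (n + 1)} (ht : IsGroupLikeElem k t) :
    t = inl n (fst n t) * inr n (snd n t) :=
  tensor_groupLike_eq (B := B) (C := groupPow B n) ht

lemma alg_ext {n : ℕ} {χ χ' : groupPow B (n + 1) →ₐ[k] k}
    (h1 : χ.comp ((inl n : B →ₐc[k] groupPow B (n + 1)) : B →ₐ[k] groupPow B (n + 1)) = χ'.comp ((inl n : B →ₐc[k] groupPow B (n + 1)) : B →ₐ[k] groupPow B (n + 1)))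
    (h2 : χ.comp ((inr n : groupPow B n →ₐc[k] groupPow B (n + 1)) : groupPow B n →ₐ[k] groupPow B (n + 1)) =
      χ'.comp ((inr n : groupPow B n →ₐc[k] groupPow B (n + 1)) : groupPow B n →ₐ[k] groupPow B (n + 1))) : χ = χ' :=
  tensor_point_ext (B := B) (C := groupPow B n) h1 h2

section powHom

variable {D : Type w} [CommRing D] [HopfAlgebra k D]

/-- The homomorphism from a power given by homomorphisms from the factors. -/
def powHom : ∀ {n : ℕ} (_ : Fin n → (B →ₐc[k] D)), groupPow B n →ₐc[k] D
  | 0, _ => Bialgebra.unitBialgHom k D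
  | n + 1, F => tensorLift (C := groupPow B n) (F 0) (powHom (Fin.tail F))

lemma powHom_prim {n : ℕ} (F : Fin (n + 1) → (B →ₐc[k] D)) {v : groupPow B (n + 1)}
    (hv : IsPrim k v) : powHom F v = F 0 (fst n v) + powHom (Fin.tail F) (snd n v) :=
  IsPrim.tensorLift_apply (B := B) (C := groupPow B n) _ _ hv

lemma powHom_groupLike {n : ℕ} (F : Fin (n + 1) → (B →ₐc[k] D)) {t : groupPow B (n + 1)}
    (ht : IsGroupLikeElem k t) : powHom F t = F 0 (fst n t) * powHom (Fin.tail F) (snd n t) :=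
  tensorLift_groupLike (B := B) (C := groupPow B n) _ _ ht

/-- The components `w` are chosen once, before the homomorphisms `F`, so that information on the
primitive elements of `B` can be fed in afterwards. -/
lemma exists_powHom_prim : ∀ {n : ℕ} {v : groupPow B n}, IsPrim k v →
    ∃ w : Fin n → B, (∀ i, IsPrim k (w i)) ∧
      (∀ F : Fin n → (B →ₐc[k] D), powHom F v = ∑ i, F i (w i)) ∧ ((∀ i, w i = 0) → v = 0)
  | 0, v, hv => by
    have h0 : v = 0 := prim_eq_zero hv
    exact ⟨fun i => i.elim0, fun i => i.elim0, fun F => by rw [h0, map_zero]; simp, fun _ => h0⟩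
  | n + 1, v, hv => by
    obtain ⟨w, hw, hF, h0⟩ := exists_powHom_prim (hv.map (snd n))
    refine ⟨Fin.cons (fst n v) w, ?_, fun F => ?_, fun h => ?_⟩
    · exact Fin.cases (hv.map (fst n)) hw
    · rw [Fin.sum_univ_succ, powHom_prim F hv, hF]
      rfl
    · rw [prim_eq hv, h0 fun i => h i.succ, show fst n v = 0 from h 0, map_zero, map_zero,
        add_zero]

lemma exists_powHom_groupLike : ∀ {n : ℕ} {t : groupPow B n}, IsGroupLikeElem k t →
    ∃ s : Fin n → B, (∀ i, IsGroupLikeElem k (s i)) ∧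
      (∀ F : Fin n → (B →ₐc[k] D), powHom F t = ∏ i, F i (s i)) ∧ ((∀ i, s i = 1) → t = 1)
  | 0, t, ht => by
    have h0 : t = 1 := groupLike_eq_one_zero ht
    exact ⟨fun i => i.elim0, fun i => i.elim0, fun F => by rw [h0, map_one]; simp, fun _ => h0⟩
  | n + 1, t, ht => by
    obtain ⟨s, hs, hF, h1⟩ := exists_powHom_groupLike (ht.map (snd n))
    refine ⟨Fin.cons (fst n t) s, ?_, fun F => ?_, fun h => ?_⟩
    · exact Fin.cases (ht.map (fst n)) hs
    · rw [Fin.prod_univ_succ, powHom_groupLike F ht, hF]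
      rfl
    · rw [groupLike_eq ht, h1 fun i => h i.succ, show fst n t = 1 from h 0, map_one, map_one,
        mul_one]

end powHom

variable (p : ℕ) [Fact p.Prime] [CharP k p]

lemma prim_pow_eq_zero (h : ∀ w : B, IsPrim k w → w ^ p = 0) :
    ∀ {n : ℕ} {v : groupPow B n}, IsPrim k v → v ^ p = 0
  | 0, v, hv => by
    rw [prim_eq_zero hv, zero_pow (Fact.out : p.Prime).ne_zero]
  | n + 1, v, hv => by
    rw [prim_eq hv, add_pow_p k p, ← map_pow (inl n), ← map_pow (inr n), h _ (hv.map (fst n)),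
      prim_pow_eq_zero h (hv.map (snd n)), map_zero, map_zero, add_zero]

lemma groupLike_eq_one (h : ∀ s : B, IsGroupLikeElem k s → s = 1) :
    ∀ {n : ℕ} {t : groupPow B n}, IsGroupLikeElem k t → t = 1
  | 0, t, ht => groupLike_eq_one_zero ht
  | n + 1, t, ht => by
    rw [groupLike_eq ht, h _ (ht.map (fst n)), groupLike_eq_one h (ht.map (snd n)), map_one,
      map_one, mul_one]

lemma point_eq (h : ∀ χ : B →ₐ[k] k, χ = Bialgebra.counitAlgHom k B) :
    ∀ {n : ℕ} (χ : groupPow B n →ₐ[k] k), χ = Bialgebra.counitAlgHom k (groupPow B n)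
  | 0, χ => by
    refine AlgHom.ext fun c => ?_
    exact (χ.commutes c).trans (AlgHom.commutes (Bialgebra.counitAlgHom k k) c).symm
  | n + 1, χ => by
    refine alg_ext ?_ ?_
    · rw [h (AlgHom.comp χ _)]
      exact (h _).symm
    · rw [point_eq h (AlgHom.comp χ _)]
      exact (point_eq h _).symm

variable [Coalgebra.IsCocomm k B] [Module.Finite k B]

lemma dual_prim_eq_zero {v : CartierDual k (groupPow B 0)} (hv : IsPrim k v) : v = 0 := by
  refine CartierDual.ext fun c => ?_
  have h : ∀ (w : k →ₗ[k] k) (c : k), w c = c * w 1 := fun w c => by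
    rw [← smul_eq_mul, ← map_smul, smul_eq_mul, mul_one]
  refine (h (CartierDual.equivDual k _ v) c).trans ?_
  refine (congrArg (c * ·) hv.apply_one).trans ?_
  exact mul_zero (c : k)

lemma dual_prim_eq {n : ℕ} {v : CartierDual k (groupPow B (n + 1))} (hv : IsPrim k v) :
    v = dualMap (fst n) (dualMap (inl n) v) + dualMap (snd n) (dualMap (inr n) v) :=
  IsPrim.dual_tensor_eq (B := B) (C := groupPow B n) hv

lemma prim_dual_pow_eq_zero (h : ∀ w : CartierDual k B, IsPrim k w → w ^ p = 0) :
    ∀ {n : ℕ} {v : CartierDual k (groupPow B n)}, IsPrim k v → v ^ p = 0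
  | 0, v, hv => by
    rw [dual_prim_eq_zero hv, zero_pow (Fact.out : p.Prime).ne_zero]
  | n + 1, v, hv => by
    rw [dual_prim_eq hv, add_pow_p k p, ← map_pow (dualMap (fst n)), ← map_pow (dualMap (snd n)), h _ (hv.map (dualMap (inl n))),
      prim_dual_pow_eq_zero h (hv.map (dualMap (inr n))), map_zero, map_zero, add_zero]

lemma mul_finrank_prim_dual_le : ∀ n : ℕ,
    n * Module.finrank k (primSubmodule k (CartierDual k B)) ≤
      Module.finrank k (primSubmodule k (CartierDual k (groupPow B n)))
  | 0 => by rw [zero_mul]; exact Nat.zero_le _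
  | n + 1 => by
    have h := finrank_prim_dual_tensor (k := k) (B := B) (C := groupPow B n)
    have h1 := mul_finrank_prim_dual_le n
    rw [add_mul, one_mul, add_comm]
    exact (Nat.add_le_add_left h1 _).trans h

end groupPow

end GroupPow

/-! ### Primitive and group-like elements of the standard group schemes -/

section Classification

section Generic

variable {k : Type u} [Field k] {B : Type v} [CommRing B] [HopfAlgebra k B] {C : Type w}
  [CommRing C] [HopfAlgebra k C]

lemma isPrim_of_map {f : B →ₐc[k] C} (hf : Function.Injective f) {b : B} (h : IsPrim k (f b)) :
    IsPrim k b := by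
  have hinj : Function.Injective (TensorProduct.map (f : B →ₗ[k] C) (f : B →ₗ[k] C)) :=
    TensorProduct.map_injective_of_flat_flat _ _ hf hf
  refine hinj ?_
  rw [CoalgHomClass.map_comp_comul_apply, h]
  simp

lemma isGroupLike_of_map {f : B →ₐc[k] C} (hf : Function.Injective f) {b : B}
    (h : IsGroupLikeElem k (f b)) : IsGroupLikeElem k b where
  counit_eq_one := by rw [← CoalgHomClass.counit_comp_apply f, h.counit_eq_one]
  comul_eq_tmul_self := by
    have hinj : Function.Injective (TensorProduct.map (f : B →ₗ[k] C) (f : B →ₗ[k] C)) :=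
      TensorProduct.map_injective_of_flat_flat _ _ hf hf
    refine hinj ?_
    rw [CoalgHomClass.map_comp_comul_apply, h.comul_eq_tmul_self]
    simp

variable [Coalgebra.IsCocomm k B] [Module.Finite k B]

/-- Evaluation at a group-like element as a point of the dual. -/
def groupLikePoint {b : B} (h : IsGroupLikeElem k b) : CartierDual k B →ₐ[k] k :=
  AlgHom.ofLinearMap (Module.Dual.eval k B b ∘ₗ (CartierDual.equivDual k B).toLinearMap)
    h.counit_eq_one (isGroupLike_iff.1 h).2

@[simp] lemma groupLikePoint_apply {b : B} (h : IsGroupLikeElem k b) (φ : CartierDual k B) :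
    groupLikePoint h φ = φ b := rfl

end Generic

variable {k : Type u} [Field k] {p : ℕ} [Fact p.Prime] [CharP k p]

namespace MuP

/-- The coefficient functional `e` at a group element is idempotent in the dual, so primitivity
gives `e v = 2 * e v` at the identity and `e v = 0` elsewhere. -/
lemma prim_eq_zero {v : MuP k p} (hv : IsPrim k v) : v = 0 := by
  have hc : ∀ g, v.coeff g = 0 := by
    intro g
    let e : ConstZp k p := (CartierDual.equivDual k (MuP k p)).symm
      (Finsupp.lapply g ∘ₗ (MonoidAlgebra.coeffLinearEquiv k).toLinearMap)
    have he : ∀ x : MuP k p, e x = x.coeff g := fun _ => rfl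
    have hidem : e * e = e := ConstZp.ext_single fun h => by
      rw [ConstZp.mul_single, he, MonoidAlgebra.coeff_single, Finsupp.single_apply]
      split_ifs <;> simp
    have h := isPrim_iff.1 hv e e
    rw [hidem, he, he, MonoidAlgebra.one_def, MonoidAlgebra.coeff_single,
      Finsupp.single_apply] at h
    split_ifs at h
    · simpa using h
    · simpa using h
  exact MonoidAlgebra.coeff_injective (Finsupp.ext hc)

/-- The homomorphism from the coordinate ring of `μ_p` given by a group-like element. -/
def liftGroupLike {B : Type v} [CommRing B] [Bialgebra k B] (g : B) (hg : IsGroupLikeElem k g)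
    (hgp : g ^ p = 1) : MuP k p →ₐc[k] B :=
  BialgHom.ofAlgHom
    (MonoidAlgebra.lift k B (Multiplicative (ZMod p))
      { toFun := fun n => g ^ (Multiplicative.toAdd n).val
        map_one' := by simp
        map_mul' := fun m n => by
          rw [toAdd_mul, ZMod.val_add, ← pow_eq_pow_mod _ hgp, pow_add] })
    (by ext; simp [hg.pow])
    (by ext; simp [(hg.pow).comul_eq_tmul_self])

lemma liftGroupLike_single {B : Type v} [CommRing B] [Bialgebra k B] (g : B)
    (hg : IsGroupLikeElem k g) (hgp : g ^ p = 1) (n : Multiplicative (ZMod p)) :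
    liftGroupLike g hg hgp (MonoidAlgebra.single n 1) = g ^ (Multiplicative.toAdd n).val := by
  refine (MonoidAlgebra.lift_single _ _ _).trans ?_
  simp

end MuP

namespace ConstZp

lemma prim_eq {w : ConstZp k p} (hw : IsPrim k w) : ∃ c : k, w = c • delta k p := by
  have hadd : ∀ n : ℕ, w (MonoidAlgebra.single (Multiplicative.ofAdd (n : ZMod p)) 1) =
      n * w (MonoidAlgebra.single (Multiplicative.ofAdd 1) 1) := by
    intro n
    induction n with
    | zero =>
      rw [Nat.cast_zero, ofAdd_zero, ← MonoidAlgebra.one_def, hw.apply_one, Nat.cast_zero, zero_mul]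
    | succ n ih =>
      have h1 : (MonoidAlgebra.single (Multiplicative.ofAdd ((n + 1 : ℕ) : ZMod p)) 1 : MuP k p) =
          MonoidAlgebra.single (Multiplicative.ofAdd (n : ZMod p)) 1 *
            MonoidAlgebra.single (Multiplicative.ofAdd 1) 1 := by
        rw [MonoidAlgebra.single_mul_single, one_mul, Nat.cast_succ, ofAdd_add]
      rw [h1, isPrim_dual_iff.1 hw, ih, (MonoidAlgebra.isGroupLikeElem_single_one _).counit_eq_one,
        (MonoidAlgebra.isGroupLikeElem_single_one _).counit_eq_one]
      push_cast
      ring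
  refine ⟨w (MonoidAlgebra.single (Multiplicative.ofAdd 1) 1), ext_single fun g => ?_⟩
  obtain ⟨n, hn⟩ := ZMod.natCast_zmod_surjective (Multiplicative.toAdd g)
  have hg : g = Multiplicative.ofAdd (n : ZMod p) := by rw [hn, ofAdd_toAdd]
  rw [hg, hadd, dual_smul_apply, delta_single, toAdd_ofAdd, map_natCast, mul_comm]

/-- The values of `t` at the elements of `ℤ/p` are `p`-th roots of unity, which are trivial in
characteristic `p`. -/
lemma groupLike_eq_one {t : ConstZp k p} (ht : IsGroupLikeElem k t) : t = 1 := by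
  refine ext_single fun g => ?_
  rw [one_single]
  have h1 : (MonoidAlgebra.single g 1 : MuP k p) ^ p = 1 := by
    rw [MonoidAlgebra.single_pow, one_pow, MonoidAlgebra.one_def]
    congr 1
    apply Multiplicative.toAdd.injective
    simp
  have h2 : (pointOf ht (MonoidAlgebra.single g 1)) ^ p = 1 := by rw [← map_pow, h1, map_one]
  rw [pointOf_apply] at h2
  have h3 : (t (MonoidAlgebra.single g 1) - 1) ^ p = 0 := by
    rw [sub_pow_char, h2, one_pow, sub_self]
  exact sub_eq_zero.1 (pow_eq_zero_iff (Fact.out : p.Prime).ne_zero |>.1 h3)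

end ConstZp

namespace AlphaP

lemma prim_eq {y : AlphaP k p} (hy : IsPrim k y) : ∃ c : k, y = c • gen k p := by
  let e := liftPrim (dualGen k p) isPrim_dualGen dualGen_pow
  refine ⟨e y (gen k p), liftPrim_dualGen_bijective.1 ?_⟩
  refine prim_ext (hy.map e) ((isPrim_gen.smul _).map e) ?_
  rw [map_smul, dual_smul_apply, liftPrim_gen, dualGen_gen, mul_one]

lemma groupLike_eq_one {t : AlphaP k p} (ht : IsGroupLikeElem k t) : t = 1 := by
  have h : groupLikePoint ht = groupLikePoint (IsGroupLikeElem.one) := by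
    refine dual_algHom_ext ?_
    rw [groupLikePoint_apply _ (dualGen k p), groupLikePoint_apply _ (dualGen k p),
      isPrim_dualGen.apply_one]
    have h1 : (groupLikePoint ht (dualGen k p)) ^ p = 0 := by rw [← map_pow, dualGen_pow, map_zero]
    exact pow_eq_zero_iff (Fact.out : p.Prime).ne_zero |>.1 h1
  exact dual_sep' k fun φ => DFunLike.congr_fun h φ

end AlphaP

end Classification

/-! ### Primitive and group-like elements of `O(I_{1,1})` and primitive elements of its dual. -/

section I11Prim

variable {k : Type u} [Field k] {p : ℕ} [Fact p.Prime] [CharP k p]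

namespace I11

instance : Module.Finite k (I11 k p) := inferInstanceAs (Module.Finite k (TruncPoly k (p ^ 2)))

lemma finrank_eq : Module.finrank k (I11 k p) = p ^ 2 := TruncPoly.finrank_eq

lemma _root_.BT1.TruncPoly.mk_eq_aeval (n : ℕ) (f : k[X]) :
    TruncPoly.mk k n f = Polynomial.aeval (TruncPoly.gen k n) f :=
  DFunLike.congr_fun (Polynomial.algHom_ext (f := TruncPoly.mk k n)
    (g := Polynomial.aeval (TruncPoly.gen k n)) (by rw [Polynomial.aeval_X, TruncPoly.mk_X])) f

lemma exists_aeval_eq (y : I11 k p) : ∃ f : k[X], Polynomial.aeval (gen k p) f = y := by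
  obtain ⟨f, hf⟩ := TruncPoly.mk_surjective y
  exact ⟨f, (TruncPoly.mk_eq_aeval _ f).symm.trans hf⟩

lemma aeval_eq_zero {f : k[X]} :
    Polynomial.aeval (gen k p) f = 0 ↔ ∀ i < p ^ 2, f.coeff i = 0 := by
  rw [← TruncPoly.mk_eq_zero, TruncPoly.mk_eq_aeval]
  rfl

lemma one_lt_sq : 1 < p ^ 2 := Nat.one_lt_pow two_ne_zero (Fact.out : p.Prime).one_lt

lemma counit_eq_coef (y : I11 k p) :
    counit (R := k) y = TruncPoly.coef (k := k) (n := p ^ 2) 0 y := by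
  have hp := (one_lt_sq (p := p)).le
  let f : I11 k p →ₐ[k] k := AlgHom.ofLinearMap (TruncPoly.coef (k := k) (n := p ^ 2) 0)
    (by
      have h := TruncPoly.coef_one (k := k) hp
      rwa [if_pos rfl] at h) (TruncPoly.coef_zero_mul hp)
  have h : Bialgebra.counitAlgHom k (I11 k p) = f := hom_ext (by
    have h1 := TruncPoly.coef_gen_pow (k := k) hp 1
    rw [pow_one, if_neg zero_ne_one] at h1
    exact counit_gen.trans h1.symm)
  exact DFunLike.congr_fun h y

variable (k p) in
/-- The functional `x ^ i ↦ δ_{in}`. -/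
def dualCoef (n : ℕ) : CartierDual k (I11 k p) :=
  (CartierDual.equivDual k (I11 k p)).symm (TruncPoly.coef (k := k) (n := p ^ 2) n)

lemma dualCoef_gen_pow {n : ℕ} (hn : n < p ^ 2) (j : ℕ) :
    dualCoef k p n (gen k p ^ j) = if n = j then 1 else 0 := TruncPoly.coef_gen_pow hn j

lemma isPrim_dualCoef : IsPrim k (dualCoef k p 1) := by
  rw [isPrim_dual_iff]
  intro a b
  rw [counit_eq_coef, counit_eq_coef]
  refine (TruncPoly.coef_mul one_lt_sq a b).trans ?_
  rw [Finset.Nat.antidiagonal_succ]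
  refine Eq.trans (b := _ + _) (by simp; rfl) (add_comm _ _)

lemma dualCoef_gen : dualCoef k p 1 (gen k p) = 1 := by
  have h := dualCoef_gen_pow (k := k) (p := p) one_lt_sq 1
  rwa [pow_one, if_pos rfl] at h

/-- A primitive functional is determined by its value at the generator. -/
lemma prim_dual_eq_zero {v : CartierDual k (I11 k p)} (hv : IsPrim k v) (h : v (gen k p) = 0) :
    v = 0 := by
  ext y
  obtain ⟨f, rfl⟩ := exists_aeval_eq y
  rw [dual_zero_apply]
  induction f using Polynomial.induction_on' with
  | add f g hf hg => rw [map_add, map_add, hf, hg, add_zero]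
  | monomial i c =>
    rw [Polynomial.aeval_monomial, ← Algebra.smul_def, map_smul]
    match i with
    | 0 => rw [pow_zero, hv.apply_one, smul_zero]
    | 1 => rw [pow_one, h, smul_zero]
    | i + 2 => rw [hv.apply_pow_succ counit_gen, smul_zero]

lemma dualPairing_comul_gen (φ χ : CartierDual k (I11 k p)) :
    (φ * χ) (gen k p) = φ (gen k p) * χ 1 + φ 1 * χ (gen k p) +
      ∑ i ∈ Finset.Ioo 0 p, ((p.choose i / p : ℕ) : k) *
        (φ ((gen k p ^ p) ^ i) * χ ((gen k p ^ p) ^ (p - i))) := by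
  rw [dual_mul_eq, comul_gen, comulGen, map_add, map_add, dualPairing_tmul, dualPairing_tmul,
    wittCocycle, map_sum]
  congr 1
  refine Finset.sum_congr rfl fun i _ => ?_
  rw [Algebra.TensorProduct.tmul_pow, Algebra.TensorProduct.tmul_pow,
    Algebra.TensorProduct.tmul_mul_tmul, one_pow, one_pow, one_mul, mul_one,
    ← map_natCast (algebraMap k _), ← Algebra.smul_def, map_smul, dualPairing_tmul, smul_eq_mul]

/-- Invariant derivations are multiples of `d/dx`: in the cocycle part of `Δ x` the functional `v`
is applied to powers of `x` with exponent at least 2, where a derivation at the origin vanishes. -/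
lemma primDer_gen {v : CartierDual k (I11 k p)} (hv : IsPrim k v) :
    primDer v hv (gen k p) = algebraMap k _ (v (gen k p)) := by
  have hp := (Fact.out : p.Prime).two_le
  refine dual_sep' k fun φ => ?_
  rw [apply_primDer, dualPairing_comul_gen, hv.apply_one, Finset.sum_eq_zero, mul_zero, zero_add,
    add_zero, Algebra.algebraMap_eq_smul_one, map_smul, smul_eq_mul, mul_comm]
  intro i hi
  rw [Finset.mem_Ioo] at hi
  obtain ⟨m, hm⟩ : ∃ m, p * (p - i) = m + 2 := ⟨p * (p - i) - 2, by
    have : p * 1 ≤ p * (p - i) := Nat.mul_le_mul_left p (by omega)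
    omega⟩
  rw [← pow_mul _ p (p - i), hm, hv.apply_pow_succ counit_gen, mul_zero, mul_zero]

lemma prim_dual_pow_eq_zero {v : CartierDual k (I11 k p)} (hv : IsPrim k v) : v ^ p = 0 := by
  refine prim_dual_eq_zero (hv.pow_p p) ?_
  obtain ⟨m, hm⟩ : ∃ m, p = (m + 1) + 1 := ⟨p - 2, by
    have := (Fact.out : p.Prime).two_le
    omega⟩
  have h1 : (v ^ (m + 1)) 1 = 0 := by rw [pow_succ]; exact prim_mul_apply_one hv _
  have h2 : (v ^ ((m + 1) + 1)) (gen k p) = 0 := by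
    rw [pow_succ, ← apply_primDer hv, primDer_gen, Algebra.algebraMap_eq_smul_one, map_smul, h1,
      smul_zero]
  rwa [← hm] at h2

lemma finrank_prim_dual_pos : 1 ≤ Module.finrank k (primSubmodule k (CartierDual k (I11 k p))) := by
  have : Nontrivial (primSubmodule k (CartierDual k (I11 k p))) := by
    refine ⟨⟨dualCoef k p 1, isPrim_dualCoef⟩, 0, fun h => ?_⟩
    have h1 : dualCoef k p 1 = 0 := congrArg Subtype.val h
    have h2 := dualCoef_gen (k := k) (p := p)
    rw [h1, dual_zero_apply] at h2
    exact zero_ne_one h2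
  exact Module.finrank_pos

lemma point_eq (χ : I11 k p →ₐ[k] k) : χ = Bialgebra.counitAlgHom k (I11 k p) := by
  have hp := (Fact.out : p.Prime).ne_zero
  refine hom_ext ?_
  have h : (χ (gen k p) ^ p) ^ p = 0 := by rw [← map_pow, ← map_pow, gen_pow, map_zero]
  rw [pow_eq_zero_iff hp, pow_eq_zero_iff hp] at h
  exact h.trans counit_gen.symm

lemma isPrim_gen_pow : IsPrim k (gen k p ^ p) := by
  change comul (R := k) (gen k p ^ p) = _
  rw [Bialgebra.comul_pow, comul_gen, comulGen_pow]

variable (k p) in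
/-- The quotient `I_{1,1} → α_p`. -/
def ofAlphaP : AlphaP k p →ₐc[k] I11 k p := AlphaP.liftPrim (gen k p ^ p) isPrim_gen_pow (gen_pow k p)

lemma ofAlphaP_gen : ofAlphaP k p (AlphaP.gen k p) = gen k p ^ p :=
  AlphaP.liftPrim_gen _ isPrim_gen_pow (gen_pow k p)

lemma ofAlphaP_mk (f : k[X]) : ofAlphaP k p (TruncPoly.mk k p f) =
    Polynomial.aeval (gen k p) (Polynomial.expand k p f) := by
  rw [Polynomial.expand_aeval, ← ofAlphaP_gen]
  refine (congrArg (ofAlphaP k p) (TruncPoly.mk_eq_aeval p f)).trans ?_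
  exact (Polynomial.aeval_algHom_apply (ofAlphaP k p : AlphaP k p →ₐ[k] I11 k p)
    (AlphaP.gen k p) f).symm

lemma ofAlphaP_injective : Function.Injective (ofAlphaP k p) := by
  have hp := (Fact.out : p.Prime).pos
  rw [injective_iff_map_eq_zero]
  intro y hy
  obtain ⟨f, rfl⟩ := TruncPoly.mk_surjective y
  rw [ofAlphaP_mk, aeval_eq_zero] at hy
  refine TruncPoly.mk_eq_zero.2 fun i hi => ?_
  have h := hy (i * p) (by rw [sq]; exact Nat.mul_lt_mul_of_pos_right hi hp)
  rwa [Polynomial.coeff_expand_mul hp] at h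

/-- A polynomial in `x` whose derivative vanishes is a polynomial in `x ^ p`. -/
lemma mem_range_ofAlphaP {y : I11 k p} (h : primDer (dualCoef k p 1) isPrim_dualCoef y = 0) :
    ∃ z, ofAlphaP k p z = y := by
  have hp := (Fact.out : p.Prime).pos
  obtain ⟨f, rfl⟩ := exists_aeval_eq y
  rw [Derivation.map_aeval, primDer_gen, dualCoef_gen, map_one, smul_eq_mul, mul_one,
    aeval_eq_zero] at h
  refine ⟨TruncPoly.mk k p (Polynomial.contract p f), ?_⟩
  rw [ofAlphaP_mk, ← sub_eq_zero, ← map_sub, aeval_eq_zero]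
  intro i hi
  rw [Polynomial.coeff_sub, Polynomial.coeff_expand hp]
  split_ifs with hd
  · rw [Polynomial.coeff_contract (Fact.out : p.Prime).ne_zero, Nat.div_mul_cancel hd, sub_self]
  · obtain ⟨j, rfl⟩ : ∃ j, i = j + 1 := ⟨i - 1, by
      have : i ≠ 0 := fun h0 => hd (h0 ▸ dvd_zero p)
      omega⟩
    have h1 := h j (by omega)
    rw [Polynomial.coeff_derivative, mul_eq_zero] at h1
    have h2 : ((j : k) + 1) ≠ 0 := by
      rw [← Nat.cast_succ, Ne, CharP.cast_eq_zero_iff k p]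
      exact hd
    rw [h1.resolve_right h2, sub_zero]

/-- With `δ = dualGen`, the two functionals restrict to `δ` and `δ ^ (p - 1) / (p - 1)!` on
`O(α_p)`, and `δ ^ p = 0`. By contrast the product is 1 on `x`, so it detects that `x` is not
primitive. -/
lemma dualCoef_mul_ofAlphaP (z : AlphaP k p) :
    (dualCoef k p p * dualCoef k p (p * (p - 1))) (ofAlphaP k p z) = 0 := by
  have hp := (Fact.out : p.Prime).two_le
  have hval : ∀ n < p, ∀ j, dualMap (ofAlphaP k p) (dualCoef k p (p * n)) (AlphaP.gen k p ^ j) =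
      if n = j then 1 else 0 := fun n hn j => by
    rw [dualMap_apply, map_pow (ofAlphaP k p), ofAlphaP_gen, ← pow_mul,
      dualCoef_gen_pow (by rw [sq]; exact Nat.mul_lt_mul_of_pos_left hn (by omega))]
    simp only [Nat.mul_right_inj (show p ≠ 0 by omega)]
  have h1 : dualMap (ofAlphaP k p) (dualCoef k p p) = AlphaP.dualGen k p := by
    refine (CartierDual.equivDual k (AlphaP k p)).injective (AlphaP.linearMap_ext fun j => ?_)
    have h := hval 1 (by omega) j
    have h' := AlphaP.dualGen_pow_apply (k := k) (p := p) 1 j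
    rw [mul_one] at h
    rw [pow_one, Nat.factorial_one, Nat.cast_one] at h'
    exact h.trans h'.symm
  have h2 : ((p - 1).factorial : k) • dualMap (ofAlphaP k p) (dualCoef k p (p * (p - 1))) =
      AlphaP.dualGen k p ^ (p - 1) := by
    refine (CartierDual.equivDual k (AlphaP k p)).injective (AlphaP.linearMap_ext fun j => ?_)
    rw [equivDual_apply, equivDual_apply, AlphaP.dualGen_pow_apply, dual_smul_apply,
      hval _ (by omega)]
    simp
  have h3 : ((p - 1).factorial : k) ≠ 0 := by
    rw [Ne, CharP.cast_eq_zero_iff k p, (Fact.out : p.Prime).dvd_factorial]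
    omega
  have h4 : dualMap (ofAlphaP k p) (dualCoef k p p * dualCoef k p (p * (p - 1))) = 0 := by
    refine smul_right_injective _ h3 ?_
    change ((p - 1).factorial : k) • _ = ((p - 1).factorial : k) • _
    rw [map_mul, h1, ← mul_smul_comm, h2, mul_pow_sub_one (by omega), AlphaP.dualGen_pow, smul_zero]
  rw [← dualMap_apply, h4, dual_zero_apply]

lemma lt_sq : p < p ^ 2 := by
  have hp := (Fact.out : p.Prime).two_le
  rw [sq]
  exact lt_mul_of_one_lt_left (by omega) (by omega)

lemma mul_pred_lt_sq : p * (p - 1) < p ^ 2 := by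
  have hp := (Fact.out : p.Prime).two_le
  rw [sq]
  exact Nat.mul_lt_mul_of_pos_left (by omega) (by omega)

lemma dualCoef_one {n : ℕ} (hn : n < p ^ 2) (h : n ≠ 0) : dualCoef k p n 1 = 0 := by
  rw [← pow_zero (gen k p), dualCoef_gen_pow hn, if_neg h]

lemma dualCoef_mul_gen :
    (dualCoef k p p * dualCoef k p (p * (p - 1))) (gen k p) = 1 := by
  have hp := (Fact.out : p.Prime).two_le
  have hlt := mul_pred_lt_sq (p := p)
  have hlt' := lt_sq (p := p)
  have h0 := dualCoef_one (k := k) hlt' (by omega)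
  have h0' := dualCoef_one (k := k) hlt (Nat.mul_ne_zero (by omega) (by omega))
  rw [dualPairing_comul_gen, h0, h0', mul_zero, zero_mul, add_zero, zero_add,
    Finset.sum_eq_single 1]
  · rw [Nat.choose_one_right, Nat.div_self (by omega), pow_one, ← pow_mul, dualCoef_gen_pow hlt',
      dualCoef_gen_pow hlt, if_pos rfl, if_pos rfl]
    simp
  · intro i hi hi1
    rw [← pow_mul, dualCoef_gen_pow hlt', if_neg, zero_mul, mul_zero]
    intro h
    exact hi1 (Nat.eq_of_mul_eq_mul_left (by omega) (h.symm.trans (mul_one p).symm))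
  · intro h
    exact absurd (Finset.mem_Ioo.2 ⟨by omega, by omega⟩) h

/-- After its linear term is subtracted, `v` has derivative 0 and comes from `O(α_p)`. Testing
primitivity on the product of `dualCoef k p p` and `dualCoef k p (p * (p - 1))` shows that the
linear term is 0, and the primitive elements of `O(α_p)` are known. -/
lemma prim_eq {v : I11 k p} (hv : IsPrim k v) : ∃ c : k, v = c • gen k p ^ p := by
  have hp := (Fact.out : p.Prime).two_le
  have hlt := mul_pred_lt_sq (p := p)
  have hlt' := lt_sq (p := p)
  have h0 := dualCoef_one (k := k) hlt' (by omega)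
  have h0' := dualCoef_one (k := k) hlt (Nat.mul_ne_zero (by omega) (by omega))
  obtain ⟨z, hz⟩ := mem_range_ofAlphaP (y := v - dualCoef k p 1 v • gen k p)
    (dual_sep k fun φ => by
      rw [map_sub, Derivation.map_smul, primDer_gen, dualCoef_gen, map_one, map_sub, map_smul, apply_primDer,
        isPrim_iff.1 hv, isPrim_dualCoef.apply_one, smul_eq_mul]
      ring)
  have h1 := isPrim_iff.1 hv (dualCoef k p p) (dualCoef k p (p * (p - 1)))
  rw [h0, h0', mul_zero, zero_mul, add_zero, eq_add_of_sub_eq hz.symm, map_add,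
    dualCoef_mul_ofAlphaP, zero_add, map_smul, dualCoef_mul_gen, smul_eq_mul, mul_one] at h1
  rw [h1, zero_smul, sub_zero] at hz
  obtain ⟨c, hc⟩ := AlphaP.prim_eq (isPrim_of_map (ofAlphaP_injective (k := k) (p := p))
    (b := z) (by rw [hz]; exact hv))
  exact ⟨c, by rw [← hz, hc, map_smul, ofAlphaP_gen]⟩

/-- A point of the dual vanishes on the nilpotent element `dualCoef k p 1`, so the invariant
derivative of `t`, which is that value times `t`, is 0; hence `t` comes from `O(α_p)`. -/
lemma groupLike_eq_one {t : I11 k p} (ht : IsGroupLikeElem k t) : t = 1 := by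
  have h1 : dualCoef k p 1 t = 0 := by
    have h2 : (groupLikePoint ht (dualCoef k p 1)) ^ p = 0 := by
      rw [← map_pow, prim_dual_pow_eq_zero isPrim_dualCoef, map_zero]
    exact pow_eq_zero_iff (Fact.out : p.Prime).ne_zero |>.1 h2
  obtain ⟨z, hz⟩ := mem_range_ofAlphaP (y := t) (dual_sep k fun φ => by
    rw [apply_primDer, (isGroupLike_iff.1 ht).2, h1, mul_zero])
  have hg : IsGroupLikeElem k z :=
    isGroupLike_of_map (ofAlphaP_injective (k := k) (p := p)) (by rw [hz]; exact ht)
  rw [← hz, AlphaP.groupLike_eq_one hg, map_one]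

end I11

end I11Prim

/-! ### Group-like elements of the dual of a `BT_1` -/

section GroupLike

variable {k : Type u} [Field k] {p : ℕ} [Fact p.Prime] [CharP k p]
variable {A : Type v} [CommRing A] [HopfAlgebra k A] [Coalgebra.IsCocomm k A] [Module.Finite k A]

/-- The power of a point in the ring `CartierDual k A` is its multiple in the group, so a point of a
group killed by `p` has `p`-th power 1. -/
lemma groupLike_pow_apply {g : CartierDual k A} (hg : IsGroupLikeElem k g) (n : ℕ) (a : A) :
    (g ^ n) a = g (((WithConv.toConv (AlgHom.id k A)) ^ n) a) := by
  induction n generalizing a with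
  | zero =>
    rw [pow_zero, pow_zero, dual_one_apply]
    refine Eq.symm ((congrArg g (Algebra.algebraMap_eq_smul_one _)).trans ?_)
    rw [map_smul, (isGroupLike_dual_iff.1 hg).1, smul_eq_mul, mul_one]
    rfl
  | succ n ih =>
    rw [pow_succ, pow_succ, AlgHom.convMul_apply, dual_mul_eq]
    generalize comul (R := k) a = w
    induction w with
    | zero => simp
    | add x y hx hy => simp only [map_add, hx, hy]
    | tmul a b =>
      rw [dualPairing_tmul, ih]
      simp [(isGroupLike_dual_iff.1 hg).2]

lemma IsBT1.groupLike_pow [IsAlgClosed k] (hG : IsBT1 k p A) {g : CartierDual k A}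
    (hg : IsGroupLikeElem k g) : g ^ p = 1 := by
  ext a
  rw [groupLike_pow_apply hg, hG.killed, dual_one_apply]
  refine (congrArg g (Algebra.algebraMap_eq_smul_one _)).trans ?_
  rw [map_smul, (isGroupLike_dual_iff.1 hg).1, smul_eq_mul, mul_one]
  rfl

lemma groupLike_mul_apply_prim {g h : CartierDual k A} (hg : IsGroupLikeElem k g)
    (hh : IsGroupLikeElem k h) {x : A} (hx : IsPrim k x) : (g * h) x = g x + h x := by
  rw [isPrim_iff.1 hx, (isGroupLike_dual_iff.1 hg).1, (isGroupLike_dual_iff.1 hh).1, mul_one,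
    one_mul]

lemma groupLike_pow_apply_prim {g : CartierDual k A} (hg : IsGroupLikeElem k g) (n : ℕ)
    {x : A} (hx : IsPrim k x) : (g ^ n) x = n * g x := by
  induction n with
  | zero => rw [pow_zero, dual_one_apply, hx.counit, Nat.cast_zero, zero_mul]
  | succ n ih =>
    rw [pow_succ, groupLike_mul_apply_prim (hg.pow (n := n)) hg hx, ih, Nat.cast_succ]
    ring

lemma groupLike_prod_apply_prim {ι : Type*} (s : Finset ι) {g : ι → CartierDual k A}
    (hg : ∀ i, IsGroupLikeElem k (g i)) {x : A} (hx : IsPrim k x) :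
    IsGroupLikeElem k (∏ i ∈ s, g i) ∧ (∏ i ∈ s, g i) x = ∑ i ∈ s, g i x := by
  classical
  induction s using Finset.induction_on with
  | empty =>
    rw [Finset.prod_empty, Finset.sum_empty, dual_one_apply, hx.counit]
    exact ⟨IsGroupLikeElem.one, rfl⟩
  | insert i s hi ih =>
    rw [Finset.prod_insert hi, Finset.sum_insert hi,
      groupLike_mul_apply_prim (hg i) ih.1 hx, ih.2]
    exact ⟨(hg i).mul ih.1, rfl⟩

lemma eq_zero_of_isNilpotent_of_fixed {B : Type*} [CommRing B] (hp : 1 < p) {y : B}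
    (hy : IsNilpotent y) (h : y ^ p = y) : y = 0 := by
  obtain ⟨m, hm⟩ := hy
  have h1 : ∀ n : ℕ, y ^ p ^ n = y := fun n => by
    induction n with
    | zero => rw [pow_zero, pow_one]
    | succ n ih => rw [pow_succ, pow_mul, ih, h]
  rw [← h1 m]
  exact pow_eq_zero_of_le (Nat.lt_pow_self hp).le hm

variable [IsAlgClosed k]

/-- Independent primitive elements fixed by the `p`-power map take arbitrary values in `𝔽_p` at
the points. -/
lemma exists_groupLike_apply {ι : Type*} [Fintype ι] {x : ι → A} (hx : ∀ i, IsPrim k (x i))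
    (hxp : ∀ i, x i ^ p = x i) (hli : LinearIndependent k x) (e : ι → ZMod p) :
    ∃ g : CartierDual k A, IsGroupLikeElem k g ∧ ∀ i, g (x i) = zmodHom k p (e i) := by
  classical
  let S : Submodule (ZMod p) (ι → ZMod p) :=
    { carrier := {e | ∃ g : CartierDual k A, IsGroupLikeElem k g ∧
        ∀ i, g (x i) = zmodHom k p (e i)}
      add_mem' := by
        rintro e e' ⟨g, hg, he⟩ ⟨g', hg', he'⟩
        refine ⟨g * g', hg.mul hg', fun i => ?_⟩
        rw [groupLike_mul_apply_prim hg hg' (hx i), he, he', Pi.add_apply, map_add]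
      zero_mem' := ⟨1, IsGroupLikeElem.one, fun i => by
        rw [dual_one_apply, (hx i).counit, Pi.zero_apply, map_zero]⟩
      smul_mem' := by
        rintro c e ⟨g, hg, he⟩
        refine ⟨g ^ c.val, hg.pow, fun i => ?_⟩
        rw [groupLike_pow_apply_prim hg _ (hx i), he, Pi.smul_apply, smul_eq_mul, map_mul,
          ← map_natCast (zmodHom k p), ZMod.natCast_zmod_val] }
  suffices h : S = ⊤ by
    have : e ∈ S := h ▸ Submodule.mem_top
    exact this
  by_contra hS
  obtain ⟨f, hf0, hf⟩ := Submodule.exists_le_ker_of_lt_top S (lt_top_iff_ne_top.2 hS)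
  -- If the value vectors at the points do not fill `𝔽_p^ι`, a linear form with coefficients `n`
  -- kills them all. Then `∑ n i • x i` vanishes at every point, so it is nilpotent; being fixed by
  -- the `p`-power map, it is 0, against independence.
  let n : ι → ZMod p := fun i => f (Pi.single i 1)
  have hfe : ∀ e, f e = ∑ i, e i * n i := fun e => by
    conv_lhs => rw [pi_eq_sum_univ' e]
    rw [map_sum]
    refine Finset.sum_congr rfl fun i _ => ?_
    rw [map_smul, smul_eq_mul]
  have hnil : IsNilpotent (∑ i, zmodHom k p (n i) • x i) := by
    refine isNilpotent_of_forall_point (k := k) fun χ => ?_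
    have h1 : ∀ i, ∃ m, zmodHom k p m = χ (x i) := fun i =>
      exists_zmodHom_eq p (by rw [← map_pow, hxp])
    choose e he using h1
    have h2 : e ∈ S := ⟨pointDual χ, isGroupLike_pointDual χ, fun i => (he i).symm⟩
    have h3 : f e = 0 := hf h2
    rw [map_sum, ← map_zero (zmodHom k p), ← h3, hfe, map_sum]
    refine Finset.sum_congr rfl fun i _ => ?_
    rw [map_smul, smul_eq_mul, map_mul, he, mul_comm]
  have hzero := eq_zero_of_isNilpotent_of_fixed (Fact.out : p.Prime).one_lt hnil (by
    rw [fixed_sum_pow hxp]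
    simp only [zmodHom_pow])
  have hn : ∀ i, n i = 0 := fun i => by
    have h := Fintype.linearIndependent_iff.1 hli _ hzero i
    exact (map_eq_zero (zmodHom k p)).1 h
  exact hf0 (LinearMap.ext fun e => by rw [hfe]; simp [hn])

end GroupLike

/-! ### The comparison with the standard group scheme -/

section Frame

section Instances

variable {k : Type u} [Field k] {p : ℕ} [Fact p.Prime] [CharP k p] (n : ℕ)

instance : Coalgebra.IsCocomm k (I11Pow k p n) :=
  groupPow.isCocomm (CommHopfAlgCat.of k (I11 k p)) n

instance : Module.Finite k (I11Pow k p n) :=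
  groupPow.finite (CommHopfAlgCat.of k (I11 k p)) n

instance : Coalgebra.IsCocomm k (ordinaryPow k p n) :=
  groupPow.isCocomm (CommHopfAlgCat.of k (ConstZp k p ⊗[k] MuP k p)) n

instance : Module.Finite k (ordinaryPow k p n) :=
  groupPow.finite (CommHopfAlgCat.of k (ConstZp k p ⊗[k] MuP k p)) n

lemma finrank_I11Pow : Module.finrank k (I11Pow k p n) = p ^ (2 * n) := by
  rw [pow_mul, ← I11.finrank_eq (k := k)]
  exact groupPow.finrank_eq (CommHopfAlgCat.of k (I11 k p)) n

lemma finrank_ordinaryPow : Module.finrank k (ordinaryPow k p n) = p ^ (2 * n) := by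
  have h : Module.finrank k (ConstZp k p ⊗[k] MuP k p) = p ^ 2 := by
    rw [Module.finrank_tensorProduct, ← finrank_dual (k := k) (A := MuP k p), ConstZp.finrank_eq, sq]
  rw [pow_mul, ← h]
  exact groupPow.finrank_eq (CommHopfAlgCat.of k (ConstZp k p ⊗[k] MuP k p)) n

end Instances

variable (k : Type u) [Field k] (p : ℕ) [Fact p.Prime] [CharP k p] (D : Type w) [CommRing D]
  [HopfAlgebra k D] (f a : ℕ)

/-- Elements of a Hopf algebra `D` that define a homomorphism to `D` from the coordinate ring of
`(ℤ/p ⊕ μ_p)^f ⊕ I_{1,1}^a`. -/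
structure Frame where
  /-- The images of the tautological functions on the factors `ℤ/p`. -/
  u : Fin f → D
  /-- The images of the characters of the factors `μ_p`. -/
  g : Fin f → D
  /-- The images of the coordinates of the factors `I_{1,1}`. -/
  b : Fin a → D
  prim_u : ∀ i, IsPrim k (u i)
  u_pow : ∀ i, u i ^ p = u i
  groupLike_g : ∀ i, IsGroupLikeElem k (g i)
  g_pow : ∀ i, g i ^ p = 1
  isWitt_b : ∀ j, IsWitt k p (b j ^ p) (b j)
  prim_b_pow : ∀ j, IsPrim k (b j ^ p)
  b_pow_pow : ∀ j, (b j ^ p) ^ p = 0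

namespace Frame

variable {k p D f a} (X : Frame k p D f a)

/-- The homomorphism on the factors `(ℤ/p ⊕ μ_p)^f`. -/
def ordHom : ordinaryPow k p f →ₐc[k] D :=
  groupPow.powHom (B := CommHopfAlgCat.of k (ConstZp k p ⊗[k] MuP k p)) fun i =>
    tensorLift (ConstZp.liftPrim (X.u i) (X.prim_u i) (X.u_pow i))
      (MuP.liftGroupLike (X.g i) (X.groupLike_g i) (X.g_pow i))

/-- The homomorphism on the factors `I_{1,1}^a`. -/
def wittHom : I11Pow k p a →ₐc[k] D :=
  groupPow.powHom (B := CommHopfAlgCat.of k (I11 k p)) fun j =>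
    I11.liftWitt (X.b j) (X.isWitt_b j) (X.b_pow_pow j)
      ((X.isWitt_b j).counit (X.prim_b_pow j).counit)

/-- The homomorphism given by a frame. -/
def hom : ordinaryPow k p f ⊗[k] I11Pow k p a →ₐc[k] D := tensorLift X.ordHom X.wittHom

lemma exists_ordHom_prim {v : ordinaryPow k p f} (hv : IsPrim k v) :
    ∃ α : Fin f → k, X.ordHom v = ∑ i, α i • X.u i ∧ ((∀ i, α i = 0) → v = 0) := by
  obtain ⟨w, hw, hF, h0⟩ := groupPow.exists_powHom_prim
    (B := CommHopfAlgCat.of k (ConstZp k p ⊗[k] MuP k p)) (D := D) hv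
  have h1 : ∀ i, ∃ α : k, tensorFst k (ConstZp k p) (MuP k p) (w i) = α • ConstZp.delta k p :=
    fun i => ConstZp.prim_eq (IsPrim.map (tensorFst k (ConstZp k p) (MuP k p)) (hw i))
  have h2 : ∀ i, tensorSnd k (ConstZp k p) (MuP k p) (w i) = 0 := fun i =>
    MuP.prim_eq_zero (IsPrim.map (tensorSnd k (ConstZp k p) (MuP k p)) (hw i))
  choose α hα using h1
  refine ⟨α, (hF _).trans (Finset.sum_congr rfl fun i _ => ?_), fun h => h0 fun i => ?_⟩
  · refine (IsPrim.tensorLift_apply _ _ (hw i)).trans ?_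
    rw [hα, h2, map_zero, add_zero, map_smul, ConstZp.liftPrim_delta]
  · refine (IsPrim.tensor_eq (hw i)).trans ?_
    rw [hα, h2, h, zero_smul, map_zero, map_zero, add_zero]

lemma exists_ordHom_groupLike {t : ordinaryPow k p f} (ht : IsGroupLikeElem k t) :
    ∃ n : Fin f → ZMod p, X.ordHom t = ∏ i, X.g i ^ (n i).val ∧ ((∀ i, n i = 0) → t = 1) := by
  obtain ⟨s, hs, hF, h1⟩ := groupPow.exists_powHom_groupLike
    (B := CommHopfAlgCat.of k (ConstZp k p ⊗[k] MuP k p)) (D := D) ht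
  have h2 : ∀ i, tensorFst k (ConstZp k p) (MuP k p) (s i) = 1 := fun i =>
    ConstZp.groupLike_eq_one (IsGroupLikeElem.map (tensorFst k (ConstZp k p) (MuP k p)) (hs i))
  have h3 : ∀ i, ∃ n : Multiplicative (ZMod p), MonoidAlgebra.single n 1 =
      tensorSnd k (ConstZp k p) (MuP k p) (s i) := fun i =>
    MonoidAlgebra.isGroupLikeElem_iff_mem_range_single_one.1
      (IsGroupLikeElem.map (tensorSnd k (ConstZp k p) (MuP k p)) (hs i))
  choose n hn using h3
  refine ⟨fun i => Multiplicative.toAdd (n i),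
    (hF _).trans (Finset.prod_congr rfl fun i _ => ?_), fun h => h1 fun i => ?_⟩
  · refine (tensorLift_groupLike _ _ (hs i)).trans ?_
    rw [h2, map_one, one_mul, ← hn, MuP.liftGroupLike_single]
  · refine (tensor_groupLike_eq (hs i)).trans ?_
    have hni : n i = 1 := h i
    rw [h2, ← hn, hni, ← MonoidAlgebra.one_def, map_one, map_one, mul_one]

lemma exists_wittHom_prim {v : I11Pow k p a} (hv : IsPrim k v) :
    ∃ β : Fin a → k, X.wittHom v = ∑ j, β j • X.b j ^ p ∧ ((∀ j, β j = 0) → v = 0) := by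
  obtain ⟨w, hw, hF, h0⟩ := groupPow.exists_powHom_prim
    (B := CommHopfAlgCat.of k (I11 k p)) (D := D) hv
  have h1 : ∀ j, ∃ β : k, (w j : I11 k p) = β • I11.gen k p ^ p := fun j => I11.prim_eq (hw j)
  choose β hβ using h1
  refine ⟨β, (hF _).trans (Finset.sum_congr rfl fun j _ => ?_), fun h => h0 fun j => ?_⟩
  · refine (congrArg (I11.liftWitt _ _ _ _) (hβ j)).trans ?_
    rw [map_smul, map_pow, I11.liftWitt_gen]
  · refine (hβ j).trans ?_
    rw [h, zero_smul]

/-- The `p`-power map separates the `u` part of a primitive element from its `b ^ p` part.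
Group-like elements come only from the characters of the factors `μ_p`. -/
lemma hom_injective [IsAlgClosed k] [Coalgebra.IsCocomm k D] [Module.Finite k D]
    (hu : LinearIndependent k X.u) (hb : LinearIndependent k fun j => X.b j ^ p)
    (hg : ∀ n : Fin f → ZMod p, ∏ i, X.g i ^ (n i).val = 1 → ∀ i, n i = 0) :
    Function.Injective X.hom := by
  refine injective_of_prim_groupLike X.hom (fun v hv h => ?_) fun t ht h => ?_
  · obtain ⟨α, hα, hα0⟩ := X.exists_ordHom_prim (hv.map (tensorFst k _ _))
    obtain ⟨β, hβ, hβ0⟩ := X.exists_wittHom_prim (hv.map (tensorSnd k _ _))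
    have h1 := (IsPrim.tensorLift_apply X.ordHom X.wittHom hv).symm.trans h
    rw [hα, hβ] at h1
    have h2 : (∑ j, β j • X.b j ^ p) ^ p = 0 := by
      rw [sum_pow_p (k := k) p]
      exact Finset.sum_eq_zero fun j _ => by rw [smul_pow, X.b_pow_pow, smul_zero]
    have h3 : (∑ i, α i • X.u i) ^ p = 0 := by
      have h4 := congrArg (· ^ p) h1
      simp only [add_pow_p k p, h2, add_zero, zero_pow (Fact.out : p.Prime).ne_zero] at h4
      exact h4
    have h4 := fixed_sum_eq_zero X.u_pow hu h3
    rw [Finset.sum_eq_zero fun i _ => by rw [h4, zero_smul], zero_add] at h1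
    rw [hv.tensor_eq, hα0 h4, hβ0 (Fintype.linearIndependent_iff.1 hb _ h1), map_zero, map_zero,
      add_zero]
  · obtain ⟨n, hn, hn1⟩ := X.exists_ordHom_groupLike (ht.map (tensorFst k _ _))
    have h1 : tensorSnd k (ordinaryPow k p f) (I11Pow k p a) t = 1 :=
      groupPow.groupLike_eq_one (fun s hs => I11.groupLike_eq_one hs) (ht.map (tensorSnd k _ _))
    have h2 := (tensorLift_groupLike X.ordHom X.wittHom ht).symm.trans h
    rw [h1, map_one, mul_one, hn] at h2
    rw [tensor_groupLike_eq ht, h1, hn1 (hg n h2), map_one, map_one, mul_one]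

end Frame

end Frame

/-! ### The comparison for a `BT_1` with maximal `a`-number -/

section Comparison

variable {k : Type u} [Field k] [IsAlgClosed k] {p : ℕ} [Fact p.Prime] [CharP k p]
variable {A : Type v} [CommRing A] [HopfAlgebra k A] [Coalgebra.IsCocomm k A] [Module.Finite k A]

theorem IsBT1.exists_frame (hG : IsBT1 k p A) (ψ : CartierDual k A ≃ₐc[k] A)
    (h : pRank k p A + aNumber k p A = Module.finrank k (primSubmodule k (CartierDual k A))) :
    ∃ X : Frame k p (CartierDual k A) (pRank k p A) (aNumber k p A),
      LinearIndependent k X.u ∧ Function.Bijective X.hom := by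
  classical
  obtain ⟨u, hu, hup, hli, -⟩ := exists_fixed_basis k p A
  obtain ⟨b, hb, hbn, hbli⟩ := hG.exists_witt_basis ψ h
  have hx : ∀ i, IsPrim k (ψ (u i)) := fun i => (hu i).map ψ
  have hxp : ∀ i, ψ (u i) ^ p = ψ (u i) := fun i => by rw [← map_pow, hup]
  have hxli : LinearIndependent k fun i => ψ (u i) :=
    hli.map' ((ψ : CartierDual k A →ₐc[k] A) : CartierDual k A →ₗ[k] A)
      (LinearMap.ker_eq_bot.2 ψ.injective)
  -- The points `g i` are dual to the functions `ψ (u l)`; evaluating a product of powers of the `g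
  -- i` there recovers the exponents, so the `g i` are independent.
  choose g hg hgx using fun i => exists_groupLike_apply hx hxp hxli (Pi.single i (1 : ZMod p))
  let X : Frame k p (CartierDual k A) (pRank k p A) (aNumber k p A) :=
    { u := u
      g := g
      b := b
      prim_u := hu
      u_pow := hup
      groupLike_g := hg
      g_pow := fun i => hG.groupLike_pow (hg i)
      isWitt_b := hb
      prim_b_pow := fun j => (hbn j).1
      b_pow_pow := fun j => (hbn j).2 }
  have hinj : Function.Injective X.hom := X.hom_injective hli hbli fun n hn l => by
    have h1 := (groupLike_prod_apply_prim Finset.univ (g := fun i => g i ^ (n i).val)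
      (fun i => (hg i).pow) (hx l)).2
    rw [show ∏ i, g i ^ (n i).val = 1 from hn, dual_one_apply, (hx l).counit,
      Finset.sum_eq_single l, groupLike_pow_apply_prim (hg l) _ (hx l), hgx, Pi.single_eq_same,
      map_one, mul_one, ← map_natCast (zmodHom k p), ZMod.natCast_zmod_val] at h1
    · exact (map_eq_zero (zmodHom k p)).1 h1.symm
    · intro i _ hil
      rw [groupLike_pow_apply_prim (hg i) _ (hx l), hgx, Pi.single_eq_of_ne hil.symm, map_zero,
        mul_zero]
    · intro hl
      exact absurd (Finset.mem_univ l) hl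
  have hdim : Module.finrank k (ordinaryPow k p (pRank k p A) ⊗[k] I11Pow k p (aNumber k p A)) =
      Module.finrank k (CartierDual k A) := by
    rw [Module.finrank_tensorProduct, finrank_ordinaryPow, finrank_I11Pow, ← pow_add, ← mul_add,
      h, finrank_dual, hG.finrank_eq ψ]
  exact ⟨X, hli, hinj, (LinearMap.injective_iff_surjective_of_finrank_eq_finrank
    (f := (X.hom : _ →ₗ[k] CartierDual k A)) hdim).1 hinj⟩

lemma groupLike_dual_I11Pow {s : ℕ} {t : CartierDual k (I11Pow k p s)}
    (ht : IsGroupLikeElem k t) : t = 1 := by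
  ext y
  exact DFunLike.congr_fun (groupPow.point_eq (B := CommHopfAlgCat.of k (I11 k p))
    (fun χ => I11.point_eq χ) (pointOf ht)) y

lemma prim_dual_I11Pow_pow {s : ℕ} {v : CartierDual k (I11Pow k p s)} (hv : IsPrim k v) :
    v ^ p = 0 :=
  groupPow.prim_dual_pow_eq_zero (B := CommHopfAlgCat.of k (I11 k p)) p
    (fun _ hw => I11.prim_dual_pow_eq_zero hw) hv

lemma prim_I11Pow_pow {s : ℕ} {v : I11Pow k p s} (hv : IsPrim k v) : v ^ p = 0 :=
  groupPow.prim_pow_eq_zero (B := CommHopfAlgCat.of k (I11 k p)) p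
    (fun w hw => by
      obtain ⟨c, hc⟩ := I11.prim_eq (k := k) (p := p) hw
      rw [hc]
      exact (smul_pow _ _ _).trans (by rw [I11.gen_pow, smul_zero])) hv

lemma le_finrank_prim_dual_I11Pow (s : ℕ) :
    s ≤ Module.finrank k (primSubmodule k (CartierDual k (I11Pow k p s))) := by
  refine le_trans ?_ (groupPow.mul_finrank_prim_dual_le (B := CommHopfAlgCat.of k (I11 k p)) s)
  exact Nat.le_mul_of_pos_right s (I11.finrank_prim_dual_pos (k := k) (p := p))

/-- The map on tangent spaces given by a homomorphism from a power of `I_{1,1}`. -/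
def primDualMap {s : ℕ} (q : A →ₐc[k] I11Pow k p s) :
    primSubmodule k (CartierDual k (I11Pow k p s)) →ₗ[k] nilPrim k p A where
  toFun v := ⟨dualMap q (v : CartierDual k (I11Pow k p s)), v.2.map (dualMap q), by
    rw [← map_pow, prim_dual_I11Pow_pow v.2, map_zero]⟩
  map_add' _ _ := Subtype.ext (map_add (dualMap q) _ _)
  map_smul' c _ := Subtype.ext (map_smul (dualMap q) c _)

lemma primDualMap_injective {s : ℕ} {q : A →ₐc[k] I11Pow k p s} (hq : Function.Surjective q) :
    Function.Injective (primDualMap q) := fun _ _ h =>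
  Subtype.ext (dualMap_injective hq (congrArg Subtype.val h))

lemma le_aNumber {s : ℕ} {q : A →ₐc[k] I11Pow k p s} (hq : Function.Surjective q) :
    s ≤ aNumber k p A := by
  rw [← finrank_nilPrim]
  exact (le_finrank_prim_dual_I11Pow s).trans
    (LinearMap.finrank_le_finrank_of_injective (primDualMap_injective hq))

/-- The homomorphism of a factor to its dual induced by a polarization. -/
def factorPolarization {s : ℕ} (ψ : CartierDual k A →ₐc[k] A) (q : A →ₐc[k] I11Pow k p s) :
    CartierDual k (I11Pow k p s) →ₐc[k] I11Pow k p s :=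
  (q.comp ψ).comp (dualMap q)

lemma factorPolarization_apply {s : ℕ} (ψ : CartierDual k A →ₐc[k] A) (q : A →ₐc[k] I11Pow k p s)
    (φ : CartierDual k (I11Pow k p s)) :
    factorPolarization ψ q φ = q (ψ (dualMap q φ)) := rfl

lemma isPolarizedFactor_iff {s : ℕ} (ψ : CartierDual k A →ₐc[k] A) (q : A →ₐc[k] I11Pow k p s) :
    IsPolarizedFactor ψ s q ↔
      Function.Surjective q ∧ Function.Bijective (factorPolarization ψ q) := by
  have h : (fun φ : Module.Dual k (I11Pow k p s) =>
      q (ψ ((CartierDual.equivDual k A).symm (φ ∘ₗ (q : A →ₗ[k] I11Pow k p s))))) =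
      factorPolarization ψ q ∘ (CartierDual.equivDual k (I11Pow k p s)).symm := rfl
  rw [IsPolarizedFactor, h, (CartierDual.equivDual k (I11Pow k p s)).symm.bijective.of_comp_iff]

lemma bddAbove_polarizedFactor (ψ : CartierDual k A →ₐc[k] A) :
    BddAbove {s : ℕ | ∃ q : A →ₐc[k] I11Pow k p s, IsPolarizedFactor ψ s q} :=
  ⟨aNumber k p A, by rintro s ⟨q, hq, -⟩; exact le_aNumber hq⟩

lemma bijective_of_injective_dual {s : ℕ} {h : CartierDual k (I11Pow k p s) →ₐc[k] I11Pow k p s}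
    (hinj : Function.Injective h) : Function.Bijective h :=
  ⟨hinj, (LinearMap.injective_iff_surjective_of_finrank_eq_finrank
    (f := (h : CartierDual k (I11Pow k p s) →ₗ[k] I11Pow k p s)) finrank_dual).1 hinj⟩

lemma exists_polarizedFactor_zero (ψ : CartierDual k A →ₐc[k] A) :
    ∃ q : A →ₐc[k] I11Pow k p 0, IsPolarizedFactor ψ 0 q := by
  refine ⟨Bialgebra.counitBialgHom k A, (isPolarizedFactor_iff _ _).2 ⟨fun c => ?_, ?_⟩⟩
  · refine ⟨algebraMap k A c, ?_⟩
    exact AlgHom.commutes (Bialgebra.counitAlgHom k A) c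
  · refine bijective_of_injective_dual (injective_of_prim_groupLike _ (fun v hv _ => ?_)
      fun t ht _ => groupLike_dual_I11Pow ht)
    exact groupPow.dual_prim_eq_zero (B := CommHopfAlgCat.of k (I11 k p)) hv

/-- The supremum is attained because the set contains 0 and is bounded by the `a`-number. -/
theorem exists_polarizedFactor_superspecialRank (ψ : CartierDual k A →ₐc[k] A) :
    ∃ q : A →ₐc[k] I11Pow k p (superspecialRank p ψ),
      IsPolarizedFactor ψ (superspecialRank p ψ) q :=
  Nat.sSup_mem ⟨0, exists_polarizedFactor_zero ψ⟩ (bddAbove_polarizedFactor ψ)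

theorem superspecialRank_le (ψ : CartierDual k A →ₐc[k] A) :
    superspecialRank p ψ ≤ aNumber k p A := by
  obtain ⟨q, hq, -⟩ := exists_polarizedFactor_superspecialRank (p := p) ψ
  exact le_aNumber hq

/-- For a frame inducing an isomorphism, the superspecial factor is polarized. -/
lemma Frame.isPolarizedFactor {f a : ℕ} (X : Frame k p (CartierDual k A) f a)
    (hu : LinearIndependent k X.u) (hX : Function.Bijective X.hom)
    (ψ : CartierDual k A ≃ₐc[k] A) :
    ∃ q : A →ₐc[k] I11Pow k p a, IsPolarizedFactor (ψ : CartierDual k A →ₐc[k] A) a q := by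
  let e := BialgEquiv.ofBijective X.hom hX
  let r : CartierDual k A →ₐc[k] I11Pow k p a :=
    (tensorSnd k (ordinaryPow k p f) (I11Pow k p a)).comp
      (e.symm : CartierDual k A →ₐc[k] ordinaryPow k p f ⊗[k] I11Pow k p a)
  have hr : ∀ x, r (X.hom x) = tensorSnd k (ordinaryPow k p f) (I11Pow k p a) x := fun x =>
    congrArg (tensorSnd k (ordinaryPow k p f) (I11Pow k p a)) (e.toEquiv.symm_apply_apply x)
  let q : A →ₐc[k] I11Pow k p a := r.comp (ψ.symm : A →ₐc[k] CartierDual k A)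
  have hq : ∀ x, q (ψ x) = r x := fun x => congrArg r (ψ.toEquiv.symm_apply_apply x)
  have hqs : Function.Surjective q := fun y => by
    obtain ⟨x, hx⟩ := tensorSnd_surjective (k := k) (B := ordinaryPow k p f) y
    exact ⟨ψ (X.hom x), by rw [hq, hr, hx]⟩
  refine ⟨q, (isPolarizedFactor_iff _ _).2 ⟨hqs, bijective_of_injective_dual
    (injective_of_prim_groupLike _ (fun v hv h => ?_) fun t ht _ => groupLike_dual_I11Pow ht)⟩⟩
  have h1 : (dualMap q v) ^ p = 0 := by rw [← map_pow, prim_dual_I11Pow_pow hv, map_zero]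
  obtain ⟨τ, hτ⟩ := hX.2 (dualMap q v)
  have hτP : IsPrim k τ := by
    have h2 : IsPrim k (X.hom τ) := hτ ▸ hv.map (dualMap q)
    exact isPrim_of_map hX.1 h2
  have h2 : tensorSnd k (ordinaryPow k p f) (I11Pow k p a) τ = 0 := by
    rw [← hr, hτ, ← hq]
    exact h
  obtain ⟨α, hα, hα0⟩ := X.exists_ordHom_prim (hτP.map (tensorFst k _ _))
  have h3 := IsPrim.tensorLift_apply X.ordHom X.wittHom hτP
  rw [h2, map_zero, add_zero, hα] at h3
  -- A tangent vector in the kernel of the form has no component in `I_{1,1}^a`, so it is a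
  -- combination of the fixed elements `u`; coming from `I_{1,1}^a`, it also has `p`-th power 0.
  have h4 := fixed_sum_eq_zero X.u_pow hu (c := α) (by rw [← h3, ← h1, ← hτ]; rfl)
  have h5 : τ = 0 := by rw [hτP.tensor_eq, h2, hα0 h4, map_zero, map_zero, add_zero]
  refine dualMap_injective hqs ?_
  rw [← hτ, h5, map_zero, map_zero]

end Comparison

/-! ### The case of maximal superspecial rank -/

section MaximalRank

variable {k : Type u} [Field k] [IsAlgClosed k] {p : ℕ} [Fact p.Prime] [CharP k p]
variable {A : Type v} [CommRing A] [HopfAlgebra k A] [Coalgebra.IsCocomm k A] [Module.Finite k A]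

variable (k p A) in
/-- The `p`-power map on the tangent space. -/
def primFrob : primSubmodule k (CartierDual k A) →ₛₗ[frobenius k p]
    primSubmodule k (CartierDual k A) where
  toFun v := ⟨(v : CartierDual k A) ^ p, v.2.pow_p p⟩
  map_add' _ _ := Subtype.ext (add_pow_p k p _ _)
  map_smul' _ _ := Subtype.ext (smul_pow _ _ _)

/-- If the `p`-power map is injective modulo its kernel then the tangent space splits. -/
lemma finrank_prim_le (h : ∀ v : CartierDual k A, IsPrim k v → (v ^ p) ^ p = 0 → v ^ p = 0) :
    Module.finrank k (primSubmodule k (CartierDual k A)) ≤ pRank k p A + aNumber k p A := by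
  obtain ⟨u, hu, hup, hli, hspan⟩ := exists_fixed_basis k p A
  let N := (nilPrim k p A).comap (primSubmodule k (CartierDual k A)).subtype
  have hN : N ≤ N.comap (primFrob k p A) := fun v hv => by
    refine ⟨v.2.pow_p p, ?_⟩
    change ((v : CartierDual k A) ^ p) ^ p = 0
    rw [show (v : CartierDual k A) ^ p = 0 from hv.2, zero_pow (Fact.out : p.Prime).ne_zero]
  let Φ := N.mapQ N (primFrob k p A) hN
  have hΦ : Function.Injective Φ := by
    rw [injective_iff_map_eq_zero]
    intro x hx
    obtain ⟨v, rfl⟩ := N.mkQ_surjective x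
    have h1 : primFrob k p A v ∈ N := (Submodule.Quotient.mk_eq_zero N).1 hx
    exact (Submodule.Quotient.mk_eq_zero N).2 ⟨v.2, h v v.2 h1.2⟩
  have hfix := span_fixed_eq_top (Fact.out : p.Prime).one_lt (fun _ => rfl) Φ hΦ
  have hle : primSubmodule k (CartierDual k A) ≤
      Submodule.span k (Set.range u) ⊔ nilPrim k p A := by
    let W := (Submodule.span k (Set.range u) ⊔ nilPrim k p A).comap
      (primSubmodule k (CartierDual k A)).subtype
    have hNW : N ≤ W := Submodule.comap_mono le_sup_right
    have h1 : Submodule.span k {x | Φ x = x} ≤ W.map N.mkQ := by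
      refine Submodule.span_le.2 fun x hx => ?_
      obtain ⟨v, rfl⟩ := N.mkQ_surjective x
      have h2 : primFrob k p A v - v ∈ N := (Submodule.Quotient.eq N).1 hx
      -- A class fixed modulo `N` has `v ^ p - v` in the kernel of the `p`-power map, so `v ^ p` is
      -- a representative that is itself fixed.
      refine ⟨primFrob k p A v, Submodule.mem_sup_left (hspan _ (v.2.pow_p p) ?_),
        (Submodule.Quotient.eq N).2 h2⟩
      have h3 : ((v : CartierDual k A) ^ p - v + v) ^ p = ((v : CartierDual k A) ^ p) := by
        rw [add_pow_p k p, show ((v : CartierDual k A) ^ p - v) ^ p = 0 from h2.2, zero_add]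
      rwa [sub_add_cancel] at h3
    intro v hv
    have h2 : N.mkQ ⟨v, hv⟩ ∈ W.map N.mkQ := h1 (hfix ▸ Submodule.mem_top)
    obtain ⟨w, hw, hwv⟩ := h2
    have h3 : w - ⟨v, hv⟩ ∈ N := (Submodule.Quotient.eq N).1 hwv
    have h4 : (⟨v, hv⟩ : primSubmodule k (CartierDual k A)) ∈ W := by
      have h5 := W.sub_mem hw (hNW h3)
      rwa [sub_sub_cancel] at h5
    exact h4
  have h1 := Submodule.finrank_mono hle
  rwa [finrank_span_sup_nilPrim hup hli, Fintype.card_fin] at h1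

/-- By dimension the tangent space of the factor is all of `nilPrim`. If `(v ^ p) ^ p = 0`, then `v
^ p` comes from a tangent vector `c` of the factor. The polarization sends `c` to `(q (ψ v)) ^ p`,
the `p`-th power of a primitive element of `O(I_{1,1}^a)`, hence to 0; so `c = 0` and `v ^ p = 0`.
-/
lemma finrank_prim_le_of_isPolarizedFactor {ψ : CartierDual k A →ₐc[k] A}
    {q : A →ₐc[k] I11Pow k p (aNumber k p A)} (hq : IsPolarizedFactor ψ (aNumber k p A) q) :
    Module.finrank k (primSubmodule k (CartierDual k A)) ≤ pRank k p A + aNumber k p A := by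
  rw [isPolarizedFactor_iff] at hq
  have hinj := primDualMap_injective hq.1
  have hsurj : Function.Surjective (primDualMap q) := by
    refine (LinearMap.injective_iff_surjective_of_finrank_eq_finrank (le_antisymm
      (LinearMap.finrank_le_finrank_of_injective hinj) ?_)).1 hinj
    rw [finrank_nilPrim]
    exact le_finrank_prim_dual_I11Pow _
  refine finrank_prim_le fun v hv hvp => ?_
  obtain ⟨c, hc⟩ := hsurj ⟨v ^ p, hv.pow_p p, hvp⟩
  have hc' : dualMap q (c : CartierDual k (I11Pow k p (aNumber k p A))) = v ^ p :=
    congrArg Subtype.val hc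
  have h1 : factorPolarization ψ q c = 0 := by
    rw [factorPolarization_apply, hc', map_pow, map_pow, prim_I11Pow_pow ((hv.map ψ).map q)]
  have h2 : (c : CartierDual k (I11Pow k p (aNumber k p A))) = 0 :=
    hq.2.1 (h1.trans (map_zero _).symm)
  rw [← hc', h2, map_zero]

theorem IsBT1.exists_equiv (hG : IsBT1 k p A) (ψ : CartierDual k A ≃ₐc[k] A)
    (h : pRank k p A + aNumber k p A = Module.finrank k (primSubmodule k (CartierDual k A))) :
    Nonempty (A ≃ₐc[k] (ordinaryPow k p (pRank k p A) ⊗[k] I11Pow k p (aNumber k p A))) := by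
  obtain ⟨X, -, hX⟩ := hG.exists_frame ψ h
  exact ⟨ψ.symm.trans (BialgEquiv.ofBijective X.hom hX).symm⟩

theorem IsBT1.superspecialRank_eq (hG : IsBT1 k p A) (ψ : CartierDual k A ≃ₐc[k] A)
    (h : pRank k p A + aNumber k p A = Module.finrank k (primSubmodule k (CartierDual k A))) :
    superspecialRank p (ψ : CartierDual k A →ₐc[k] A) = aNumber k p A := by
  obtain ⟨X, hu, hX⟩ := hG.exists_frame ψ h
  exact le_antisymm (superspecialRank_le _)
    (le_csSup (bddAbove_polarizedFactor _) (X.isPolarizedFactor hu hX ψ))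

lemma finrank_prim_of_superspecialRank_eq (ψ : CartierDual k A →ₐc[k] A)
    (h : superspecialRank p ψ = aNumber k p A) :
    pRank k p A + aNumber k p A = Module.finrank k (primSubmodule k (CartierDual k A)) := by
  obtain ⟨q, hq⟩ := exists_polarizedFactor_superspecialRank (p := p) ψ
  refine le_antisymm (pRank_add_aNumber_le k p A) ?_
  revert q
  rw [h]
  exact fun q hq => finrank_prim_le_of_isPolarizedFactor hq

end MaximalRank

end BT1

end


/-! ### The theorem. -/

theorem mainTheorem10 {k : Type*} [Field k] [IsAlgClosed k] (p : ℕ) [Fact p.Prime] [CharP k p]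
    {A : Type*} [CommRing A] [HopfAlgebra k A] [Coalgebra.IsCocomm k A] [Module.Finite k A]
    (hG : BT1.IsBT1 k p A)
    (ψ : BT1.CartierDual k A ≃ₐc[k] A)
    (hψ : BT1.IsAntisymmetric (ψ : BT1.CartierDual k A →ₐc[k] A))
    (g : ℕ) (hg : Module.finrank k A = p ^ (2 * g))
    (f a s : ℕ) (hf : f = BT1.pRank k p A) (ha : a = BT1.aNumber k p A)
    (hs : s = BT1.superspecialRank p (ψ : BT1.CartierDual k A →ₐc[k] A)) :
    ((0 : ℤ) ≤ s ∧ (s : ℤ) ≤ a ∧ (a : ℤ) ≤ g - f) ∧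
    ((a : ℤ) = g - f →
      Nonempty (A ≃ₐc[k] (BT1.ordinaryPow k p f ⊗[k] BT1.I11Pow k p a)) ∧ s = a) ∧
    ((a : ℤ) ≠ g - f → s < a) := by
  subst hf ha hs
  -- Comparing the two expressions for the order of `G` identifies the dimension of the tangent
  -- space with `g`; all three claims are statements about `f + a` and this dimension.
  have hdim : Module.finrank k (BT1.primSubmodule k (BT1.CartierDual k A)) = g := by
    have h := hG.finrank_eq ψ
    rw [hg] at h
    have h1 := Nat.pow_right_injective (Fact.out : p.Prime).two_le h
    omega
  have h1 := BT1.pRank_add_aNumber_le k p A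
  have h2 := BT1.superspecialRank_le (p := p) (ψ : BT1.CartierDual k A →ₐc[k] A)
  refine ⟨⟨by omega, by omega, by omega⟩, fun h => ?_, fun h => ?_⟩
  · have h3 : BT1.pRank k p A + BT1.aNumber k p A =
        Module.finrank k (BT1.primSubmodule k (BT1.CartierDual k A)) := by omega
    exact ⟨hG.exists_equiv ψ h3, hG.superspecialRank_eq ψ h3⟩
  · refine lt_of_le_of_ne h2 fun h3 => ?_
    have h4 := BT1.finrank_prim_of_superspecialRank_eq _ h3
    omega
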